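/- **Setting.** An instance of U-GSC is an undirected (simple) graph $G=(V,E)$ on $n$ nodes and a cost $c>0$. For $S\subseteq V$ let $\deg_S(v)$ be the number of neighbours of $v$ in $S$, $E(S)$ the set of edges with both endpoints in $S$, $E_{\max}=\binom n2$, and $$\mu_p(S)=\Bigl(1-\sum_{i\in S}\frac{c\,E_{\max}}{\deg_S(i)}\Bigr)\frac{|E(S)|}{E_{\max}},$$ where $\mu_p(S)=-\infty$ if $\deg_S(i)=0$ for some $i\in S$, and $\mu_p(\emptyset)=0$. Let $S^*$ maximize $\mu_p$. **The sampling algorithm.** Input: $\epsilon\in(0,1/7]$, $G$, $c$, with $n\ge 2^2 3^4/\epsilon^8$. Put $m=\lceil \frac{3^6}{\epsilon^4}\ln n\rceil$ and $t=\lceil n^{\frac{3^7}{\epsilon^4}\ln\frac3\epsilon}\rceil$. Start a list of contracts with $\emptyset$. In each of $t$ independent iterations draw a multiset $M$ of $m$ nodes uniformly at random with replacement. For every guess $(\kappa,k)$ of the numbers of nodes and edges of the $\frac{\epsilon n}{3}$-core $\tilde S$ of $S^*$ (the unknown set that the sample is meant to hit), with $1\le\kappa\le n$ and $\frac{\epsilon^2n^2}{18}\le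 k\le n^2$, put $\hat d_v=\min(\frac{\kappa}{m}\deg_M(v),n)$, where $\deg_M(v)$ counts the neighbours of $v$ in $M$ with multiplicity, and $H=\{v:\hat d_v\ge\frac13(1-\epsilon)\epsilon n\}$. If the linear program $$\min\sum_{v\in H}\frac{cE_{\max}}{\hat d_v}x_v\quad\text{s.t.}\quad \sum_{v\in H}\hat d_vx_v\ge 2(1-\epsilon)k,\quad \sum_{u\in H,\,uv\in E}x_u\ge\frac{\hat d_v}{1+\epsilon}\ (v\in H),\quad x_v\in[0,1]\ (v\in H)$$ is feasible, take an optimal solution $x^*$ and add to the list the random set that contains each $v\in H$ independently with probability $x^*_v$. Finally output a contract of maximal utility in the list. **Theorem.** 1. There is an absolute constant $C>0$ such that for every $\epsilon\in(0,1/7]$ and every U-GSC instance $(G,c)$ with $n\ge 2^23^4/\epsilon^8$ nodes, whichever optimal solutions of the linear programs are used, the sampling algorithm outputs with probability at least $1-\frac1n$ a set $S$ with $\mu_p(S)\ge\mu_p(S^*)-C\epsilon$. 2. U-GSC has an additive PTAS. There are a randomized algorithm, namely one fixed program of a randomized real RAM that gets $\epsilon$, $G$ and $c$ as input, and an absolute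 constant $C>0$ such that for every $\epsilon\in(0,1/7]$ and every instance $(G,c)$ on $n$ nodes: * if $n\ge 2^23^4/\epsilon^8$, it always halts within $n^{C\log(1/\epsilon)/\epsilon^4}$ steps, and with probability at least $1-\frac1n$ it outputs a set $S$ with $\mu_p(S)\ge\mu_p(S^*)-C\epsilon$; * if $n<2^23^4/\epsilon^8$ (for constant $\epsilon$, only finitely many $n$), it always halts within $2^{C(n+1)}$ steps and outputs a set $S$ with $\mu_p(S)=\mu_p(S^*)$. The machine has registers and indirectly addressed memories for natural numbers (addition, truncated subtraction, comparison) and for real numbers (field operations, comparison, conversion of natural numbers, but no rounding and no real constants in the program), adjacency queries to $G$, uniform random elements of $\{0,\dots,k\}$ and random bits of a given bias; every step has unit cost. The step bound depends on $\epsilon$ and $n$ only. -/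

import Mathlib

open scoped ENNReal

noncomputable section

namespace UGSC

/-! ### The uniform cost graph supermodular contract problem -/

section Problem

variable {V : Type*} [Fintype V]

open Classical in
/-- `deg_S(v)`: the number of neighbours of `v` in `S`. -/
def degIn (G : SimpleGraph V) (S : Finset V) (v : V) : ℕ :=
  (S.filter fun u => G.Adj v u).card

open Classical in
/-- `|E(S)|`: the number of edges of `G` with both endpoints in `S`. -/
def edgesIn (G : SimpleGraph V) (S : Finset V) : ℕ :=
  (Finset.univ.filter fun e : Sym2 V => e ∈ G.edgeSet ∧ ∀ v ∈ e, v ∈ S).card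

/-- `E_max = n choose 2`. -/
def edgeMax (V : Type*) [Fintype V] : ℝ := ((Fintype.card V).choose 2 : ℝ)

open Classical in
/-- The principal's utility
`μ_p(S) = (1 - ∑_{i ∈ S} c E_max / deg_S(i)) (|E(S)| / E_max)`.
The payment needed for an agent with `deg_S(i) = 0` is infinite: a set containing such an
agent cannot be incentivized and has utility `-∞`. -/
def utility (G : SimpleGraph V) (c : ℝ) (S : Finset V) : EReal :=
  if ∀ v ∈ S, 0 < degIn G S v then
    (((1 - ∑ v ∈ S, c * edgeMax V / (degIn G S v : ℝ)) *
      ((edgesIn G S : ℝ) / edgeMax V) : ℝ) : EReal)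
  else ⊥

/-- The utility of `S` is within the additive error `δ` of the maximal utility. -/
def NearOptimal (G : SimpleGraph V) (c δ : ℝ) (S : Finset V) : Prop :=
  ∀ T : Finset V, utility G c T ≤ utility G c S + (δ : EReal)

end Problem

/-! ### Elementary random choices -/

/-- A real number clamped to `[0,1]`, as a probability. -/
def clamp (p : ℝ) : ℝ≥0∞ := min 1 (ENNReal.ofReal p)

theorem clamp_add (p : ℝ) : clamp p + (1 - clamp p) = 1 :=
  add_tsub_cancel_of_le (min_le_left _ _)

/-- A coin that shows `true` with probability `p` (clamped to `[0,1]`). -/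
def coin (p : ℝ) : PMF Bool :=
  PMF.ofFintype (fun b => if b then clamp p else 1 - clamp p)
    (by simp [clamp_add])

open Classical in
/-- Randomized rounding: every `v` is put into the random set independently of the others,
with probability `x v`. -/
def roundSet {V : Type} [Fintype V] (x : V → ℝ) : PMF (Finset V) :=
  PMF.ofFintype
    (fun S => (∏ v ∈ S, clamp (x v)) * ∏ v ∈ Finset.univ \ S, (1 - clamp (x v)))
    (by
      have h := Finset.prod_add (fun v => clamp (x v)) (fun v => 1 - clamp (x v))
        (Finset.univ : Finset V)
      simp only [clamp_add, Finset.prod_const_one, Finset.powerset_univ] at h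
      exact h.symm)

/-! ### The sampling algorithm -/

section Algorithm

variable {V : Type} [Fintype V]

open Classical in
/-- Feasibility for the surrogate linear program on the node set `H`, with the guess `k` for
the number of edges and the degree estimates `d`. -/
structure LPFeasible (G : SimpleGraph V) (ε : ℝ) (H : Finset V) (k : ℕ) (d x : V → ℝ) :
    Prop where
  mem_unit : ∀ v ∈ H, 0 ≤ x v ∧ x v ≤ 1
  outside : ∀ v, v ∉ H → x v = 0
  edges : 2 * (1 - ε) * (k : ℝ) ≤ ∑ v ∈ H, d v * x v
  degrees : ∀ v ∈ H, 1 / (1 + ε) * d v ≤ ∑ u ∈ H.filter (fun u => G.Adj u v), x u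

/-- The objective of the surrogate linear program (the normalized cost is `c E_max`). -/
def lpObjective (c : ℝ) (H : Finset V) (d x : V → ℝ) : ℝ :=
  ∑ v ∈ H, c * edgeMax V / d v * x v

/-- `x` is an optimal solution of the surrogate linear program. -/
def LPOptimal (G : SimpleGraph V) (c ε : ℝ) (H : Finset V) (k : ℕ) (d x : V → ℝ) : Prop :=
  LPFeasible G ε H k d x ∧
    ∀ y, LPFeasible G ε H k d y → lpObjective c H d x ≤ lpObjective c H d y

/-- `solver` returns an optimal solution of every feasible instance of the linear program. -/
def IsLPSolver (G : SimpleGraph V) (c ε : ℝ)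
    (solver : Finset V → ℕ → (V → ℝ) → (V → ℝ)) : Prop :=
  ∀ H k d, (∃ x, LPFeasible G ε H k d x) → LPOptimal G c ε H k d (solver H k d)

/-- The number of nodes in one sample. -/
def sampleSize (n : ℕ) (ε : ℝ) : ℕ := ⌈(3 : ℝ) ^ 6 / ε ^ 4 * Real.log n⌉₊

/-- The number of samples. -/
def numSamples (n : ℕ) (ε : ℝ) : ℕ :=
  ⌈(n : ℝ) ^ ((3 : ℝ) ^ 7 / ε ^ 4 * Real.log (3 / ε))⌉₊

open Classical in
/-- The degree estimate computed from the sample `M`, when the sampled set is guessed to have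
`κ` elements: `min (κ / m * deg_M(v), n)`. -/
def degEstimate (G : SimpleGraph V) {m : ℕ} (M : Fin m → V) (κ : ℕ) (v : V) : ℝ :=
  min ((κ : ℝ) / (m : ℝ) * ((Finset.univ.filter fun j => G.Adj v (M j)).card : ℝ))
    (Fintype.card V : ℝ)

open Classical in
/-- The nodes of high estimated degree. -/
def highDegree (ε : ℝ) (d : V → ℝ) : Finset V :=
  Finset.univ.filter fun v => 1 / 3 * (1 - ε) * ε * (Fintype.card V : ℝ) ≤ d v

open Classical in
/-- The guesses `(κ, k)` for the number `κ` of nodes and the number `k` of edges of the core: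
`1 ≤ κ ≤ n` and `ε² n² / 18 ≤ k ≤ n²`. -/
def guesses (n : ℕ) (ε : ℝ) : List (ℕ × ℕ) :=
  (List.range' 1 n) ×ˢ
    ((List.range (n ^ 2 + 1)).filter fun k : ℕ => ε ^ 2 * (n : ℝ) ^ 2 / 18 ≤ (k : ℝ))

open Classical in
/-- The contract obtained from the sample `M` and the guess `(κ, k)`: solve the linear program
and round its solution (the empty contract if the linear program is infeasible). -/
def candidate (G : SimpleGraph V) (ε : ℝ) (solver : Finset V → ℕ → (V → ℝ) → (V → ℝ))
    {m : ℕ} (M : Fin m → V) (g : ℕ × ℕ) : PMF (Finset V) :=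
  let d := degEstimate G M g.1
  let H := highDegree ε d
  if ∃ x, LPFeasible G ε H g.2 d x then roundSet (solver H g.2 d) else PMF.pure ∅

/-- One iteration: draw a multiset of nodes, uniformly and with replacement, and collect the
contracts for all guesses. -/
def iteration [Nonempty V] (G : SimpleGraph V) (ε : ℝ)
    (solver : Finset V → ℕ → (V → ℝ) → (V → ℝ)) : PMF (List (Finset V)) := do
  let M ← PMF.uniformOfFintype (Fin (sampleSize (Fintype.card V) ε) → V)
  (guesses (Fintype.card V) ε).mapM fun g => candidate G ε solver M g

open Classical in
/-- The whole algorithm, as the distribution of its output: among the empty contract and the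
contracts collected in all the iterations, one of maximal utility is returned. -/
def algorithm [Nonempty V] (G : SimpleGraph V) (c ε : ℝ)
    (solver : Finset V → ℕ → (V → ℝ) → (V → ℝ)) : PMF (Finset V) := do
  let contracts ← (List.range (numSamples (Fintype.card V) ε)).mapM
    fun _ => iteration G ε solver
  pure (((∅ :: contracts.flatten).argmax (utility G c)).getD ∅)

end Algorithm

/-! ### Randomized random access machines with a step count

Programs are finite texts over the instructions below and contain no real constants. There are
finitely many registers in a program and two memories with indirect addressing, for natural
numbers and for real numbers. Natural numbers can only be added and subtracted, real numbers
admit the field operations and comparison (but no rounding). The graph is read through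
adjacency queries. Every step has unit cost. -/

/-- Elementary instructions; the numbers in them are names of registers, except for the value
`k` in `const`. -/
inductive Instr : Type
  | const (a k : ℕ)
  | add (a b d : ℕ)
  | sub (a b d : ℕ)
  | load (a b : ℕ)
  | store (a b : ℕ)
  | cast (a b : ℕ)
  | radd (a b d : ℕ)
  | rsub (a b d : ℕ)
  | rmul (a b d : ℕ)
  | rdiv (a b d : ℕ)
  | rload (a b : ℕ)
  | rstore (a b : ℕ)
  | adj (a b d : ℕ)
  | rand (a b : ℕ)
  | flip (a b : ℕ)

/-- Tests compare two registers. -/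
inductive Test : Type
  | lt (a b : ℕ)
  | rlt (a b : ℕ)

/-- Programs. -/
inductive Prog : Type
  | instr (i : Instr)
  | seq (p q : Prog)
  | ite (t : Test) (p q : Prog)
  | loop (t : Test) (p : Prog)

/-- The contents of the registers and of the two memories. -/
structure Store : Type where
  nreg : ℕ → ℕ
  rreg : ℕ → ℝ
  nmem : ℕ → ℕ
  rmem : ℕ → ℝ

/-- Set the natural number register `a`. -/
def Store.setN (s : Store) (a k : ℕ) : Store := { s with nreg := Function.update s.nreg a k }

/-- Set the real register `a`. -/
def Store.setR (s : Store) (a : ℕ) (r : ℝ) : Store :=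
  { s with rreg := Function.update s.rreg a r }

open Classical in
/-- The effect of an instruction on an input graph with nodes `0, …, n - 1`. -/
def Instr.exec {n : ℕ} (G : SimpleGraph (Fin n)) (s : Store) : Instr → PMF Store
  | const a k => PMF.pure (s.setN a k)
  | add a b d => PMF.pure (s.setN a (s.nreg b + s.nreg d))
  | sub a b d => PMF.pure (s.setN a (s.nreg b - s.nreg d))
  | load a b => PMF.pure (s.setN a (s.nmem (s.nreg b)))
  | store a b => PMF.pure { s with nmem := Function.update s.nmem (s.nreg a) (s.nreg b) }
  | cast a b => PMF.pure (s.setR a (s.nreg b : ℝ))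
  | radd a b d => PMF.pure (s.setR a (s.rreg b + s.rreg d))
  | rsub a b d => PMF.pure (s.setR a (s.rreg b - s.rreg d))
  | rmul a b d => PMF.pure (s.setR a (s.rreg b * s.rreg d))
  | rdiv a b d => PMF.pure (s.setR a (s.rreg b / s.rreg d))
  | rload a b => PMF.pure (s.setR a (s.rmem (s.nreg b)))
  | rstore a b => PMF.pure { s with rmem := Function.update s.rmem (s.nreg a) (s.rreg b) }
  | adj a b d => PMF.pure (s.setN a
      (if ∃ u v : Fin n, (u : ℕ) = s.nreg b ∧ (v : ℕ) = s.nreg d ∧ G.Adj u v then 1 else 0))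
  -- a uniformly random element of `{0, …, k}`, where `k` is the content of register `b`
  | rand a b =>
      (PMF.uniformOfFintype (Fin (s.nreg b + 1))).bind fun j => PMF.pure (s.setN a (j : ℕ))
  -- `1` with probability `x` and `0` otherwise, where `x` is the content of register `b`
  | flip a b => (coin (s.rreg b)).bind fun h => PMF.pure (s.setN a (if h then 1 else 0))

/-- The truth value of a test. -/
def Test.holds (s : Store) : Test → Prop
  | lt a b => s.nreg a < s.nreg b
  | rlt a b => s.rreg a < s.rreg b

/-- A configuration: what remains to be executed, and the current store. The machine has halted
when nothing remains to be executed. -/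
abbrev Config : Type := List Prog × Store

open Classical in
/-- One step of the machine. -/
def step {n : ℕ} (G : SimpleGraph (Fin n)) : Config → PMF Config
  | ([], s) => PMF.pure ([], s)
  | (.instr i :: k, s) => (i.exec G s).bind fun s' => PMF.pure (k, s')
  | (.seq p q :: k, s) => PMF.pure (p :: q :: k, s)
  | (.ite t p q :: k, s) => PMF.pure ((if t.holds s then p else q) :: k, s)
  | (.loop t p :: k, s) => PMF.pure (if t.holds s then p :: .loop t p :: k else k, s)

/-- The distribution of the configuration after `T` steps. -/
def runSteps {n : ℕ} (G : SimpleGraph (Fin n)) : ℕ → Config → PMF Config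
  | 0, a => PMF.pure a
  | T + 1, a => (step G a).bind (runSteps G T)

/-- The initial store: the number of nodes, the error parameter and the cost stand in registers,
everything else is `0`. -/
def initStore (n : ℕ) (ε c : ℝ) : Store where
  nreg a := if a = 0 then n else 0
  rreg a := if a = 0 then ε else if a = 1 then c else 0
  nmem _ := 0
  rmem _ := 0

/-- The distribution of the configuration of the program `P` on the input `(ε, G, c)` after `T`
steps. -/
def Prog.run (P : Prog) {n : ℕ} (G : SimpleGraph (Fin n)) (ε c : ℝ) (T : ℕ) : PMF Config :=
  runSteps G T ([P], initStore n ε c)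

/-- Whatever the random choices, `P` halts on the input `(ε, G, c)` within `T` steps. -/
def Prog.HaltsWithin (P : Prog) {n : ℕ} (G : SimpleGraph (Fin n)) (ε c : ℝ) (T : ℕ) : Prop :=
  ∀ a ∈ (P.run G ε c T).support, a.1 = []

open Classical in
/-- The set of nodes that a configuration stands for: the nodes with a nonzero mark in memory. -/
def Config.output (n : ℕ) (a : Config) : Finset (Fin n) :=
  Finset.univ.filter fun v => a.2.nmem (v : ℕ) ≠ 0

/-- The distribution of the set that `P` has computed on the input `(ε, G, c)` after `T` steps. -/
def Prog.outputDist (P : Prog) {n : ℕ} (G : SimpleGraph (Fin n)) (ε c : ℝ) (T : ℕ) :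
    PMF (Finset (Fin n)) :=
  (P.run G ε c T).bind fun a => PMF.pure (Config.output n a)

end UGSC

end

/-! The utility is a product of one minus the payment and the edge density. Both factors tolerate
small relative errors in the degrees, provided that all degrees are of order εn. That this may be
assumed is the content of `exists_core`: as long as some node has degree below D = εn/3, delete it.
Fewer than D edges go with it, so at most εn²/3 edges are lost in all, a density of order ε. The sum
of 1 / max(deg, D) does not grow, since each of the fewer than D neighbours raises it by at most 1 /
(D(D+1)), while the deleted term was 1 / D. So the optimum can be replaced by a core K at a loss of
2ε (`exists_isOptCore`).

A nonempty core has at least εn/3 nodes, hence a uniform sample of m nodes falls into K entirely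
with probability at least (ε/3)^m. By a Chernoff bound at least half of the samples from K estimate
all degrees into K up to ε²n/5 (`card_goodSample`, `le_prob_goodSample`). With such estimates and
the right guess for |K| and |E(K)|, the indicator of K is feasible for the linear program, so an
optimal solution is not much more expensive than K, and its constraints keep the number of edges and
make the fractional degrees match the estimates. Independent rounding preserves the n + 2 linear
forms involved, again by Chernoff; the size assumption on n is used for this union bound
(`mul_exp_le_half`). The rounded set is thus nearly optimal with probability at least one half
(`half_le_nearOptimal`), and t iterations amplify the success probability (`le_mul_numSamples`,
`algorithm_nearOptimal`).

The machine program `ptas` varies this scheme. The objective of the linear program becomes one more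
constraint with a guessed bound, and the system is solved up to a tolerance by relaxation: moving
along a violated row and clamping to [0,1] lowers the squared distance to every feasible point by
ε⁴n/256, so that at most 256/ε⁴ ≤ n moves occur if the system is feasible (`relax_step`,
`lpProg_spec`). The guesses are drawn at random, which costs a factor (n+1)³ in the success
probability. For small n all sets are enumerated by a binary counter. Programs are verified in a
program logic (`Ens`) whose judgments combine a worst-case step bound, a postcondition that always
holds, and a lower bound on an expected value; a frame rule (`Ens.frame`) confines each
specification to what the program changes. -/

namespace UGSC

/-! ### Degrees, edges and cores of a node set -/

section Graph

set_option linter.unusedSectionVars false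

variable {V : Type} [Fintype V]

open Classical in
theorem degIn_eq_sum (G : SimpleGraph V) (S : Finset V) (v : V) :
    degIn G S v = ∑ u ∈ S, if G.Adj v u then 1 else 0 := by
  rw [degIn, Finset.card_filter]

open Classical in
/-- The graph with the edges of `G` inside `S`. -/
def insideGraph (G : SimpleGraph V) (S : Finset V) : SimpleGraph V where
  Adj u v := G.Adj u v ∧ u ∈ S ∧ v ∈ S
  symm := ⟨fun _ _ h => ⟨h.1.symm, h.2.2, h.2.1⟩⟩
  loopless := ⟨fun _ h => G.loopless.irrefl _ h.1⟩

theorem insideGraph_adj (G : SimpleGraph V) (S : Finset V) (u v : V) :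
    (insideGraph G S).Adj u v ↔ G.Adj u v ∧ u ∈ S ∧ v ∈ S := Iff.rfl

open Classical in
theorem edgesIn_eq_card (G : SimpleGraph V) (S : Finset V) :
    edgesIn G S = (insideGraph G S).edgeFinset.card := by
  unfold edgesIn
  congr 1
  ext e
  induction e using Sym2.ind with
  | _ u v => simp [insideGraph_adj]

open Classical in
theorem sum_degIn (G : SimpleGraph V) (S : Finset V) :
    ∑ v ∈ S, degIn G S v = 2 * edgesIn G S := by
  rw [edgesIn_eq_card, ← SimpleGraph.sum_degrees_eq_twice_card_edges,
    ← Finset.sum_subset (Finset.subset_univ S)]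
  · refine Finset.sum_congr rfl fun v hv => ?_
    rw [degIn, ← SimpleGraph.card_neighborFinset_eq_degree]
    congr 1
    ext u
    simp [insideGraph_adj, hv, and_comm]
  · intro v _ hv
    rw [← SimpleGraph.card_neighborFinset_eq_degree, Finset.card_eq_zero]
    ext u
    simp [insideGraph_adj, hv]

theorem edgesIn_le_edgeMax (G : SimpleGraph V) (S : Finset V) :
    (edgesIn G S : ℝ) ≤ edgeMax V := by
  classical
  rw [edgesIn_eq_card, edgeMax]
  exact_mod_cast SimpleGraph.card_edgeFinset_le_card_choose_two

open Classical in
theorem degIn_erase (G : SimpleGraph V) {S : Finset V} {v : V} (hv : v ∈ S) (u : V) :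
    degIn G S u = degIn G (S.erase v) u + if G.Adj u v then 1 else 0 := by
  rw [degIn_eq_sum, degIn_eq_sum, Finset.sum_erase_add _ _ hv]

theorem degIn_le_card (G : SimpleGraph V) (S : Finset V) (v : V) : degIn G S v ≤ S.card := by
  classical exact Finset.card_filter_le _ _

open Classical in
-- Handshake on both sets: deleting v takes its own degree and one unit from each of its neighbours
-- out of the degree sum, hence twice its degree.
theorem edgesIn_erase (G : SimpleGraph V) {S : Finset V} {v : V} (hv : v ∈ S) :
    edgesIn G S = edgesIn G (S.erase v) + degIn G S v := by
  have h1 := sum_degIn G S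
  have h2 := sum_degIn G (S.erase v)
  rw [← Finset.sum_erase_add _ _ hv,
    Finset.sum_congr rfl fun u _ => degIn_erase G hv u, Finset.sum_add_distrib, h2] at h1
  have h3 : ∑ u ∈ S.erase v, (if G.Adj u v then 1 else 0) = degIn G S v := by
    rw [degIn_erase G hv v, degIn_eq_sum]
    simp [G.adj_comm]
  omega

/-- The worst case is d = D + 1, where the maximum drops from D + 1 to D and equality holds. Over
fewer than D neighbours these increments stay below 1 / D. -/
theorem inv_max_sub_one_le {D : ℝ} (hD : 0 < D) (d : ℝ) :
    1 / max (d - 1) D ≤ 1 / max d D + 1 / (D * (D + 1)) := by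
  have key : 1 / max (d - 1) D - 1 / max d D ≤ 1 / (D * (D + 1)) := by
    have hp : 0 < max (d - 1) D := lt_max_of_lt_right hD
    have hq : 0 < max d D := lt_max_of_lt_right hD
    rw [div_sub_div _ _ hp.ne' hq.ne', div_le_div_iff₀ (by positivity) (by positivity)]
    have h1 : D ≤ max (d - 1) D := le_max_right _ _
    have h2 : max d D ≤ max (d - 1) D + 1 :=
      max_le (by linarith [le_max_left (d - 1) D]) (by linarith)
    have h3 : max (d - 1) D ≤ max d D := max_le_max (by linarith) le_rfl
    set p := max (d - 1) D
    set q := max d D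
    nlinarith [mul_nonneg (sub_nonneg.2 h1) (sub_nonneg.2 h3),
      mul_nonneg (sub_nonneg.2 h2) hD.le, mul_nonneg (sub_nonneg.2 h1) hD.le,
      mul_nonneg (mul_nonneg (sub_nonneg.2 h2) hD.le) hD.le,
      mul_nonneg (mul_nonneg (sub_nonneg.2 h1) (sub_nonneg.2 h3)) hD.le]
  linarith

open Classical in
/-- Deleting a node of degree below `D` does not increase the truncated sum of inverse degrees. -/
theorem sum_inv_max_erase_le (G : SimpleGraph V) {D : ℝ} (hD : 0 < D)
    {S : Finset V} {v : V} (hv : v ∈ S) (hdeg : (degIn G S v : ℝ) < D) :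
    ∑ u ∈ S.erase v, 1 / max (degIn G (S.erase v) u : ℝ) D ≤
      ∑ u ∈ S, 1 / max (degIn G S u : ℝ) D := by
  rw [← Finset.sum_erase_add _ _ hv]
  have h1 : ∀ u ∈ S.erase v, 1 / max (degIn G (S.erase v) u : ℝ) D ≤
      1 / max (degIn G S u : ℝ) D + (if G.Adj u v then 1 else 0) * (1 / (D * (D + 1))) := by
    intro u _
    have h := degIn_erase G hv u
    by_cases ha : G.Adj u v
    · have := inv_max_sub_one_le hD (degIn G S u : ℝ)
      simp only [ha, if_true, one_mul] at h ⊢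
      rw [h] at this ⊢
      push_cast at this ⊢
      simpa using this
    · simp only [ha, if_false, zero_mul, add_zero] at h ⊢
      rw [h]
  refine (Finset.sum_le_sum h1).trans ?_
  rw [Finset.sum_add_distrib, ← Finset.sum_mul]
  have h2 : ∑ u ∈ S.erase v, (if G.Adj u v then (1 : ℝ) else 0) ≤ D := by
    refine le_trans ?_ hdeg.le
    rw [degIn_eq_sum]
    push_cast
    rw [Finset.sum_congr rfl fun u _ => by rw [G.adj_comm]]
    exact Finset.sum_le_sum_of_subset_of_nonneg (Finset.erase_subset _ _)
      fun _ _ _ => by positivity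
  have h3 : D * (1 / (D * (D + 1))) ≤ 1 / D := by
    rw [mul_one_div, div_le_div_iff₀ (by positivity) hD]
    nlinarith
  -- Truncation makes the deleted term exactly 1 / D, however small the degree was; it pays for the
  -- increments at the neighbours.
  have h4 : max (degIn G S v : ℝ) D = D := max_eq_right hdeg.le
  rw [h4]
  have h5 := mul_le_mul_of_nonneg_right h2 (by positivity : 0 ≤ 1 / (D * (D + 1)))
  linarith

/-- Every set `S` has a subset (its `D`-core) with all degrees at least `D` that has almost as
many edges and no larger sum of inverse degrees. -/
theorem exists_core (G : SimpleGraph V) {D : ℝ} (hD : 0 < D) (S : Finset V) :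
    ∃ K ⊆ S, (∀ v ∈ K, D ≤ degIn G K v) ∧
      (edgesIn G S : ℝ) ≤ edgesIn G K + D * S.card ∧
      ∑ v ∈ K, 1 / (degIn G K v : ℝ) ≤ ∑ v ∈ S, 1 / max (degIn G S v : ℝ) D := by
  classical
  induction S using Finset.strongInduction with
  | H S ih =>
    by_cases h : ∀ v ∈ S, D ≤ degIn G S v
    · refine ⟨S, subset_rfl, h, by nlinarith [(Nat.cast_nonneg S.card : (0 : ℝ) ≤ S.card)],
        (Finset.sum_congr rfl fun v hv => ?_).le⟩
      rw [max_eq_left (h v hv)]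
    · push Not at h
      obtain ⟨v, hv, hlt⟩ := h
      -- Deleting v removes fewer than D edges, which are charged to the drop of `S.card` by one.
      obtain ⟨K, hK, h1, h2, h3⟩ := ih _ (Finset.erase_ssubset hv)
      refine ⟨K, hK.trans (Finset.erase_subset _ _), h1, ?_,
        h3.trans (sum_inv_max_erase_le G hD hv hlt)⟩
      have e1 := edgesIn_erase G hv
      have e2 := Finset.card_erase_add_one hv
      have e3 : (edgesIn G S : ℝ) = edgesIn G (S.erase v) + degIn G S v := by
        rw [e1]; push_cast; rfl
      have e4 : (S.card : ℝ) = (S.erase v).card + 1 := by rw [← e2]; push_cast; ring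
      rw [e3, e4]
      linarith

theorem utility_empty (G : SimpleGraph V) (c : ℝ) : utility G c ∅ = 0 := by
  have : edgesIn G (∅ : Finset V) = 0 := by
    have := sum_degIn G (∅ : Finset V)
    simp only [Finset.sum_empty] at this
    omega
  simp [utility, this]

theorem exists_max_utility (G : SimpleGraph V) (c : ℝ) :
    ∃ S : Finset V, ∀ T, utility G c T ≤ utility G c S := by
  obtain ⟨S, -, h⟩ := Finset.exists_max_image (Finset.univ : Finset (Finset V)) (utility G c)
    ⟨∅, Finset.mem_univ _⟩
  exact ⟨S, fun T => h T (Finset.mem_univ _)⟩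

theorem utility_of_pos (G : SimpleGraph V) (c : ℝ) {S : Finset V}
    (h : ∀ v ∈ S, 0 < degIn G S v) :
    utility G c S = (((1 - c * edgeMax V * ∑ v ∈ S, 1 / (degIn G S v : ℝ)) *
      ((edgesIn G S : ℝ) / edgeMax V) : ℝ) : EReal) := by
  rw [utility, if_pos h, Finset.mul_sum]
  simp only [mul_one_div]

end Graph

end UGSC

namespace UGSC

/-! ### Chernoff bounds for rounding and for sampling -/

section Concentration

set_option linter.unusedSectionVars false

variable {V : Type} [Fintype V]

theorem exp_le_one_add_add_sq {y : ℝ} (hy : |y| ≤ 1) : Real.exp y ≤ 1 + y + y ^ 2 := by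
  have := (abs_le.1 (Real.abs_exp_sub_one_sub_id_le hy)).2
  linarith

/-- A bound on the moment generating function of a centred Bernoulli variable. -/
theorem bernoulli_mgf_le {p b B : ℝ} (hp0 : 0 ≤ p) (hp1 : p ≤ 1) (hb : |b| ≤ B) (hB : B ≤ 1) :
    p * Real.exp (b * (1 - p)) + (1 - p) * Real.exp (-(b * p)) ≤ Real.exp (B ^ 2) := by
  have hb1 : |b| ≤ 1 := hb.trans hB
  have h1 : |b * (1 - p)| ≤ 1 := by
    rw [abs_mul, abs_of_nonneg (sub_nonneg.2 hp1)]
    nlinarith [abs_nonneg b]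
  have h2 : |-(b * p)| ≤ 1 := by
    rw [abs_neg, abs_mul, abs_of_nonneg hp0]
    nlinarith [abs_nonneg b]
  have h3 := mul_le_mul_of_nonneg_left (exp_le_one_add_add_sq h1) hp0
  have h4 := mul_le_mul_of_nonneg_left (exp_le_one_add_add_sq h2) (sub_nonneg.2 hp1)
  have h5 : b ^ 2 ≤ B ^ 2 := sq_le_sq' (by linarith [(abs_le.1 hb).1]) ((abs_le.1 hb).2)
  -- The terms linear in b cancel, and p (1 - p) b² is what the quadratic terms add up to.
  have h6 : p * (1 - p) * b ^ 2 ≤ 1 * b ^ 2 :=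
    mul_le_mul_of_nonneg_right (by nlinarith) (sq_nonneg b)
  have h7 : B ^ 2 + 1 ≤ Real.exp (B ^ 2) := Real.add_one_le_exp _
  nlinarith

theorem clamp_of_mem {p : ℝ} (h1 : p ≤ 1) : clamp p = ENNReal.ofReal p :=
  min_eq_right (ENNReal.ofReal_le_one.2 h1)

theorem one_sub_clamp_of_mem {p : ℝ} (h0 : 0 ≤ p) (h1 : p ≤ 1) :
    1 - clamp p = ENNReal.ofReal (1 - p) := by
  rw [clamp_of_mem h1, ENNReal.ofReal_sub _ h0, ENNReal.ofReal_one]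

open Classical in
theorem roundSet_apply (x : V → ℝ) (S : Finset V) :
    roundSet x S = (∏ v ∈ S, clamp (x v)) * ∏ v ∈ Finset.univ \ S, (1 - clamp (x v)) := rfl

open Classical in
theorem roundSet_apply_ofReal {x : V → ℝ} (hx : ∀ v, 0 ≤ x v ∧ x v ≤ 1) (S : Finset V) :
    roundSet x S =
      ENNReal.ofReal ((∏ v ∈ S, x v) * ∏ v ∈ Finset.univ \ S, (1 - x v)) := by
  rw [roundSet_apply, ENNReal.ofReal_mul (Finset.prod_nonneg fun v _ => (hx v).1),
    ENNReal.ofReal_prod_of_nonneg fun v _ => (hx v).1,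
    ENNReal.ofReal_prod_of_nonneg fun v _ => sub_nonneg.2 (hx v).2]
  congr 1
  · exact Finset.prod_congr rfl fun v _ => clamp_of_mem (hx v).2
  · exact Finset.prod_congr rfl fun v _ => one_sub_clamp_of_mem (hx v).1 (hx v).2

open Classical in
theorem toOuterMeasure_eq_sum {α : Type*} [Fintype α] (p : PMF α) (A : Set α) :
    p.toOuterMeasure A = ∑ a ∈ Finset.univ.filter (· ∈ A), p a := by
  rw [PMF.toOuterMeasure_apply, tsum_fintype, Finset.sum_filter]
  rfl

open Classical in
/-- A Chernoff bound for randomized rounding. -/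
theorem roundSet_tail {x : V → ℝ} (hx : ∀ v, 0 ≤ x v ∧ x v ≤ 1) {a : V → ℝ}
    (ha : ∀ v, |a v| ≤ 2) {t : ℝ} (ht : 0 ≤ t) (htn : t ≤ 4 * (Fintype.card V : ℝ)) :
    (roundSet x).toOuterMeasure {S | t ≤ ∑ v ∈ S, a v - ∑ v, a v * x v} ≤
      ENNReal.ofReal (Real.exp (-(t ^ 2 / (16 * (Fintype.card V : ℝ))))) := by
  set N : ℝ := (Fintype.card V : ℝ) with hN
  have hN0 : 0 ≤ N := Nat.cast_nonneg _
  rcases hN0.eq_or_lt with h0 | hpos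
  · rw [← h0]
    simp only [mul_zero, div_zero, neg_zero, Real.exp_zero, ENNReal.ofReal_one]
    rw [toOuterMeasure_eq_sum]
    refine (Finset.sum_le_sum_of_subset (Finset.filter_subset _ _)).trans ?_
    rw [← tsum_fintype (L := .unconditional _), PMF.tsum_coe]
  -- This s minimizes the exponent -s t + (2 s)² N that the exponential Markov inequality leaves;
  -- `htn` is what makes 2 s ≤ 1.
  set s : ℝ := t / (8 * N) with hs
  have hs0 : 0 ≤ s := by positivity
  have hs1 : 2 * s ≤ 1 := by
    rw [hs, ← mul_div_assoc, div_le_one (by positivity)]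
    linarith
  rw [toOuterMeasure_eq_sum]
  have hw : ∀ S : Finset V, 0 ≤ (∏ v ∈ S, x v) * ∏ v ∈ Finset.univ \ S, (1 - x v) := fun S =>
    mul_nonneg (Finset.prod_nonneg fun v _ => (hx v).1)
      (Finset.prod_nonneg fun v _ => sub_nonneg.2 (hx v).2)
  rw [Finset.sum_congr rfl fun S _ => roundSet_apply_ofReal hx S,
    ← ENNReal.ofReal_sum_of_nonneg fun S _ => hw S]
  refine ENNReal.ofReal_le_ofReal ?_
  have h1 : ∀ S ∈ Finset.univ.filter (· ∈ {S | t ≤ ∑ v ∈ S, a v - ∑ v, a v * x v}),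
      (∏ v ∈ S, x v) * ∏ v ∈ Finset.univ \ S, (1 - x v) ≤
      Real.exp (-(s * t)) * ((∏ v ∈ S, x v * Real.exp (s * a v * (1 - x v))) *
        ∏ v ∈ Finset.univ \ S, (1 - x v) * Real.exp (-(s * a v * x v))) := by
    intro S hS
    have hS' : t ≤ ∑ v ∈ S, a v - ∑ v, a v * x v := (Finset.mem_filter.1 hS).2
    rw [Finset.prod_mul_distrib, Finset.prod_mul_distrib, ← Real.exp_sum, ← Real.exp_sum]
    have e : Real.exp (-(s * t)) * ((∏ v ∈ S, x v) * Real.exp (∑ v ∈ S, s * a v * (1 - x v)) *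
        ((∏ v ∈ Finset.univ \ S, (1 - x v)) *
          Real.exp (∑ v ∈ Finset.univ \ S, -(s * a v * x v)))) =
        ((∏ v ∈ S, x v) * ∏ v ∈ Finset.univ \ S, (1 - x v)) *
          Real.exp (-(s * t) + ∑ v ∈ S, s * a v * (1 - x v) +
            ∑ v ∈ Finset.univ \ S, -(s * a v * x v)) := by
      rw [Real.exp_add, Real.exp_add]; ring
    rw [e]
    refine le_mul_of_one_le_right (hw S) (Real.one_le_exp ?_)
    have e2 : ∑ v ∈ S, s * a v * (1 - x v) + ∑ v ∈ Finset.univ \ S, -(s * a v * x v) =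
        s * (∑ v ∈ S, a v - ∑ v, a v * x v) := by
      rw [← Finset.sum_sdiff (Finset.subset_univ S)]
      rw [mul_sub, mul_add, Finset.mul_sum, Finset.mul_sum, Finset.mul_sum]
      rw [← sub_sub, sub_right_comm, ← Finset.sum_sub_distrib, sub_eq_add_neg,
        ← Finset.sum_neg_distrib]
      congr 1
      · exact Finset.sum_congr rfl fun v _ => by ring
      · exact Finset.sum_congr rfl fun v _ => by ring
    rw [add_assoc, e2]
    nlinarith
  refine (Finset.sum_le_sum h1).trans ?_
  refine (Finset.sum_le_sum_of_subset_of_nonneg (Finset.subset_univ _) fun S _ _ => ?_).trans ?_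
  · refine mul_nonneg (Real.exp_pos _).le (mul_nonneg (Finset.prod_nonneg fun v _ => ?_)
      (Finset.prod_nonneg fun v _ => ?_))
    · exact mul_nonneg (hx v).1 (Real.exp_pos _).le
    · exact mul_nonneg (sub_nonneg.2 (hx v).2) (Real.exp_pos _).le
  rw [← Finset.mul_sum]
  -- Independence of the coins: the sum over all sets factors into a product over the nodes of an
  -- included and an excluded part.
  have h2 := Finset.prod_add (fun v => x v * Real.exp (s * a v * (1 - x v)))
    (fun v => (1 - x v) * Real.exp (-(s * a v * x v))) (Finset.univ : Finset V)
  rw [Finset.powerset_univ] at h2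
  rw [← h2]
  have h3 : ∏ v : V, (x v * Real.exp (s * a v * (1 - x v)) +
      (1 - x v) * Real.exp (-(s * a v * x v))) ≤ ∏ _v : V, Real.exp ((2 * s) ^ 2) := by
    refine Finset.prod_le_prod (fun v _ => ?_) fun v _ => ?_
    · exact add_nonneg (mul_nonneg (hx v).1 (Real.exp_pos _).le)
        (mul_nonneg (sub_nonneg.2 (hx v).2) (Real.exp_pos _).le)
    · refine bernoulli_mgf_le (hx v).1 (hx v).2 ?_ hs1
      rw [abs_mul, abs_of_nonneg hs0]
      nlinarith [ha v]
  refine (mul_le_mul_of_nonneg_left h3 (Real.exp_pos _).le).trans ?_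
  rw [Finset.prod_const, Finset.card_univ, ← Real.exp_nat_mul, ← Real.exp_add]
  refine Real.exp_le_exp.2 (le_of_eq ?_)
  rw [← hN, hs]
  field_simp
  ring

open Classical in
/-- A Chernoff bound for sums of samples from a set `K`, one tail, in the counting form. -/
theorem sample_tail_upper {K : Finset V} (hK : K.Nonempty) {f : V → ℝ}
    (hf : ∀ v, |f v| ≤ 1) (hmean : ∑ v ∈ K, f v = 0) (m : ℕ) {δ : ℝ} (h0 : 0 ≤ δ) (h2 : δ ≤ 2) :
    (((Fintype.piFinset fun _ : Fin m => K).filter fun M => m * δ < ∑ j, f (M j)).card : ℝ) ≤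
      (K.card : ℝ) ^ m * Real.exp (-(m * δ ^ 2 / 4)) := by
  -- The minimizer of the exponent m (s² - s δ); `h2` makes s ≤ 1.
  set s := δ / 2 with hs
  have hs0 : 0 ≤ s := by positivity
  have h1 : (((Fintype.piFinset fun _ : Fin m => K).filter
      fun M => m * δ < ∑ j, f (M j)).card : ℝ) ≤
      ∑ M ∈ Fintype.piFinset fun _ : Fin m => K,
        Real.exp (-(s * (m * δ))) * ∏ j, Real.exp (s * f (M j)) := by
    rw [Finset.card_filter]
    push_cast
    refine Finset.sum_le_sum fun M _ => ?_
    rw [← Real.exp_sum, ← Real.exp_add]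
    split_ifs with h
    · refine Real.one_le_exp ?_
      rw [← Finset.mul_sum]
      nlinarith
    · exact (Real.exp_pos _).le
  refine h1.trans ?_
  have hprod : ∑ M ∈ Fintype.piFinset fun _ : Fin m => K, ∏ j, Real.exp (s * f (M j)) =
      (∑ v ∈ K, Real.exp (s * f v)) ^ m := by
    have := Finset.prod_univ_sum (fun _ : Fin m => K) fun _ v => Real.exp (s * f v)
    rw [Finset.prod_const, Finset.card_univ, Fintype.card_fin] at this
    rw [this]
  rw [← Finset.mul_sum, hprod]
  have hc : 0 < (K.card : ℝ) := by exact_mod_cast hK.card_pos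
  have h3 : ∑ v ∈ K, Real.exp (s * f v) ≤ K.card * Real.exp (s ^ 2) := by
    have : ∀ v ∈ K, Real.exp (s * f v) ≤ 1 + s * f v + s ^ 2 := by
      intro v _
      have hb : |s * f v| ≤ 1 := by
        rw [abs_mul, abs_of_nonneg hs0]
        nlinarith [hf v, abs_nonneg (f v)]
      refine (exp_le_one_add_add_sq hb).trans ?_
      have : (f v) ^ 2 ≤ 1 := by
        rw [← sq_abs]; nlinarith [hf v, abs_nonneg (f v)]
      nlinarith [sq_nonneg s]
    refine (Finset.sum_le_sum this).trans ?_
    rw [Finset.sum_add_distrib, Finset.sum_add_distrib, ← Finset.mul_sum, hmean,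
      Finset.sum_const, Finset.sum_const]
    have := Real.add_one_le_exp (s ^ 2)
    simp only [nsmul_eq_mul]
    nlinarith
  have h4 : (∑ v ∈ K, Real.exp (s * f v)) ^ m ≤ (K.card * Real.exp (s ^ 2)) ^ m :=
    pow_le_pow_left₀ (Finset.sum_nonneg fun v _ => (Real.exp_pos _).le) h3 m
  refine (mul_le_mul_of_nonneg_left h4 (Real.exp_pos _).le).trans (le_of_eq ?_)
  rw [mul_pow, ← Real.exp_nat_mul, mul_left_comm, ← Real.exp_add]
  congr 2
  rw [hs]; ring

/-- The number of neighbours of `v` in the sample `M`, with multiplicity. -/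
noncomputable def sampleDeg (G : SimpleGraph V) {m : ℕ} (M : Fin m → V) (v : V) : ℕ :=
  open Classical in (Finset.univ.filter fun j => G.Adj v (M j)).card

/-- The sample `M` from `K` estimates all degrees into `K` up to the error `e`. -/
def GoodSample (G : SimpleGraph V) (K : Finset V) (e : ℝ) {m : ℕ} (M : Fin m → V) : Prop :=
  ∀ v, |(K.card : ℝ) / m * sampleDeg G M v - degIn G K v| ≤ e

open Classical in
-- The upper tail is applied to the centred indicator of adjacency to v and to its negative. The
-- error δ of the average is then scaled by |K|, which is at most the number of nodes.
theorem card_bad_sample_le (G : SimpleGraph V) {K : Finset V} (hK : K.Nonempty) (m : ℕ)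
    (hm : 0 < m) {δ : ℝ} (h0 : 0 ≤ δ) (h2 : δ ≤ 2) (v : V) :
    (((Fintype.piFinset fun _ : Fin m => K).filter fun M =>
      ¬ |(K.card : ℝ) / m * sampleDeg G M v - degIn G K v| ≤ δ * Fintype.card V).card : ℝ) ≤
      2 * ((K.card : ℝ) ^ m * Real.exp (-(m * δ ^ 2 / 4))) := by
  have hc : 0 < (K.card : ℝ) := by exact_mod_cast hK.card_pos
  have hm' : (0 : ℝ) < m := by exact_mod_cast hm
  set μ : ℝ := (degIn G K v : ℝ) / K.card with hμ
  have hμ0 : 0 ≤ μ := by positivity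
  have hμ1 : μ ≤ 1 := by
    rw [hμ, div_le_one hc]; exact_mod_cast degIn_le_card G K v
  set f : V → ℝ := fun u => (if G.Adj v u then 1 else 0) - μ with hf
  have hf1 : ∀ u, |f u| ≤ 1 := by
    intro u
    rw [abs_le, hf]
    dsimp only
    split_ifs <;> constructor <;> linarith
  have hf0 : ∑ u ∈ K, f u = 0 := by
    rw [hf]
    simp only [Finset.sum_sub_distrib, Finset.sum_const, nsmul_eq_mul]
    have : (∑ u ∈ K, if G.Adj v u then (1 : ℝ) else 0) = degIn G K v := by
      rw [degIn_eq_sum]; push_cast; rfl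
    rw [this, hμ]
    field_simp
    ring
  have t1 := sample_tail_upper hK hf1 hf0 m h0 h2
  have t2 := sample_tail_upper (f := fun u => -f u) hK (fun u => by rw [abs_neg]; exact hf1 u)
    (by rw [Finset.sum_neg_distrib, hf0, neg_zero]) m h0 h2
  rw [two_mul]
  refine le_trans ?_ (add_le_add t1 t2)
  rw [← Nat.cast_add]
  refine Nat.cast_le.2 (le_trans (Finset.card_le_card ?_) (Finset.card_union_le _ _))
  intro M hM
  rw [Finset.mem_filter] at hM
  rw [Finset.mem_union, Finset.mem_filter, Finset.mem_filter]
  have hsum : ∑ j, f (M j) = sampleDeg G M v - m * μ := by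
    simp only [hf, sampleDeg, Finset.card_filter, Finset.sum_sub_distrib]
    push_cast
    simp
  have hcard : (K.card : ℝ) ≤ Fintype.card V := by exact_mod_cast Finset.card_le_univ K
  by_contra hcon
  apply hM.2
  have hcon1 : ∑ j, f (M j) ≤ m * δ := by
    by_contra h; exact hcon (Or.inl ⟨hM.1, not_le.1 h⟩)
  have hcon2 : ∑ j, -f (M j) ≤ m * δ := by
    by_contra h; exact hcon (Or.inr ⟨hM.1, not_le.1 h⟩)
  rw [Finset.sum_neg_distrib, hsum] at hcon2
  rw [hsum] at hcon1
  have e : (K.card : ℝ) / m * sampleDeg G M v - degIn G K v =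
      K.card / m * (sampleDeg G M v - m * μ) := by
    rw [hμ]; field_simp
  rw [e, abs_mul, abs_of_nonneg (by positivity)]
  have : |(sampleDeg G M v : ℝ) - m * μ| ≤ m * δ := abs_le.2 ⟨by linarith, by linarith⟩
  calc (K.card : ℝ) / m * |(sampleDeg G M v : ℝ) - m * μ| ≤ K.card / m * (m * δ) := by gcongr
    _ = δ * K.card := by field_simp
    _ ≤ δ * Fintype.card V := by gcongr

open Classical in
/-- At least half of the samples from `K` of logarithmic size are good. -/
theorem card_goodSample {ε : ℝ} (hε : 0 < ε) (hε1 : ε ≤ 1 / 7) (hn : 2 ≤ Fintype.card V)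
    (G : SimpleGraph V) {K : Finset V} (hK : K.Nonempty) (m : ℕ)
    (hm : (3 : ℝ) ^ 6 / ε ^ 4 * Real.log (Fintype.card V) ≤ m) :
    (K.card : ℝ) ^ m ≤ 2 * ((Finset.univ.filter fun M : Fin m → V =>
      GoodSample G K (ε ^ 2 / 5 * Fintype.card V) M).card : ℝ) := by
  set N : ℝ := (Fintype.card V : ℝ) with hN
  have hN2 : (2 : ℝ) ≤ N := by rw [hN]; exact_mod_cast hn
  have hlog : 0 < Real.log N := Real.log_pos (by linarith)
  have hm0 : 0 < m := by
    have : (0 : ℝ) < m := lt_of_lt_of_le (by positivity) hm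
    exact_mod_cast this
  have hbad : ∀ v : V, _ := fun v =>
    card_bad_sample_le G hK m hm0 (δ := ε ^ 2 / 5) (by positivity) (by nlinarith) v
  -- The exponent is m ε⁴ / 100 and 3⁶ / 100 > 7, so each tail is at most N⁻⁷. The union bound over
  -- N nodes and two tails asks for 1 / (4 N) to leave one half.
  have hexp : Real.exp (-(m * (ε ^ 2 / 5) ^ 2 / 4)) ≤ 1 / (4 * N) := by
    have h1 : 7 * Real.log N ≤ m * (ε ^ 2 / 5) ^ 2 / 4 := by
      have : (3 : ℝ) ^ 6 / ε ^ 4 * Real.log N * ε ^ 4 ≤ m * ε ^ 4 := by gcongr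
      have e : (3 : ℝ) ^ 6 / ε ^ 4 * Real.log N * ε ^ 4 = 3 ^ 6 * Real.log N := by
        field_simp
      nlinarith
    have h2 : Real.exp (-(m * (ε ^ 2 / 5) ^ 2 / 4)) ≤ Real.exp (-(7 * Real.log N)) :=
      Real.exp_le_exp.2 (by linarith)
    refine h2.trans ?_
    have h3 : Real.exp (-(7 * Real.log N)) = 1 / N ^ 7 := by
      rw [Real.exp_neg, show (7 : ℝ) * Real.log N = ((7 : ℕ) : ℝ) * Real.log N by norm_num,
        Real.exp_nat_mul, Real.exp_log (by linarith), one_div]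
    rw [h3]
    refine one_div_le_one_div_of_le (by linarith) ?_
    have : (2 : ℝ) ^ 6 ≤ N ^ 6 := pow_le_pow_left₀ (by norm_num) hN2 6
    nlinarith
  set P := Fintype.piFinset fun _ : Fin m => K with hP
  have hPc : (P.card : ℝ) = (K.card : ℝ) ^ m := by
    rw [hP, Fintype.card_piFinset]; simp
  have hsub : P ⊆ (Finset.univ.filter fun M : Fin m → V =>
      GoodSample G K (ε ^ 2 / 5 * N) M) ∪
      Finset.univ.biUnion fun v : V => P.filter fun M =>
        ¬ |(K.card : ℝ) / m * sampleDeg G M v - degIn G K v| ≤ ε ^ 2 / 5 * N := by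
    intro M hM
    rw [Finset.mem_union, Finset.mem_filter, Finset.mem_biUnion]
    by_cases h : GoodSample G K (ε ^ 2 / 5 * N) M
    · exact Or.inl ⟨Finset.mem_univ _, h⟩
    · right
      unfold GoodSample at h
      push Not at h
      obtain ⟨v, hv⟩ := h
      exact ⟨v, Finset.mem_univ _, Finset.mem_filter.2 ⟨hM, not_le.2 hv⟩⟩
  have h1 : (P.card : ℝ) ≤ ((Finset.univ.filter fun M : Fin m → V =>
      GoodSample G K (ε ^ 2 / 5 * N) M).card : ℝ) +
      ∑ v : V, ((P.filter fun M =>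
        ¬ |(K.card : ℝ) / m * sampleDeg G M v - degIn G K v| ≤ ε ^ 2 / 5 * N).card : ℝ) := by
    have := (Finset.card_le_card hsub).trans ((Finset.card_union_le _ _).trans
      (Nat.add_le_add_left Finset.card_biUnion_le _))
    exact_mod_cast this
  have h2 := Finset.sum_le_sum fun v (_ : v ∈ Finset.univ) => hbad v
  rw [Finset.sum_const, Finset.card_univ, nsmul_eq_mul] at h2
  have h3 : N * (2 * ((K.card : ℝ) ^ m * Real.exp (-(m * (ε ^ 2 / 5) ^ 2 / 4)))) ≤
      (K.card : ℝ) ^ m / 2 := by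
    have : (K.card : ℝ) ^ m * Real.exp (-(m * (ε ^ 2 / 5) ^ 2 / 4)) ≤
        (K.card : ℝ) ^ m * (1 / (4 * N)) := by gcongr
    calc _ ≤ N * (2 * ((K.card : ℝ) ^ m * (1 / (4 * N)))) := by gcongr
      _ = _ := by field_simp; norm_num
  rw [hPc] at h1
  linarith [h1, h2, h3]

end Concentration

end UGSC

namespace UGSC

/-! ### From a good fractional solution to a nearly optimal set -/

section Rounding

variable {V : Type} [Fintype V]

theorem edgeMax_ge (hn : 2 ≤ Fintype.card V) :
    (Fintype.card V : ℝ) ^ 2 / 4 ≤ edgeMax V := by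
  rw [edgeMax, Nat.cast_choose_two]
  have : (2 : ℝ) ≤ Fintype.card V := by exact_mod_cast hn
  nlinarith

theorem two_edgeMax_le : 2 * edgeMax V ≤ (Fintype.card V : ℝ) ^ 2 := by
  rw [edgeMax, Nat.cast_choose_two]
  have : (0 : ℝ) ≤ Fintype.card V := Nat.cast_nonneg _
  nlinarith

/-- The sum of inverse degrees. -/
noncomputable def invDegSum (G : SimpleGraph V) (S : Finset V) : ℝ :=
  ∑ v ∈ S, 1 / (degIn G S v : ℝ)

/-- No degree within S exceeds |S|. For a nonempty core this yields c E_max ≤ 1, so an additive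
error in the sum of inverse degrees is no larger as an error of the payment. -/
theorem one_le_invDegSum (G : SimpleGraph V) {S : Finset V} (hS : S.Nonempty)
    (h : ∀ v ∈ S, 0 < degIn G S v) : 1 ≤ invDegSum G S := by
  have h1 : ∀ v ∈ S, 1 / (S.card : ℝ) ≤ 1 / (degIn G S v : ℝ) := fun v hv =>
    one_div_le_one_div_of_le (by exact_mod_cast h v hv) (by exact_mod_cast degIn_le_card G S v)
  have h2 := Finset.sum_le_sum h1
  rw [Finset.sum_const, nsmul_eq_mul] at h2
  have : (S.card : ℝ) ≠ 0 := by exact_mod_cast hS.card_pos.ne'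
  rwa [mul_one_div, div_self this] at h2

/-- `K` is a core of the instance: all degrees are large, it can be incentivized at a cost of at
most `1`, and its utility is optimal up to `2 ε`. -/
structure IsOptCore (G : SimpleGraph V) (c ε : ℝ) (K : Finset V) : Prop where
  le_deg : ∀ v ∈ K, ε * Fintype.card V / 3 ≤ degIn G K v
  cost_le : c * edgeMax V * invDegSum G K ≤ 1
  near : ∀ T, utility G c T ≤ utility G c K + ((2 * ε : ℝ) : EReal)

theorem IsOptCore.deg_pos {G : SimpleGraph V} {c ε : ℝ} {K : Finset V} (h : IsOptCore G c ε K)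
    (hε : 0 < ε) (hn : 0 < Fintype.card V) : ∀ v ∈ K, 0 < degIn G K v := by
  intro v hv
  have h1 := h.le_deg v hv
  have : (0 : ℝ) < Fintype.card V := by exact_mod_cast hn
  have : (0 : ℝ) < degIn G K v := lt_of_lt_of_le (by positivity) h1
  exact_mod_cast this

/-- The core of a maximizer for D = εn/3 has no larger payment and loses at most εn²/3 edges,
against E_max ≥ n²/4. If the maximum is not positive, the empty set serves. -/
theorem exists_isOptCore (G : SimpleGraph V) {c ε : ℝ} (hc : 0 < c) (hε : 0 < ε)
    (hn : 2 ≤ Fintype.card V) : ∃ K, IsOptCore G c ε K := by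
  obtain ⟨S, hS⟩ := exists_max_utility G c
  have hN : (2 : ℝ) ≤ Fintype.card V := by exact_mod_cast hn
  have hE := edgeMax_ge hn
  have hE0 : 0 < edgeMax V := by nlinarith
  by_cases hpos : utility G c S ≤ 0
  · refine ⟨∅, by simp, by simp [invDegSum], fun T => ?_⟩
    rw [utility_empty, zero_add]
    exact (hS T).trans (hpos.trans (by exact_mod_cast (by positivity : (0 : ℝ) ≤ 2 * ε)))
  have hdeg : ∀ v ∈ S, 0 < degIn G S v := by
    by_contra h
    apply hpos
    rw [utility, if_neg h]
    exact bot_le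
  rw [utility_of_pos G c hdeg] at hpos
  have hpos' : 0 < (1 - c * edgeMax V * invDegSum G S) * ((edgesIn G S : ℝ) / edgeMax V) := by
    have := not_le.1 hpos
    exact_mod_cast this
  have hb : (0 : ℝ) ≤ (edgesIn G S : ℝ) / edgeMax V := by positivity
  have ha : 0 < 1 - c * edgeMax V * invDegSum G S := by
    by_contra h
    nlinarith [not_lt.1 h]
  have hD : 0 < ε * Fintype.card V / 3 := by positivity
  obtain ⟨K, -, h1, h2, h3⟩ := exists_core G hD S
  have h4 : invDegSum G K ≤ invDegSum G S := h3.trans <| Finset.sum_le_sum fun v hv =>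
    one_div_le_one_div_of_le (by exact_mod_cast hdeg v hv) (le_max_left _ _)
  have hA : 0 < c * edgeMax V := by positivity
  have h5 : c * edgeMax V * invDegSum G K ≤ c * edgeMax V * invDegSum G S :=
    mul_le_mul_of_nonneg_left h4 hA.le
  refine ⟨K, h1, by linarith, fun T => (hS T).trans ?_⟩
  have hdegK : ∀ v ∈ K, 0 < degIn G K v := fun v hv => by
    exact_mod_cast hD.trans_le (h1 v hv)
  rw [utility_of_pos G c hdeg, utility_of_pos G c hdegK]
  norm_cast
  change (1 - c * edgeMax V * invDegSum G S) * ((edgesIn G S : ℝ) / edgeMax V) ≤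
    (1 - c * edgeMax V * invDegSum G K) * ((edgesIn G K : ℝ) / edgeMax V) + 2 * ε
  have hcard : (S.card : ℝ) ≤ Fintype.card V := by exact_mod_cast Finset.card_le_univ S
  have h6 : (edgesIn G S : ℝ) / edgeMax V ≤ edgesIn G K / edgeMax V + 2 * ε := by
    rw [div_add' _ _ _ hE0.ne', div_le_div_iff_of_pos_right hE0]
    have : ε * Fintype.card V / 3 * S.card ≤ ε * Fintype.card V / 3 * Fintype.card V := by gcongr
    nlinarith
  have hnn : 0 ≤ invDegSum G K := Finset.sum_nonneg fun _ _ => by positivity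
  have hcK : 0 ≤ c * edgeMax V * invDegSum G K := mul_nonneg hA.le hnn
  calc _ ≤ (1 - c * edgeMax V * invDegSum G K) * ((edgesIn G S : ℝ) / edgeMax V) := by gcongr
    _ ≤ (1 - c * edgeMax V * invDegSum G K) * (edgesIn G K / edgeMax V + 2 * ε) := by
        gcongr
        linarith
    _ ≤ _ := by
        have : (1 - c * edgeMax V * invDegSum G K) * (2 * ε) ≤ 1 * (2 * ε) := by
          gcongr; linarith
        linarith

open Classical in
/-- The fractional solution `x` on `H` with degree estimates `d` is good enough to be rounded. -/
structure FracGood (G : SimpleGraph V) (c ε : ℝ) (K H : Finset V) (d x : V → ℝ) : Prop where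
  mem_unit : ∀ v, 0 ≤ x v ∧ x v ≤ 1
  outside : ∀ v, v ∉ H → x v = 0
  le_est : ∀ v ∈ H, ε * Fintype.card V / 4 ≤ d v
  est_le : ∀ v ∈ H, d v ≤ 2 * Fintype.card V
  degrees : ∀ v ∈ H, (1 - 2 * ε) * d v ≤ ∑ u ∈ H.filter (fun u => G.Adj v u), x u
  edges : 2 * (edgesIn G K : ℝ) - 3 * ε * (Fintype.card V : ℝ) ^ 2 ≤ ∑ v ∈ H, d v * x v
  cost : c * edgeMax V * ∑ v ∈ H, 1 / d v * x v ≤ c * edgeMax V * invDegSum G K + 4 * ε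

open Classical in
/-- The rounded set `S` deviates little from the fractional solution. -/
structure RoundedWell (G : SimpleGraph V) (ε : ℝ) (H : Finset V) (d x : V → ℝ)
    (S : Finset V) : Prop where
  subset : S ⊆ H
  degrees : ∀ v ∈ H, ∑ u ∈ H.filter (fun u => G.Adj v u), x u -
    ε ^ 2 * Fintype.card V / 4 ≤ degIn G S v
  cost : ∑ v ∈ S, 1 / d v ≤ ∑ v ∈ H, 1 / d v * x v + ε
  edges : ∑ v ∈ H, d v * x v - ε ^ 2 * (Fintype.card V : ℝ) ^ 2 / 4 ≤ ∑ v ∈ S, d v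

/-- The deterministic half of rounding. Estimates on H are at least εn/4, so the additive degree
error ε²n/4 is at most ε d(v), and the true degrees in S reach (1 - 3ε) d(v). Payment and edge
density are then off by at most 14ε each; with the 2ε of the core this makes 30ε. -/
theorem RoundedWell.utility_ge {G : SimpleGraph V} {c ε : ℝ} {K H S : Finset V} {d x : V → ℝ}
    (hc : 0 < c) (hε : 0 < ε) (hε1 : ε ≤ 1 / 7) (hn : 2 ≤ Fintype.card V)
    (hK : IsOptCore G c ε K) (hKne : K.Nonempty) (hx : FracGood G c ε K H d x)
    (hS : RoundedWell G ε H d x S) : NearOptimal G c (30 * ε) S := by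
  have hN : (2 : ℝ) ≤ Fintype.card V := by exact_mod_cast hn
  set N : ℝ := (Fintype.card V : ℝ) with hNdef
  have hE : N ^ 2 / 4 ≤ edgeMax V := edgeMax_ge hn
  have hE2 : 2 * edgeMax V ≤ N ^ 2 := two_edgeMax_le
  have hE0 : 0 < edgeMax V := by nlinarith
  have hA : 0 < c * edgeMax V := by positivity
  set A := c * edgeMax V with hAdef
  have hdK := hK.deg_pos hε (by omega)
  have hAh := hK.cost_le
  rw [← hAdef] at hAh
  have h1h := one_le_invDegSum G hKne hdK
  have hA1 : A ≤ 1 := by nlinarith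
  have hεN : 0 < ε * N := by positivity
  have hd0 : ∀ v ∈ H, 0 < d v := fun v hv => by
    have := hx.le_est v hv
    rw [← hNdef] at this
    linarith
  have hdeg : ∀ v ∈ H, (1 - 3 * ε) * d v ≤ degIn G S v := by
    intro v hv
    have a1 := hx.degrees v hv
    have a2 := hS.degrees v hv
    have a3 := hx.le_est v hv
    rw [← hNdef] at a2 a3
    nlinarith
  have h3ε : 0 < 1 - 3 * ε := by linarith
  have hdegS : ∀ v ∈ S, 0 < degIn G S v := by
    intro v hv
    have a1 := hdeg v (hS.subset hv)
    have : (0 : ℝ) < degIn G S v := lt_of_lt_of_le (mul_pos h3ε (hd0 v (hS.subset hv))) a1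
    exact_mod_cast this
  have hcost : A * invDegSum G S ≤ A * invDegSum G K + 14 * ε := by
    have b1 : (1 - 3 * ε) * invDegSum G S ≤ ∑ v ∈ S, 1 / d v := by
      rw [invDegSum, Finset.mul_sum]
      refine Finset.sum_le_sum fun v hv => ?_
      have := hd0 v (hS.subset hv)
      rw [mul_one_div, div_le_div_iff₀ (by exact_mod_cast hdegS v hv) this, one_mul]
      exact hdeg v (hS.subset hv)
    have b2 := hx.cost
    rw [← hAdef] at b2
    have b3 := mul_le_mul_of_nonneg_left hS.cost hA.le
    have b4 := mul_le_mul_of_nonneg_left b1 hA.le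
    have b5 : A * ε ≤ ε := by nlinarith
    have b6 : (1 - 3 * ε) * (A * invDegSum G S) ≤ A * invDegSum G K + 5 * ε := by linarith
    -- The origin of 14: the factor 1 - 3ε costs 3ε times the payment, at most 3ε, and 42ε² ≤ 6ε
    -- because ε ≤ 1/7; together the 9ε between 5 and 14.
    have b7 : A * invDegSum G K + 5 * ε ≤ (1 - 3 * ε) * (A * invDegSum G K + 14 * ε) := by
      nlinarith
    exact le_of_mul_le_mul_left (b6.trans b7) h3ε
  have hKe := edgesIn_le_edgeMax G K
  have hSe := edgesIn_le_edgeMax G S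
  have hedge : (edgesIn G K : ℝ) - 14 * ε * edgeMax V ≤ edgesIn G S := by
    have b1 : ∑ v ∈ S, (1 - 3 * ε) * d v ≤ ∑ v ∈ S, (degIn G S v : ℝ) :=
      Finset.sum_le_sum fun v hv => hdeg v (hS.subset hv)
    rw [← Finset.mul_sum] at b1
    have b2 : ∑ v ∈ S, (degIn G S v : ℝ) = 2 * edgesIn G S := by exact_mod_cast sum_degIn G S
    rw [b2] at b1
    have b3 := hS.edges
    have b4 := hx.edges
    rw [← hNdef] at b3 b4
    have b5 : ε ^ 2 * N ^ 2 / 4 ≤ ε * N ^ 2 / 28 := by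
      have : 0 ≤ ε * N ^ 2 := by positivity
      nlinarith
    have b6 : (1 - 3 * ε) * (2 * edgesIn G K - 3 * ε * N ^ 2 - ε * N ^ 2 / 28) ≤
        2 * edgesIn G S :=
      (mul_le_mul_of_nonneg_left (by linarith) h3ε.le).trans b1
    have b7 : 0 ≤ ε * N ^ 2 := by positivity
    have b8 : ε * (edgesIn G K : ℝ) ≤ ε * edgeMax V := by gcongr
    have b9 : 0 ≤ ε * (ε * N ^ 2) := by positivity
    nlinarith
  intro T
  refine (hK.near T).trans ?_
  rw [utility_of_pos G c hdK, utility_of_pos G c hdegS]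
  norm_cast
  change (1 - A * invDegSum G K) * ((edgesIn G K : ℝ) / edgeMax V) + 2 * ε ≤
    (1 - A * invDegSum G S) * ((edgesIn G S : ℝ) / edgeMax V) + 30 * ε
  have e1 : (edgesIn G K : ℝ) / edgeMax V - 14 * ε ≤ edgesIn G S / edgeMax V := by
    rw [div_sub' hE0.ne', div_le_div_iff_of_pos_right hE0]
    linarith
  have e2 : (edgesIn G S : ℝ) / edgeMax V ≤ 1 := (div_le_one hE0).2 hSe
  have e3 : 0 ≤ (edgesIn G S : ℝ) / edgeMax V := by positivity
  have e4 : 0 ≤ A * invDegSum G K := mul_nonneg hA.le (by linarith)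
  set a := A * invDegSum G K
  set b := (edgesIn G K : ℝ) / edgeMax V
  set a' := A * invDegSum G S
  set b' := (edgesIn G S : ℝ) / edgeMax V
  nlinarith [mul_le_mul_of_nonneg_right hcost e3, mul_nonneg hε.le e3,
    mul_le_mul_of_nonneg_left e1 (by linarith : 0 ≤ 1 - a), mul_nonneg e4 hε.le,
    mul_le_mul_of_nonneg_left e2 hε.le]

/-- N + 2 counts the linear forms that rounding has to preserve. For z = ε⁴N/256 the size assumption
gives z² ≥ 324 N / 2¹⁶, so that e^z ≥ z⁴/24 grows quadratically in N. Here the power ε⁸ in the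
assumption matters. -/
theorem mul_exp_le_half {ε N : ℝ} (hε : 0 < ε) (hε1 : ε ≤ 1 / 7)
    (hn : 2 ^ 2 * 3 ^ 4 / ε ^ 8 ≤ N) :
    (N + 2) * Real.exp (-(ε ^ 4 * N / 256)) ≤ 1 / 2 := by
  have h8 : ε ^ 8 ≤ (1 / 7) ^ 8 := pow_le_pow_left₀ hε.le hε1 8
  have hp : 0 < ε ^ 8 := by positivity
  rw [div_le_iff₀ hp] at hn
  have hN : 2 ^ 2 * 3 ^ 4 * 7 ^ 8 ≤ N := by
    by_contra h
    push Not at h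
    have : N * ε ^ 8 < 2 ^ 2 * 3 ^ 4 := by
      rcases le_or_gt N 0 with h0 | h0
      · nlinarith
      · calc N * ε ^ 8 ≤ N * (1 / 7) ^ 8 := by gcongr
          _ < 2 ^ 2 * 3 ^ 4 * 7 ^ 8 * (1 / 7) ^ 8 := by gcongr
          _ = _ := by norm_num
    linarith
  have hN0 : 0 < N := lt_of_lt_of_le (by positivity) hN
  set z := ε ^ 4 * N / 256 with hz
  have hz0 : 0 ≤ z := by positivity
  have hz2 : 324 * N / 65536 ≤ z ^ 2 := by
    have e : z ^ 2 = N * (N * ε ^ 8) / 65536 := by rw [hz]; ring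
    rw [e, div_le_div_iff_of_pos_right (by norm_num)]
    nlinarith
  have h4 : z ^ 4 / 24 ≤ Real.exp z := by
    have := Real.pow_div_factorial_le_exp z hz0 4
    norm_num [Nat.factorial] at this
    exact this
  have h5 : (324 * N / 65536) ^ 2 ≤ z ^ 4 := by
    calc (324 * N / 65536) ^ 2 ≤ (z ^ 2) ^ 2 := by gcongr
      _ = z ^ 4 := by ring
  rw [Real.exp_neg, ← div_eq_mul_inv, div_le_iff₀ (Real.exp_pos _)]
  nlinarith

theorem one_le_add_compl {α : Type*} (p : PMF α) (A : Set α) :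
    1 ≤ p.toOuterMeasure A + p.toOuterMeasure Aᶜ := by
  have h := MeasureTheory.measure_union_le (μ := p.toOuterMeasure) A Aᶜ
  rw [Set.union_compl_self] at h
  rwa [(PMF.toOuterMeasure_apply_eq_one_iff p (s := Set.univ)).2 (Set.subset_univ _)] at h

open Classical in
-- A union bound: failure means a large deviation of the degree of some node, of the cost or of the
-- number of edges, or the null event of leaving H, where x vanishes.
theorem half_le_roundedWell {G : SimpleGraph V} {c ε : ℝ} {K H : Finset V} {d x : V → ℝ}
    (hε : 0 < ε) (hε1 : ε ≤ 1 / 7) (hn : 2 ^ 2 * 3 ^ 4 / ε ^ 8 ≤ (Fintype.card V : ℝ))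
    (hx : FracGood G c ε K H d x) :
    1 / 2 ≤ (roundSet x).toOuterMeasure {S | RoundedWell G ε H d x S} := by
  have hN : 0 < (Fintype.card V : ℝ) := lt_of_lt_of_le (by positivity) hn
  set N : ℝ := (Fintype.card V : ℝ) with hNdef
  have hεN : 0 < ε * N := by positivity
  have hd0 : ∀ v ∈ H, 0 < d v := fun v hv => by
    have := hx.le_est v hv
    rw [← hNdef] at this
    linarith
  set t := ε ^ 2 * N / 4 with ht
  have ht0 : 0 ≤ t := by positivity
  have htN : t ≤ 4 * N := by rw [ht]; nlinarith
  -- All coefficients are scaled to absolute value at most 2, so that one deviation t fits every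
  -- form. Degrees and edges need lower bounds and therefore carry a minus sign.
  let aD : V → V → ℝ := fun v u => if u ∈ H ∧ G.Adj v u then -1 else 0
  let aC : V → ℝ := fun u => if u ∈ H then ε * N / 4 * (1 / d u) else 0
  let aE : V → ℝ := fun u => if u ∈ H then -(d u / N) else 0
  let B : (V → ℝ) → Set (Finset V) := fun a => {S | t ≤ ∑ v ∈ S, a v - ∑ v, a v * x v}
  have hexp : ∀ a : V → ℝ, (∀ v, |a v| ≤ 2) → (roundSet x).toOuterMeasure (B a) ≤
      ENNReal.ofReal (Real.exp (-(ε ^ 4 * N / 256))) := by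
    intro a ha
    refine (roundSet_tail hx.mem_unit ha ht0 htN).trans (le_of_eq ?_)
    rw [← hNdef, ht]
    congr 3
    field_simp
    norm_num
  have hD2 : ∀ v u, |aD v u| ≤ 2 := by
    intro v u
    simp only [aD]
    split_ifs <;> norm_num
  have hC2 : ∀ u, |aC u| ≤ 2 := by
    intro u
    simp only [aC]
    split_ifs with h
    · have h1 := hx.le_est u h
      have h0 := hd0 u h
      rw [abs_of_nonneg (by positivity), mul_one_div, div_le_iff₀ h0]
      linarith
    · norm_num
  have hE2 : ∀ u, |aE u| ≤ 2 := by
    intro u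
    simp only [aE]
    split_ifs with h
    · have h1 := hx.est_le u h
      have h0 := hd0 u h
      rw [abs_neg, abs_of_nonneg (by positivity), div_le_iff₀ hN]
      linarith
    · norm_num
  let Z : Set (Finset V) := {S | ¬ S ⊆ H}
  have hZ : (roundSet x).toOuterMeasure Z = 0 := by
    rw [PMF.toOuterMeasure_apply_eq_zero_iff, Set.disjoint_left]
    intro S hS hSZ
    obtain ⟨v, hvS, hvH⟩ := Finset.not_subset.1 hSZ
    rw [PMF.mem_support_iff] at hS
    apply hS
    rw [roundSet_apply, Finset.prod_eq_zero hvS, zero_mul]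
    rw [hx.outside v hvH]
    simp [clamp]
  have hcompl : {S | RoundedWell G ε H d x S}ᶜ ⊆
      (⋃ v ∈ (Finset.univ : Finset V), B (aD v)) ∪ (B aC ∪ (B aE ∪ Z)) := by
    intro S hS
    by_contra hcon
    simp only [Set.mem_union, Set.mem_iUnion, not_or, not_exists] at hcon
    obtain ⟨c1, c2, c3, c4⟩ := hcon
    have hSH : S ⊆ H := not_not.1 c4
    apply hS
    have hsumH : ∀ f : V → ℝ, ∑ v, (if v ∈ H then f v else 0) * x v = ∑ v ∈ H, f v * x v := by
      intro f
      rw [← Finset.sum_subset (Finset.subset_univ H)]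
      · exact Finset.sum_congr rfl fun v hv => by rw [if_pos hv]
      · intro v _ hv
        rw [if_neg hv, zero_mul]
    have hsumS : ∀ f : V → ℝ, ∑ v ∈ S, (if v ∈ H then f v else 0) = ∑ v ∈ S, f v := fun f =>
      Finset.sum_congr rfl fun v hv => by rw [if_pos (hSH hv)]
    refine ⟨hSH, fun v hv => ?_, ?_, ?_⟩
    · have h := c1 v (Finset.mem_univ v)
      simp only [B, Set.mem_ofPred_eq, not_le] at h
      have e1 : ∑ u ∈ S, aD v u = -(degIn G S v : ℝ) := by
        rw [degIn_eq_sum, Nat.cast_sum, ← Finset.sum_neg_distrib]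
        refine Finset.sum_congr rfl fun u hu => ?_
        simp only [aD, hSH hu, true_and]
        split_ifs <;> simp
      have e2 : ∑ u, aD v u * x u = -∑ u ∈ H.filter (fun u => G.Adj v u), x u := by
        rw [Finset.sum_filter, ← Finset.sum_neg_distrib,
          ← Finset.sum_subset (Finset.subset_univ H)]
        · refine Finset.sum_congr rfl fun u hu => ?_
          simp only [aD, hu, true_and]
          split_ifs <;> simp
        · intro u _ hu
          simp [aD, hu]
      rw [e1, e2] at h
      linarith
    · simp only [B, Set.mem_ofPred_eq, not_le, aC, hsumH, hsumS] at c2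
      rw [← Finset.mul_sum] at c2
      have e : ∑ v ∈ H, ε * N / 4 * (1 / d v) * x v = ε * N / 4 * ∑ v ∈ H, 1 / d v * x v := by
        rw [Finset.mul_sum]
        exact Finset.sum_congr rfl fun _ _ => by ring
      rw [e] at c2
      have key : ε * N / 4 * (∑ v ∈ S, 1 / d v) <
          ε * N / 4 * (∑ v ∈ H, 1 / d v * x v + ε) := by
        have : ε * N / 4 * ε = t := by rw [ht]; ring
        rw [mul_add, this]
        linarith
      exact (lt_of_mul_lt_mul_left key (by positivity)).le
    · simp only [B, Set.mem_ofPred_eq, not_le, aE, hsumH, hsumS] at c3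
      rw [Finset.sum_neg_distrib, ← Finset.sum_div] at c3
      have e : ∑ v ∈ H, -(d v / N) * x v = -(∑ v ∈ H, d v * x v) / N := by
        rw [← Finset.sum_neg_distrib, Finset.sum_div]
        exact Finset.sum_congr rfl fun _ _ => by ring
      rw [e] at c3
      have : (∑ v ∈ H, d v * x v - ∑ v ∈ S, d v) / N < t := by
        rw [sub_div]; rw [neg_div] at c3; linarith
      rw [div_lt_iff₀ hN] at this
      have e4 : ε ^ 2 * N ^ 2 / 4 = t * N := by rw [ht]; ring
      rw [← hNdef, e4]
      linarith
  have hbad : (roundSet x).toOuterMeasure {S | RoundedWell G ε H d x S}ᶜ ≤ 1 / 2 := by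
    refine (MeasureTheory.measure_mono hcompl).trans ?_
    refine (MeasureTheory.measure_union_le _ _).trans ?_
    refine (add_le_add (MeasureTheory.measure_biUnion_finset_le _ _)
      ((MeasureTheory.measure_union_le _ _).trans (add_le_add (hexp _ hC2)
        ((MeasureTheory.measure_union_le _ _).trans (add_le_add (hexp _ hE2) hZ.le))))).trans ?_
    refine (add_le_add (Finset.sum_le_sum fun v _ => hexp _ (hD2 v)) le_rfl).trans ?_
    rw [Finset.sum_const, Finset.card_univ, nsmul_eq_mul, add_zero]
    set y := Real.exp (-(ε ^ 4 * N / 256)) with hy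
    have hy0 : 0 ≤ y := (Real.exp_pos _).le
    have e : (Fintype.card V : ℝ≥0∞) = ENNReal.ofReal N := by
      rw [hNdef, ENNReal.ofReal_natCast]
    rw [e, ← ENNReal.ofReal_mul hN.le, ← ENNReal.ofReal_add hy0 hy0,
      ← ENNReal.ofReal_add (by positivity) (by positivity)]
    have h := mul_exp_le_half hε hε1 hn
    rw [← hy] at h
    have e2 : (1 / 2 : ℝ≥0∞) = ENNReal.ofReal (1 / 2) := by
      rw [ENNReal.ofReal_div_of_pos (by norm_num)]; simp
    rw [e2]
    exact ENNReal.ofReal_le_ofReal (by linarith)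
  have h1 := one_le_add_compl (roundSet x) {S | RoundedWell G ε H d x S}
  have h2 : (1 : ℝ≥0∞) ≤ (roundSet x).toOuterMeasure {S | RoundedWell G ε H d x S} + 1 / 2 :=
    h1.trans (by gcongr)
  have h3 := tsub_le_iff_right.2 h2
  simpa using h3

/-- Rounding a good fractional solution yields a nearly optimal set with probability at least
one half. -/
theorem half_le_nearOptimal {G : SimpleGraph V} {c ε : ℝ} {K H : Finset V} {d x : V → ℝ}
    (hc : 0 < c) (hε : 0 < ε) (hε1 : ε ≤ 1 / 7)
    (hn : 2 ^ 2 * 3 ^ 4 / ε ^ 8 ≤ (Fintype.card V : ℝ)) (hn2 : 2 ≤ Fintype.card V)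
    (hK : IsOptCore G c ε K) (hKne : K.Nonempty) (hx : FracGood G c ε K H d x) :
    1 / 2 ≤ (roundSet x).toOuterMeasure {S | NearOptimal G c (30 * ε) S} :=
  (half_le_roundedWell hε hε1 hn hx).trans <| MeasureTheory.measure_mono fun _ hS =>
    hS.utility_ge hc hε hε1 hn2 hK hKne hx

end Rounding

end UGSC

namespace UGSC

/-! ### Degree estimates from a random sample -/

section Sampling

variable {V : Type} [Fintype V]

/-- The error ε²N/5 is ε times εN/5, hence a relative error ε on all degrees from εN/5 upwards. -/
theorem est_bounds {ε N d g : ℝ} (hε : 0 < ε) (h : |d - g| ≤ ε ^ 2 / 5 * N)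
    (hg : ε * N / 5 ≤ g) : (1 - ε) * g ≤ d ∧ d ≤ (1 + ε) * g := by
  rw [abs_le] at h
  constructor <;> nlinarith

/-- 1/4 - ε/5 ≥ 1/5 for ε ≤ 1/7. It makes the relative error bounds available at every node with a
high estimate, not only within the core. -/
theorem est_deg_ge {ε N d g : ℝ} (hε : 0 < ε) (hN : 0 ≤ N) (hε1 : ε ≤ 1 / 7)
    (h : |d - g| ≤ ε ^ 2 / 5 * N) (hd : ε * N / 4 ≤ d) : ε * N / 5 ≤ g := by
  rw [abs_le] at h
  have : 0 ≤ ε * N := by positivity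
  nlinarith

theorem est_le_two_mul {ε N d g : ℝ} (hε : 0 < ε) (hN : 0 ≤ N) (hε1 : ε ≤ 1 / 7)
    (h : |d - g| ≤ ε ^ 2 / 5 * N) (hg : g ≤ N) : d ≤ 2 * N := by
  rw [abs_le] at h
  have : ε ^ 2 ≤ 1 := by nlinarith
  nlinarith

/-- The inverse degree estimates of a core sum up to nearly its sum of inverse degrees. -/
theorem sum_inv_est_le {G : SimpleGraph V} {ε : ℝ} {K : Finset V} {d : V → ℝ}
    (hε : 0 < ε) (hε1 : ε ≤ 1 / 7) (hV : 0 < Fintype.card V)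
    (hK : ∀ v ∈ K, ε * Fintype.card V / 3 ≤ degIn G K v)
    (hd : ∀ v, |d v - degIn G K v| ≤ ε ^ 2 / 5 * Fintype.card V) :
    (1 - ε) * ∑ v ∈ K, 1 / d v ≤ invDegSum G K := by
  have hN : 0 < (Fintype.card V : ℝ) := by exact_mod_cast hV
  rw [invDegSum, Finset.mul_sum]
  refine Finset.sum_le_sum fun v hv => ?_
  have h1 := hK v hv
  have hεN : 0 < ε * Fintype.card V := by positivity
  have h2 := est_bounds hε (hd v) (by linarith)
  have h3 : 0 < (degIn G K v : ℝ) := by linarith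
  have h4 : 0 < d v := by nlinarith
  rw [mul_one_div, div_le_div_iff₀ h4 h3, one_mul]
  exact h2.1

/-- The degree estimates of a core sum up to nearly twice its number of edges. -/
theorem le_sum_est {G : SimpleGraph V} {ε : ℝ} {K : Finset V} {d : V → ℝ} (hε : 0 < ε)
    (hK : ∀ v ∈ K, ε * Fintype.card V / 3 ≤ degIn G K v)
    (hd : ∀ v, |d v - degIn G K v| ≤ ε ^ 2 / 5 * Fintype.card V) :
    2 * (1 - ε) * edgesIn G K ≤ ∑ v ∈ K, d v := by
  have h1 : (∑ v ∈ K, (degIn G K v : ℝ)) = 2 * edgesIn G K := by exact_mod_cast sum_degIn G K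
  have h2 : ∑ v ∈ K, (1 - ε) * (degIn G K v : ℝ) ≤ ∑ v ∈ K, d v :=
    Finset.sum_le_sum fun v hv => by
      have h1 := hK v hv
      have hεN : 0 ≤ ε * Fintype.card V := by positivity
      exact (est_bounds hε (hd v) (by linarith)).1
  rw [← Finset.mul_sum, h1] at h2
  linarith

/-- (1 - q)^t ≤ e^(-qt) ≤ e^(-n) ≤ 1/n. Asking for q t ≥ n is generous, but a further factor n in
the number of iterations is harmless. -/
theorem one_sub_pow_le {q : ℝ} {t : ℕ} {n : ℝ} (hq1 : q ≤ 1) (hn : 0 < n)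
    (h : n ≤ q * t) : (1 - q) ^ t ≤ 1 / n := by
  have h1 : (1 - q) ^ t ≤ Real.exp (-q) ^ t :=
    pow_le_pow_left₀ (by linarith) (by linarith [Real.add_one_le_exp (-q)]) t
  refine h1.trans ?_
  rw [← Real.exp_nat_mul]
  have h2 : Real.exp (t * -q) ≤ Real.exp (-n) := Real.exp_le_exp.2 (by linarith)
  refine h2.trans ?_
  rw [Real.exp_neg, ← one_div]
  exact one_div_le_one_div_of_le hn (by linarith [Real.add_one_le_exp n])

open Classical in
/-- A uniformly random sample is a good sample from the core `K` with a noticeable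
probability. -/
theorem le_prob_goodSample [Nonempty V] {ε : ℝ} (hε : 0 < ε) (hε1 : ε ≤ 1 / 7)
    (hn : 2 ≤ Fintype.card V) (G : SimpleGraph V) {K : Finset V} (hK : K.Nonempty)
    (hdeg : ∀ v ∈ K, ε * Fintype.card V / 3 ≤ degIn G K v) (m : ℕ)
    (hm : (3 : ℝ) ^ 6 / ε ^ 4 * Real.log (Fintype.card V) ≤ m) :
    (ε / 3) ^ m / 2 ≤ ((Finset.univ.filter fun M : Fin m → V =>
      GoodSample G K (ε ^ 2 / 5 * Fintype.card V) M).card : ℝ) / (Fintype.card V : ℝ) ^ m := by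
  have hN : 0 < (Fintype.card V : ℝ) := by exact_mod_cast (by omega : 0 < Fintype.card V)
  have h := card_goodSample hε hε1 hn G hK m hm
  obtain ⟨v, hv⟩ := hK
  -- A node of the core has εn/3 neighbours inside it, so a random node hits K with probability at
  -- least ε/3.
  have h1 : ε * Fintype.card V / 3 ≤ K.card :=
    (hdeg v hv).trans (by exact_mod_cast degIn_le_card G K v)
  rw [le_div_iff₀ (by positivity)]
  have h2 : (ε * Fintype.card V / 3) ^ m ≤ (K.card : ℝ) ^ m :=
    pow_le_pow_left₀ (by positivity) h1 m
  have e : (ε / 3) ^ m / 2 * (Fintype.card V : ℝ) ^ m = (ε * Fintype.card V / 3) ^ m / 2 := by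
    rw [mul_div_right_comm, mul_pow]; ring
  rw [e]
  linarith

end Sampling

/-! ### The sampling algorithm succeeds with high probability -/

section SamplingAlgorithm

variable {V : Type} [Fintype V]

theorem prob_le_one {α : Type*} (p : PMF α) (A : Set α) : p.toOuterMeasure A ≤ 1 :=
  (MeasureTheory.measure_mono (Set.subset_univ _)).trans
    ((PMF.toOuterMeasure_apply_eq_one_iff p (s := Set.univ)).2 (Set.subset_univ _)).le

/-- Independence of the draws. It serves twice, for the guesses within one iteration and for the
list of iterations, each time for the event that everything fails. -/
theorem toOuterMeasure_mapM_le {α β : Type} (f : α → PMF β) (A : Set β) (l : List α) :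
    (l.mapM f).toOuterMeasure {L | ∀ y ∈ L, y ∈ A} ≤
      (l.map fun a => (f a).toOuterMeasure A).prod := by
  induction l with
  | nil =>
    rw [List.map_nil, List.prod_nil]
    exact prob_le_one _ _
  | cons a l ih =>
    rw [List.mapM_cons, List.map_cons, List.prod_cons]
    change ((f a).bind fun b => (l.mapM f).bind fun bs => PMF.pure (b :: bs)).toOuterMeasure _ ≤ _
    rw [PMF.toOuterMeasure_bind_apply, PMF.toOuterMeasure_apply (f a) A, ← ENNReal.tsum_mul_right]
    refine ENNReal.tsum_le_tsum fun b => ?_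
    by_cases hb : b ∈ A
    · rw [Set.indicator_of_mem hb]
      refine mul_le_mul_right (le_trans ?_ ih) _
      rw [PMF.toOuterMeasure_bind_apply, PMF.toOuterMeasure_apply]
      refine ENNReal.tsum_le_tsum fun L => ?_
      by_cases hL : ∀ y ∈ L, y ∈ A
      · rw [Set.indicator_of_mem (by exact hL)]
        refine (mul_le_mul_right ?_ _).trans (mul_one _).le
        exact prob_le_one _ _
      · rw [PMF.toOuterMeasure_pure_apply, if_neg, mul_zero]
        · exact zero_le
        · intro h
          exact hL fun y hy => h y (List.mem_cons_of_mem _ hy)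
    · rw [Set.indicator_of_notMem hb, zero_mul]
      refine le_of_eq (mul_eq_zero_of_right _ ?_)
      rw [PMF.toOuterMeasure_apply_eq_zero_iff, Set.disjoint_left]
      intro L hL hLA
      rw [PMF.mem_support_bind_iff] at hL
      obtain ⟨bs, -, hbs⟩ := hL
      rw [PMF.mem_support_pure_iff] at hbs
      subst hbs
      exact hb (hLA b List.mem_cons_self)

/-- Of the failure probabilities of the guesses only the one of the matching guess is controlled;
the others are bounded by 1. -/
theorem list_prod_le_of_mem {l : List ℝ≥0∞} (h : ∀ y ∈ l, y ≤ 1) {x : ℝ≥0∞} (hx : x ∈ l) :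
    l.prod ≤ x := by
  have h1 : ∀ l : List ℝ≥0∞, (∀ y ∈ l, y ≤ 1) → l.prod ≤ 1 := by
    intro l
    induction l with
    | nil => simp
    | cons a l ih =>
      intro hl
      rw [List.prod_cons]
      exact mul_le_one' (hl a List.mem_cons_self) (ih fun y hy => hl y (List.mem_cons_of_mem _ hy))
  induction l with
  | nil => simp at hx
  | cons a l ih =>
    rw [List.prod_cons]
    rcases List.mem_cons.1 hx with rfl | hx'
    · exact mul_le_of_le_one_right' (h1 l fun y hy => h y (List.mem_cons_of_mem _ hy))
    · exact (mul_le_of_le_one_left' (h a List.mem_cons_self)).trans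
        (ih (fun y hy => h y (List.mem_cons_of_mem _ hy)) hx')

/-- The guess that matches the core `K`. -/
theorem mem_guesses {G : SimpleGraph V} {ε : ℝ} {K : Finset V} (hε : 0 < ε)
    (hV : 0 < Fintype.card V) (hKne : K.Nonempty)
    (hK : ∀ v ∈ K, ε * Fintype.card V / 3 ≤ degIn G K v) :
    (K.card, edgesIn G K) ∈ guesses (Fintype.card V) ε := by
  have hN : 0 < (Fintype.card V : ℝ) := by exact_mod_cast hV
  refine List.mem_product.2 ⟨?_, ?_⟩
  · rw [List.mem_range'_1]
    exact ⟨hKne.card_pos, by have := Finset.card_le_univ K; omega⟩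
  · rw [List.mem_filter, List.mem_range]
    constructor
    · have h1 := edgesIn_le_edgeMax G K
      have h2 : 2 * edgeMax V ≤ (Fintype.card V : ℝ) ^ 2 := two_edgeMax_le
      have h3 : (edgesIn G K : ℝ) < (Fintype.card V : ℝ) ^ 2 + 1 := by
        have : (0 : ℝ) ≤ edgesIn G K := Nat.cast_nonneg _
        linarith
      exact_mod_cast h3
    · rw [decide_eq_true_eq]
      have h1 : (∑ v ∈ K, (degIn G K v : ℝ)) = 2 * edgesIn G K := by
        exact_mod_cast sum_degIn G K
      -- 2k is the degree sum, at least |K| εn/3 ≥ (εn/3)²; this is the lower end ε²n²/18 of the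
      -- guesses for k.
      have h2 := Finset.sum_le_sum hK
      rw [h1, Finset.sum_const, nsmul_eq_mul] at h2
      obtain ⟨v, hv⟩ := hKne
      have h3 : ε * Fintype.card V / 3 ≤ K.card :=
        (hK v hv).trans (by exact_mod_cast degIn_le_card G K v)
      have h4 : 0 ≤ ε * Fintype.card V / 3 := by positivity
      nlinarith

/-- Degrees do not exceed n, so capping an estimate at n can only bring it closer to the truth. -/
theorem abs_min_sub_le {y N g : ℝ} (h : g ≤ N) : |min y N - g| ≤ |y - g| := by
  rcases le_total y N with h1 | h1
  · rw [min_eq_left h1]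
  · rw [min_eq_right h1, abs_of_nonneg (by linarith), abs_of_nonneg (by linarith)]
    linarith

open Classical in
-- For the right guess and a good sample the indicator of K is feasible. Optimality of the solution
-- is used against this one competitor only, so it does not matter which optimal solution is chosen.
theorem half_le_candidate {G : SimpleGraph V} {c ε : ℝ} {K : Finset V} (hc : 0 < c)
    (hε : 0 < ε) (hε1 : ε ≤ 1 / 7) (hn : 2 ^ 2 * 3 ^ 4 / ε ^ 8 ≤ (Fintype.card V : ℝ))
    (hn2 : 2 ≤ Fintype.card V) (hK : IsOptCore G c ε K) (hKne : K.Nonempty)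
    {solver : Finset V → ℕ → (V → ℝ) → (V → ℝ)} (hsolver : IsLPSolver G c ε solver)
    {m : ℕ} {M : Fin m → V} (hM : GoodSample G K (ε ^ 2 / 5 * Fintype.card V) M) :
    1 / 2 ≤ (candidate G ε solver M (K.card, edgesIn G K)).toOuterMeasure
      {S | NearOptimal G c (30 * ε) S} := by
  have hN : 0 < (Fintype.card V : ℝ) := lt_of_lt_of_le (by positivity) hn
  have hεN : 0 < ε * Fintype.card V := by positivity
  rw [candidate]
  dsimp only
  set d := degEstimate G M K.card with hddef
  set H := highDegree ε d with hHdef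
  set N : ℝ := (Fintype.card V : ℝ) with hNdef
  have hdN : ∀ v, (degIn G K v : ℝ) ≤ N := fun v => by
    exact Nat.cast_le.2 ((degIn_le_card G K v).trans (Finset.card_le_univ K))
  have hd : ∀ v, |d v - degIn G K v| ≤ ε ^ 2 / 5 * N := by
    intro v
    refine le_trans ?_ (hM v)
    rw [hddef, degEstimate, ← hNdef]
    exact abs_min_sub_le (hdN v)
  -- The cutoff (1 - ε)ε/3 is at least 2ε/7, above ε/4; yet by `hKH` every node of the core passes
  -- it in spite of the estimation error.
  have hH4 : ∀ v ∈ H, ε * N / 4 ≤ d v := by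
    intro v hv
    rw [hHdef, highDegree, Finset.mem_filter] at hv
    have := hv.2
    nlinarith
  have hHg : ∀ v ∈ H, ε * N / 5 ≤ degIn G K v := fun v hv =>
    est_deg_ge hε hN.le hε1 (hd v) (hH4 v hv)
  have hKH : K ⊆ H := by
    intro v hv
    rw [hHdef, highDegree, Finset.mem_filter]
    refine ⟨Finset.mem_univ v, ?_⟩
    have h1 := hK.le_deg v hv
    have h2 := (est_bounds hε (hd v) (by linarith)).1
    nlinarith
  let z : V → ℝ := fun v => if v ∈ K then 1 else 0
  have hsum : ∀ f : V → ℝ, ∑ v ∈ H, f v * z v = ∑ v ∈ K, f v := by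
    intro f
    simp only [z, mul_ite, mul_one, mul_zero]
    rw [Finset.sum_ite_mem, Finset.inter_eq_right.2 hKH]
  have hfeas : LPFeasible G ε H (edgesIn G K) d z := by
    refine ⟨fun v _ => ?_, fun v hv => ?_, ?_, fun v hv => ?_⟩
    · simp only [z]; split_ifs <;> norm_num
    · exact if_neg fun h => hv (hKH h)
    · rw [hsum]
      exact le_sum_est hε hK.le_deg hd
    · have h1 := (est_bounds hε (hd v) (hHg v hv)).2
      have h2 : ∑ u ∈ H.filter (fun u => G.Adj u v), z u = degIn G K v := by
        rw [Finset.sum_filter, degIn_eq_sum]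
        push_cast
        rw [← Finset.sum_subset hKH]
        · refine Finset.sum_congr rfl fun u hu => ?_
          simp [z, hu, G.adj_comm]
        · intro u _ hu
          simp [z, hu]
      rw [h2, one_div, inv_mul_le_iff₀ (by linarith)]
      exact h1
  rw [if_pos ⟨z, hfeas⟩]
  obtain ⟨hx, hopt⟩ := hsolver H (edgesIn G K) d ⟨z, hfeas⟩
  set x := solver H (edgesIn G K) d
  refine half_le_nearOptimal (K := K) (H := H) (d := d) hc hε hε1 hn hn2 hK hKne
    ⟨fun v => ?_, hx.outside, hH4, fun v hv => ?_, fun v hv => ?_, ?_, ?_⟩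
  · by_cases hv : v ∈ H
    · exact hx.mem_unit v hv
    · rw [hx.outside v hv]; norm_num
  · exact est_le_two_mul hε hN.le hε1 (hd v) (hdN v)
  · have h1 := hx.degrees v hv
    have h2 := hH4 v hv
    simp only [G.adj_comm v]
    refine le_trans ?_ h1
    have : 1 - 2 * ε ≤ 1 / (1 + ε) := by
      rw [le_div_iff₀ (by linarith)]; nlinarith
    exact mul_le_mul_of_nonneg_right this (by linarith)
  · refine le_trans ?_ hx.edges
    have h1 := edgesIn_le_edgeMax G K
    have h2 : 2 * edgeMax V ≤ N ^ 2 := two_edgeMax_le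
    have : ε * (2 * edgesIn G K) ≤ ε * N ^ 2 := by gcongr; linarith
    nlinarith [sq_nonneg N]
  · have h1 := hopt z hfeas
    rw [lpObjective, lpObjective, hsum] at h1
    have e1 : ∑ v ∈ H, c * edgeMax V / d v * x v = c * edgeMax V * ∑ v ∈ H, 1 / d v * x v := by
      rw [Finset.mul_sum]
      exact Finset.sum_congr rfl fun v _ => by ring
    have e2 : ∑ v ∈ K, c * edgeMax V / d v = c * edgeMax V * ∑ v ∈ K, 1 / d v := by
      rw [Finset.mul_sum]
      exact Finset.sum_congr rfl fun v _ => by ring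
    rw [e1, e2] at h1
    refine h1.trans ?_
    have h2 := sum_inv_est_le hε hε1 (by omega) hK.le_deg hd
    have hA : 0 ≤ c * edgeMax V := mul_nonneg hc.le (by rw [edgeMax]; positivity)
    have h3 := mul_le_mul_of_nonneg_left h2 hA
    have h4 := hK.cost_le
    -- The payment for K is at most 1, so dividing by 1 - ε adds less than 4ε.
    have h5 : (1 - ε) * (c * edgeMax V * ∑ v ∈ K, 1 / d v) ≤
        (1 - ε) * (c * edgeMax V * invDegSum G K + 4 * ε) := by nlinarith
    exact le_of_mul_le_mul_left h5 (by linarith)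

theorem ofReal_half : ENNReal.ofReal (1 / 2) = 1 / 2 := by
  rw [ENNReal.ofReal_div_of_pos (by norm_num)]; simp

open Classical in
/-- One iteration fails to produce a nearly optimal set with probability at most `1 - q`. -/
theorem iteration_fail_le [Nonempty V] {G : SimpleGraph V} {c ε : ℝ} {K : Finset V} (hc : 0 < c)
    (hε : 0 < ε) (hε1 : ε ≤ 1 / 7) (hn : 2 ^ 2 * 3 ^ 4 / ε ^ 8 ≤ (Fintype.card V : ℝ))
    (hn2 : 2 ≤ Fintype.card V) (hK : IsOptCore G c ε K) (hKne : K.Nonempty)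
    {solver : Finset V → ℕ → (V → ℝ) → (V → ℝ)} (hsolver : IsLPSolver G c ε solver) :
    (iteration G ε solver).toOuterMeasure {L | ∀ S ∈ L, S ∈ {S | ¬ NearOptimal G c (30 * ε) S}} ≤
      ENNReal.ofReal (1 - (ε / 3) ^ sampleSize (Fintype.card V) ε / 4) := by
  set m := sampleSize (Fintype.card V) ε with hm
  have hN : 0 < (Fintype.card V : ℝ) := lt_of_lt_of_le (by positivity) hn
  set A : Finset (Fin m → V) := Finset.univ.filter fun M : Fin m → V =>
      GoodSample G K (ε ^ 2 / 5 * Fintype.card V) M with hA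
  have hgood := le_prob_goodSample hε hε1 hn2 G hKne hK.le_deg m (Nat.le_ceil _)
  change ((PMF.uniformOfFintype (Fin m → V)).bind fun M =>
    (guesses (Fintype.card V) ε).mapM fun g => candidate G ε solver M g).toOuterMeasure _ ≤ _
  rw [PMF.toOuterMeasure_bind_apply, tsum_fintype]
  -- Good samples are credited with failure probability 1/2, all others with the trivial bound 1.
  have hterm : ∀ M : Fin m → V, ((guesses (Fintype.card V) ε).mapM fun g =>
      candidate G ε solver M g).toOuterMeasure
        {L | ∀ S ∈ L, S ∈ {S | ¬ NearOptimal G c (30 * ε) S}} ≤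
      ENNReal.ofReal (1 - if M ∈ A then 1 / 2 else 0) := by
    intro M
    split_ifs with hMA
    · refine (toOuterMeasure_mapM_le _ _ _).trans ?_
      have hM : GoodSample G K (ε ^ 2 / 5 * Fintype.card V) M := (Finset.mem_filter.1 hMA).2
      have h1 := half_le_candidate hc hε hε1 hn hn2 hK hKne hsolver hM
      have hmem := mem_guesses hε (by omega) hKne hK.le_deg
      refine (list_prod_le_of_mem (x := (candidate G ε solver M
        (K.card, edgesIn G K)).toOuterMeasure {S | ¬ NearOptimal G c (30 * ε) S}) ?_ ?_).trans ?_
      · intro y hy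
        obtain ⟨g, -, rfl⟩ := List.mem_map.1 hy
        exact prob_le_one _ _
      · exact List.mem_map.2 ⟨_, hmem, rfl⟩
      · have h2 : ∀ p : PMF (Finset V), 1 / 2 ≤ p.toOuterMeasure {S | NearOptimal G c (30 * ε) S} →
            p.toOuterMeasure {S | ¬ NearOptimal G c (30 * ε) S} ≤ 1 / 2 := by
          intro p hp
          have h3 : p.toOuterMeasure {S | NearOptimal G c (30 * ε) S} +
              p.toOuterMeasure {S | ¬ NearOptimal G c (30 * ε) S} = 1 := by
            rw [toOuterMeasure_eq_sum, toOuterMeasure_eq_sum]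
            simp only [Set.mem_ofPred_eq]
            rw [Finset.sum_filter_add_sum_filter_not]
            rw [← tsum_fintype (L := .unconditional _), PMF.tsum_coe]
          have h4 : 1 / 2 + p.toOuterMeasure {S | ¬ NearOptimal G c (30 * ε) S} ≤ 1 / 2 + 1 / 2 := by
            rw [ENNReal.add_halves]
            exact (add_le_add_left hp _).trans h3.le
          exact (ENNReal.add_le_add_iff_left (by simp)).1 h4
        rw [show (1 : ℝ) - 1 / 2 = 1 / 2 by norm_num, ofReal_half]
        exact h2 _ h1
    · rw [sub_zero, ENNReal.ofReal_one]
      exact prob_le_one _ _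
  have hcard : (Fintype.card (Fin m → V) : ℝ) = (Fintype.card V : ℝ) ^ m := by
    rw [Fintype.card_fun, Fintype.card_fin]; push_cast; rfl
  have hu : ∀ M : Fin m → V, PMF.uniformOfFintype (Fin m → V) M =
      ENNReal.ofReal (1 / (Fintype.card V : ℝ) ^ m) := by
    intro M
    rw [PMF.uniformOfFintype_apply, ← hcard, one_div, ENNReal.ofReal_inv_of_pos,
      ENNReal.ofReal_natCast]
    rw [hcard]; positivity
  have hnn : ∀ M : Fin m → V, (0 : ℝ) ≤ 1 - if M ∈ A then 1 / 2 else 0 := fun M => by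
    split_ifs <;> norm_num
  refine (Finset.sum_le_sum fun M _ => mul_le_mul' (hu M).le (hterm M)).trans ?_
  simp only [← ENNReal.ofReal_mul (by positivity : (0 : ℝ) ≤ 1 / (Fintype.card V : ℝ) ^ m)]
  rw [← ENNReal.ofReal_sum_of_nonneg fun M _ => mul_nonneg (by positivity) (hnn M)]
  refine ENNReal.ofReal_le_ofReal ?_
  rw [← Finset.mul_sum, Finset.sum_sub_distrib, Finset.sum_ite_mem, Finset.univ_inter]
  simp only [Finset.sum_const, Finset.card_univ, nsmul_eq_mul, mul_one]
  rw [hcard]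
  have e : 1 / (Fintype.card V : ℝ) ^ m * ((Fintype.card V : ℝ) ^ m - A.card * (1 / 2)) =
      1 - (A.card / (Fintype.card V : ℝ) ^ m) / 2 := by
    field_simp
  rw [e]
  linarith

theorem seven_pow_le_of_le {ε n : ℝ} (hε : 0 < ε) (hε1 : ε ≤ 1 / 7)
    (hn : 2 ^ 2 * 3 ^ 4 / ε ^ 8 ≤ n) : 2 ^ 2 * 3 ^ 4 * 7 ^ 8 ≤ n := by
  refine le_trans ?_ hn
  rw [le_div_iff₀ (by positivity)]
  have h8 : ε ^ 8 ≤ (1 / 7) ^ 8 := pow_le_pow_left₀ hε.le hε1 8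
  calc _ ≤ (2 : ℝ) ^ 2 * 3 ^ 4 * 7 ^ 8 * (1 / 7) ^ 8 := by gcongr
    _ = _ := by norm_num

/-- The number of samples suffices. -/
theorem le_mul_numSamples {ε : ℝ} {n : ℕ} (hε : 0 < ε) (hε1 : ε ≤ 1 / 7)
    (hn : 2 ^ 2 * 3 ^ 4 / ε ^ 8 ≤ (n : ℝ)) :
    (n : ℝ) ≤ (ε / 3) ^ sampleSize n ε / 4 * numSamples n ε := by
  have h7 := seven_pow_le_of_le hε hε1 hn
  have hn1 : (1 : ℝ) ≤ n := le_trans (by norm_num) h7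
  have hn0 : (0 : ℝ) < n := by linarith
  set l := Real.log (3 / ε) with hl
  have hl1 : 1 ≤ l := by
    rw [hl, Real.le_log_iff_exp_le (by positivity)]
    have : 21 ≤ 3 / ε := by rw [le_div_iff₀ hε]; linarith
    linarith [Real.exp_one_lt_d9]
  have hlog : 0 ≤ Real.log n := Real.log_nonneg hn1
  -- n^e is (3/ε)^m without the ceiling in m; the ceiling costs one more factor 3/ε in `hpow`.
  set e := (3 : ℝ) ^ 6 / ε ^ 4 * l with he
  have he1 : 1 ≤ e := by
    have : (1 : ℝ) ≤ 3 ^ 6 / ε ^ 4 := by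
      rw [le_div_iff₀ (by positivity), one_mul]
      have : ε ^ 4 ≤ 1 := pow_le_one₀ hε.le (by linarith)
      linarith
    nlinarith
  have hm : (sampleSize n ε : ℝ) ≤ (3 : ℝ) ^ 6 / ε ^ 4 * Real.log n + 1 :=
    (Nat.ceil_lt_add_one (by positivity)).le
  have hpow : (3 / ε) ^ sampleSize n ε ≤ (n : ℝ) ^ e * (3 / ε) := by
    rw [← Real.rpow_natCast]
    have h3 : 1 ≤ 3 / ε := by rw [le_div_iff₀ hε]; linarith
    refine (Real.rpow_le_rpow_of_exponent_le h3 hm).trans (le_of_eq ?_)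
    rw [Real.rpow_add (by positivity), Real.rpow_one, Real.rpow_def_of_pos (by positivity),
      Real.rpow_def_of_pos hn0, ← hl, he]
    congr 2
    ring
  -- 3⁷ = 3 · 3⁶ gives t ≥ n^(3e), and e ≥ 1 leaves n^e n². One factor n is the target, the other
  -- absorbs 12/ε.
  have ht : (n : ℝ) ^ e * n ^ 2 ≤ numSamples n ε := by
    refine le_trans ?_ (Nat.le_ceil _)
    rw [← Real.rpow_natCast, ← Real.rpow_add hn0]
    refine Real.rpow_le_rpow_of_exponent_le hn1 ?_
    push_cast
    have : (3 : ℝ) ^ 7 / ε ^ 4 * l = 3 * e := by rw [he]; ring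
    rw [this]
    linarith
  have hne : 0 < (n : ℝ) ^ e := Real.rpow_pos_of_pos hn0 _
  have h12 : 12 / ε ≤ n := by
    refine le_trans ?_ hn
    rw [div_le_div_iff₀ hε (by positivity)]
    have : ε ^ 8 ≤ ε := pow_le_of_le_one hε.le (by linarith) (by norm_num)
    nlinarith
  have hinv : (ε / 3) ^ sampleSize n ε = ((3 / ε) ^ sampleSize n ε)⁻¹ := by
    rw [← inv_pow, inv_div]
  rw [hinv, div_mul_eq_mul_div, le_div_iff₀ (by norm_num), inv_mul_eq_div,
    le_div_iff₀ (by positivity)]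
  calc (n : ℝ) * 4 * (3 / ε) ^ sampleSize n ε ≤ n * 4 * ((n : ℝ) ^ e * (3 / ε)) := by gcongr
    _ = (n : ℝ) ^ e * n * (12 / ε) := by ring
    _ ≤ (n : ℝ) ^ e * n * n := by gcongr
    _ = (n : ℝ) ^ e * n ^ 2 := by ring
    _ ≤ _ := ht

theorem le_one_sub_of_compl_le {α : Type*} (p : PMF α) (A : Set α) {r : ℝ} (h0 : 0 ≤ r)
    (h : p.toOuterMeasure Aᶜ ≤ ENNReal.ofReal r) :
    ENNReal.ofReal (1 - r) ≤ p.toOuterMeasure A := by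
  rw [ENNReal.ofReal_sub _ h0, ENNReal.ofReal_one, tsub_le_iff_right]
  exact (one_le_add_compl p A).trans (by gcongr)

theorem NearOptimal.mono_set {G : SimpleGraph V} {c δ : ℝ} {S S' : Finset V}
    (h : NearOptimal G c δ S) (hS : utility G c S ≤ utility G c S') : NearOptimal G c δ S' :=
  fun T => (h T).trans (by gcongr)

theorem NearOptimal.mono {G : SimpleGraph V} {c δ δ' : ℝ} {S : Finset V}
    (h : NearOptimal G c δ S) (hδ : δ ≤ δ') : NearOptimal G c δ' S :=
  fun T => (h T).trans (by gcongr)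

theorem nearOptimal_empty_of_core {G : SimpleGraph V} {c ε : ℝ} (h : IsOptCore G c ε ∅) :
    NearOptimal G c (2 * ε) ∅ := h.near

open Classical in
theorem nearOptimal_argmax {G : SimpleGraph V} {c δ : ℝ} {L : List (Finset V)} {S : Finset V}
    (hS : S ∈ L) (h : NearOptimal G c δ S) :
    NearOptimal G c δ ((L.argmax (utility G c)).getD ∅) := by
  cases hL : L.argmax (utility G c) with
  | none =>
    rw [List.argmax_eq_none] at hL
    simp [hL] at hS
  | some S' => exact h.mono_set (List.le_of_mem_argmax hS hL)

/-- If the core is empty, the empty contract is nearly optimal, and it is always in the list.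
Otherwise the independent iterations all fail with probability at most (1 - q)^t for q = (ε/3)^m /
4, and the contract of maximal utility is as good as any nearly optimal one in the list. -/
theorem algorithm_nearOptimal [Nonempty V] {ε : ℝ} (hε : 0 < ε) (hε1 : ε ≤ 1 / 7)
    (hn : 2 ^ 2 * 3 ^ 4 / ε ^ 8 ≤ (Fintype.card V : ℝ)) (G : SimpleGraph V) {c : ℝ} (hc : 0 < c)
    {solver : Finset V → ℕ → (V → ℝ) → (V → ℝ)} (hsolver : IsLPSolver G c ε solver) :
    ENNReal.ofReal (1 - 1 / (Fintype.card V : ℝ)) ≤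
      (algorithm G c ε solver).toOuterMeasure {S | NearOptimal G c (30 * ε) S} := by
  classical
  have h7 := seven_pow_le_of_le hε hε1 hn
  have hN : 0 < (Fintype.card V : ℝ) := lt_of_lt_of_le (by norm_num) h7
  have hn2 : 2 ≤ Fintype.card V := by
    have : (2 : ℝ) ≤ Fintype.card V := le_trans (by norm_num) h7
    exact_mod_cast this
  refine le_one_sub_of_compl_le _ _ (by positivity) ?_
  change ((((List.range (numSamples (Fintype.card V) ε)).mapM
    fun _ => iteration G ε solver)).bind fun contracts =>
      PMF.pure (((∅ :: contracts.flatten).argmax (utility G c)).getD ∅)).toOuterMeasure _ ≤ _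
  rw [PMF.toOuterMeasure_bind_apply]
  obtain ⟨K, hK⟩ := exists_isOptCore G hc hε hn2
  rcases K.eq_empty_or_nonempty with rfl | hKne
  · refine le_trans (le_of_eq ?_) (zero_le)
    rw [ENNReal.tsum_eq_zero]
    intro L
    rw [PMF.toOuterMeasure_pure_apply, if_neg, mul_zero]
    exact fun h => h (nearOptimal_argmax List.mem_cons_self
      (NearOptimal.mono (nearOptimal_empty_of_core hK) (by linarith)))
  · set q := (ε / 3) ^ sampleSize (Fintype.card V) ε / 4 with hq
    have hq1 : q ≤ 1 := by
      have : (ε / 3) ^ sampleSize (Fintype.card V) ε ≤ 1 :=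
        pow_le_one₀ (by positivity) (by linarith)
      rw [hq]; linarith
    have h1 := toOuterMeasure_mapM_le (fun _ : ℕ => iteration G ε solver)
      {L | ∀ S ∈ L, S ∈ {S | ¬ NearOptimal G c (30 * ε) S}}
      (List.range (numSamples (Fintype.card V) ε))
    rw [List.map_const', List.prod_replicate, List.length_range] at h1
    have h2 := pow_le_pow_left' (iteration_fail_le hc hε hε1 hn hn2 hK hKne hsolver)
      (numSamples (Fintype.card V) ε)
    rw [← hq, ← ENNReal.ofReal_pow (by linarith)] at h2
    refine le_trans ?_ ((h1.trans h2).trans (ENNReal.ofReal_le_ofReal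
      (one_sub_pow_le hq1 hN (le_mul_numSamples hε hε1 hn))))
    rw [PMF.toOuterMeasure_apply]
    refine ENNReal.tsum_le_tsum fun L => ?_
    rw [PMF.toOuterMeasure_pure_apply]
    split_ifs with h
    · rw [Set.indicator_of_mem, mul_one]
      intro l hl S hS hnear
      exact h (nearOptimal_argmax (List.mem_cons_of_mem _ (List.mem_flatten.2 ⟨l, hl, hS⟩)) hnear)
    · rw [mul_zero]
      exact zero_le

end SamplingAlgorithm

end UGSC

namespace UGSC

/-! ### Expectations -/

section Expectation

variable {α β : Type}

/-- The expected value of `f`. -/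
noncomputable def ev (μ : PMF α) (f : α → ℝ≥0∞) : ℝ≥0∞ := ∑' a, μ a * f a

theorem ev_pure (a : α) (f : α → ℝ≥0∞) : ev (PMF.pure a) f = f a := by
  classical
  rw [ev, tsum_eq_single a]
  · simp
  · intro b hb
    simp [PMF.pure_apply, hb]

theorem ev_bind (μ : PMF α) (ν : α → PMF β) (f : β → ℝ≥0∞) :
    ev (μ.bind ν) f = ev μ fun a => ev (ν a) f := by
  simp only [ev, PMF.bind_apply, ← ENNReal.tsum_mul_right, ← ENNReal.tsum_mul_left]
  rw [ENNReal.tsum_comm]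
  simp only [mul_assoc]

theorem ev_mono_support {μ : PMF α} {f g : α → ℝ≥0∞} (h : ∀ a ∈ μ.support, f a ≤ g a) :
    ev μ f ≤ ev μ g := by
  refine ENNReal.tsum_le_tsum fun a => ?_
  by_cases ha : a ∈ μ.support
  · exact mul_le_mul_right (h a ha) _
  · rw [(PMF.apply_eq_zero_iff μ a).2 ha, zero_mul, zero_mul]

theorem ev_const (μ : PMF α) (r : ℝ≥0∞) : ev μ (fun _ => r) = r := by
  rw [ev, ENNReal.tsum_mul_right, PMF.tsum_coe, one_mul]

theorem le_ev_of_support {μ : PMF α} {f : α → ℝ≥0∞} {r : ℝ≥0∞}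
    (h : ∀ a ∈ μ.support, r ≤ f a) : r ≤ ev μ f :=
  (ev_const μ r).symm.le.trans (ev_mono_support h)

open Classical in
theorem ev_indicator (μ : PMF α) (A : Set α) :
    ev μ (fun a => if a ∈ A then 1 else 0) = μ.toOuterMeasure A := by
  rw [PMF.toOuterMeasure_apply, ev]
  refine tsum_congr fun a => ?_
  by_cases h : a ∈ A <;> simp [h]

theorem ev_fintype [Fintype α] (μ : PMF α) (f : α → ℝ≥0∞) : ev μ f = ∑ a, μ a * f a :=
  tsum_fintype _

theorem bind_congr_support {μ : PMF α} {f g : α → PMF β} (h : ∀ a ∈ μ.support, f a = g a) :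
    μ.bind f = μ.bind g := by
  ext b
  rw [PMF.bind_apply, PMF.bind_apply]
  refine tsum_congr fun a => ?_
  by_cases ha : a ∈ μ.support
  · rw [h a ha]
  · rw [(PMF.apply_eq_zero_iff μ a).2 ha, zero_mul, zero_mul]

end Expectation

/-! ### Semantics of programs with running times -/

section Semantics

variable {n : ℕ} {G : SimpleGraph (Fin n)}

/-- Started in the store `s`, the program `p` halts with the distribution `μ` of the final store
and the number of steps. -/
def Sem (G : SimpleGraph (Fin n)) (p : Prog) (s : Store) (μ : PMF (Store × ℕ)) : Prop :=
  -- The continuation k and the supply N of steps are arbitrary, which is what makes the statement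
  -- compositional; the condition on N excludes running out of steps within p.
  ∀ (k : List Prog) (N : ℕ), (∀ a ∈ μ.support, a.2 ≤ N) →
    runSteps G N (p :: k, s) = μ.bind fun a => runSteps G (N - a.2) (k, a.1)

/-- Started in the store `s`, the program `p` always halts within `T` steps in a store that
satisfies `Q`, and the expected value of `f` in the final store is at least `r`. -/
def Ens (G : SimpleGraph (Fin n)) (p : Prog) (s : Store) (T : ℕ) (Q : Store → Prop)
    (r : ℝ≥0∞) (f : Store → ℝ≥0∞) : Prop :=
  ∃ μ, Sem G p s μ ∧ (∀ a ∈ μ.support, a.2 ≤ T ∧ Q a.1) ∧ r ≤ ev μ fun a => f a.1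

/-- Started in the store `s`, the program `p` always halts within `T` steps in a store that
satisfies `Q`. -/
def Hoare (G : SimpleGraph (Fin n)) (p : Prog) (s : Store) (T : ℕ) (Q : Store → Prop) : Prop :=
  Ens G p s T Q 0 0

theorem Ens.hoare {p : Prog} {s : Store} {T : ℕ} {Q : Store → Prop} {r : ℝ≥0∞}
    {f : Store → ℝ≥0∞} (h : Ens G p s T Q r f) : Hoare G p s T Q := by
  obtain ⟨μ, h1, h2, -⟩ := h
  exact ⟨μ, h1, h2, zero_le⟩

theorem Hoare.ens {p : Prog} {s : Store} {T : ℕ} {Q : Store → Prop} {r : ℝ≥0∞}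
    {f : Store → ℝ≥0∞} (h : Hoare G p s T Q) (hr : ∀ s', Q s' → r ≤ f s') :
    Ens G p s T Q r f := by
  obtain ⟨μ, h1, h2, -⟩ := h
  exact ⟨μ, h1, h2, le_ev_of_support fun a ha => hr _ (h2 a ha).2⟩

theorem Ens.mono {p : Prog} {s : Store} {T T' : ℕ} {Q Q' : Store → Prop} {r r' : ℝ≥0∞}
    {f f' : Store → ℝ≥0∞} (h : Ens G p s T Q r f) (hT : T ≤ T') (hQ : ∀ s', Q s' → Q' s')
    (hr : r' ≤ r) (hf : ∀ s', Q s' → f s' ≤ f' s') : Ens G p s T' Q' r' f' := by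
  obtain ⟨μ, h1, h2, h3⟩ := h
  exact ⟨μ, h1, fun a ha => ⟨(h2 a ha).1.trans hT, hQ _ (h2 a ha).2⟩,
    hr.trans (h3.trans (ev_mono_support fun a ha => hf _ (h2 a ha).2))⟩

theorem Hoare.mono {p : Prog} {s : Store} {T T' : ℕ} {Q Q' : Store → Prop}
    (h : Hoare G p s T Q) (hT : T ≤ T') (hQ : ∀ s', Q s' → Q' s') : Hoare G p s T' Q' :=
  Ens.mono h hT hQ le_rfl fun _ _ => le_rfl

theorem exists_support {α : Type} (μ : PMF α) : ∃ a, a ∈ μ.support :=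
  μ.support_nonempty

theorem Sem.instr (i : Instr) (s : Store) :
    Sem G (.instr i) s ((i.exec G s).bind fun s' => PMF.pure (s', 1)) := by
  intro k N hN
  have h1 : 1 ≤ N := by
    obtain ⟨s', hs'⟩ := exists_support (i.exec G s)
    exact hN (s', 1) ((PMF.mem_support_bind_iff _ _ _).2 ⟨s', hs', by simp⟩)
  obtain ⟨N, rfl⟩ := Nat.exists_eq_add_of_le h1
  rw [Nat.add_comm, runSteps, step, PMF.bind_bind, PMF.bind_bind]
  simp only [PMF.pure_bind, Nat.add_sub_cancel]

theorem Sem.seq {p q : Prog} {s : Store} {μ : PMF (Store × ℕ)} (hp : Sem G p s μ)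
    {ν : Store × ℕ → PMF (Store × ℕ)} (hq : ∀ a ∈ μ.support, Sem G q a.1 (ν a)) :
    Sem G (.seq p q) s
      (μ.bind fun a => (ν a).bind fun b => PMF.pure (b.1, a.2 + b.2 + 1)) := by
  intro k N hN
  have hN' : ∀ a ∈ μ.support, ∀ b ∈ (ν a).support, a.2 + b.2 + 1 ≤ N := by
    intro a ha b hb
    refine hN (b.1, a.2 + b.2 + 1) ((PMF.mem_support_bind_iff _ _ _).2 ⟨a, ha, ?_⟩)
    exact (PMF.mem_support_bind_iff _ _ _).2 ⟨b, hb, by simp⟩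
  obtain ⟨a, ha⟩ := exists_support μ
  obtain ⟨b, hb⟩ := exists_support (ν a)
  have h1 := hN' a ha b hb
  obtain ⟨N, rfl⟩ := Nat.exists_eq_add_of_le (show 1 ≤ N by omega)
  rw [Nat.add_comm, runSteps, step, PMF.pure_bind, hp (q :: k) N]
  · rw [PMF.bind_bind]
    refine bind_congr_support fun a ha => ?_
    rw [hq a ha k (N - a.2), PMF.bind_bind]
    · refine bind_congr_support fun b hb => ?_
      rw [PMF.pure_bind]
      have := hN' a ha b hb
      congr 1
      omega
    · intro b hb
      have := hN' a ha b hb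
      omega
  · intro a ha
    obtain ⟨b, hb⟩ := exists_support (ν a)
    have := hN' a ha b hb
    omega

/-- One deterministic step replaces the head of the stack by the list k': a single program for a
branch, the empty list for leaving a loop, the body followed by the loop for entering it. -/
theorem Sem.of_step {p : Prog} {s : Store} {μ : PMF (Store × ℕ)} {k' : List Prog}
    (hstep : ∀ k, step G (p :: k, s) = PMF.pure (k' ++ k, s))
    (h : ∀ (k : List Prog) (N : ℕ), (∀ a ∈ μ.support, a.2 ≤ N) →
      runSteps G N (k' ++ k, s) = μ.bind fun a => runSteps G (N - a.2) (k, a.1)) :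
    Sem G p s (μ.bind fun a => PMF.pure (a.1, a.2 + 1)) := by
  intro k N hN
  have hN' : ∀ a ∈ μ.support, a.2 + 1 ≤ N := fun a ha =>
    hN (a.1, a.2 + 1) ((PMF.mem_support_bind_iff _ _ _).2 ⟨a, ha, by simp⟩)
  obtain ⟨a, ha⟩ := exists_support μ
  have h1 := hN' a ha
  obtain ⟨N, rfl⟩ := Nat.exists_eq_add_of_le (show 1 ≤ N by omega)
  rw [Nat.add_comm, runSteps, hstep, PMF.pure_bind, h k N, PMF.bind_bind]
  · simp only [PMF.pure_bind, Nat.add_sub_add_right]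
  · intro a ha
    have := hN' a ha
    omega

theorem Ens.of_step {p q : Prog} {s : Store} {T : ℕ} {Q : Store → Prop} {r : ℝ≥0∞}
    {f : Store → ℝ≥0∞} (hstep : ∀ k, step G (p :: k, s) = PMF.pure (q :: k, s))
    (h : Ens G q s T Q r f) : Ens G p s (T + 1) Q r f := by
  obtain ⟨μ, h1, h2, h3⟩ := h
  refine ⟨_, Sem.of_step (k' := [q]) hstep fun k N hN => h1 k N hN, ?_, ?_⟩
  · intro b hb
    obtain ⟨a, ha, hab⟩ := (PMF.mem_support_bind_iff _ _ _).1 hb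
    rw [PMF.mem_support_pure_iff] at hab
    subst hab
    exact ⟨Nat.add_le_add_right (h2 a ha).1 1, (h2 a ha).2⟩
  · rw [ev_bind]
    simpa only [ev_pure] using h3

/-- The function g is a pre-expectation: the first program guarantees it on average, the second one
starts from its value at the store it finds. Success probabilities are propagated in this way
without describing any distribution of stores. -/
theorem Ens.seq {p q : Prog} {s : Store} {T₁ T₂ : ℕ} {Q R : Store → Prop} {r : ℝ≥0∞}
    {f g : Store → ℝ≥0∞} (hp : Ens G p s T₁ Q r g)
    (hq : ∀ s', Q s' → Ens G q s' T₂ R (g s') f) :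
    Ens G (.seq p q) s (T₁ + T₂ + 1) R r f := by
  obtain ⟨μ, h1, h2, h3⟩ := hp
  have : ∀ a : Store × ℕ, ∃ ν : PMF (Store × ℕ), a ∈ μ.support → Sem G q a.1 ν ∧
      (∀ b ∈ ν.support, b.2 ≤ T₂ ∧ R b.1) ∧ g a.1 ≤ ev ν fun b => f b.1 := by
    intro a
    by_cases ha : a ∈ μ.support
    · obtain ⟨ν, hν⟩ := hq a.1 (h2 a ha).2
      exact ⟨ν, fun _ => hν⟩
    · exact ⟨μ, fun h => absurd h ha⟩
  choose ν hν using this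
  refine ⟨_, h1.seq fun a ha => (hν a ha).1, ?_, ?_⟩
  · intro b hb
    obtain ⟨a, ha, hb⟩ := (PMF.mem_support_bind_iff _ _ _).1 hb
    obtain ⟨b', hb', hb⟩ := (PMF.mem_support_bind_iff _ _ _).1 hb
    rw [PMF.mem_support_pure_iff] at hb
    subst hb
    have e1 := (h2 a ha).1
    have e2 := ((hν a ha).2.1 b' hb')
    exact ⟨by dsimp only; omega, e2.2⟩
  · rw [ev_bind]
    refine h3.trans (ev_mono_support fun a ha => ?_)
    rw [ev_bind]
    simpa only [ev_pure] using (hν a ha).2.2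

theorem Hoare.seq {p q : Prog} {s : Store} {T₁ T₂ : ℕ} {Q R : Store → Prop}
    (hp : Hoare G p s T₁ Q) (hq : ∀ s', Q s' → Hoare G q s' T₂ R) :
    Hoare G (.seq p q) s (T₁ + T₂ + 1) R :=
  Ens.seq hp hq

theorem Ens.ite {t : Test} {p q : Prog} {s : Store} {T : ℕ} {Q : Store → Prop} {r : ℝ≥0∞}
    {f : Store → ℝ≥0∞} (hp : t.holds s → Ens G p s T Q r f)
    (hq : ¬ t.holds s → Ens G q s T Q r f) : Ens G (.ite t p q) s (T + 1) Q r f := by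
  by_cases h : t.holds s
  · exact Ens.of_step (fun k => by rw [step, if_pos h]) (hp h)
  · exact Ens.of_step (fun k => by rw [step, if_neg h]) (hq h)

theorem Hoare.ite {t : Test} {p q : Prog} {s : Store} {T : ℕ} {Q : Store → Prop}
    (hp : t.holds s → Hoare G p s T Q) (hq : ¬ t.holds s → Hoare G q s T Q) :
    Hoare G (.ite t p q) s (T + 1) Q :=
  Ens.ite hp hq

theorem Sem.loop_of_not {t : Test} {p : Prog} {s : Store} (h : ¬ t.holds s) :
    Sem G (.loop t p) s (PMF.pure (s, 1)) := by
  have := Sem.of_step (G := G) (p := .loop t p) (s := s) (μ := PMF.pure (s, 0)) (k' := [])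
    (fun k => by rw [step, if_neg h]; rfl) (fun k N _ => by rw [PMF.pure_bind]; rfl)
  rwa [PMF.pure_bind] at this

theorem Ens.loop_of_not {t : Test} {p : Prog} {s : Store} {Q : Store → Prop}
    {f : Store → ℝ≥0∞} (h : ¬ t.holds s) (hQ : Q s) : Ens G (.loop t p) s 1 Q (f s) f := by
  refine ⟨_, Sem.loop_of_not h, ?_, ?_⟩
  · intro a ha
    rw [PMF.mem_support_pure_iff] at ha
    subst ha
    exact ⟨le_rfl, hQ⟩
  · rw [ev_pure]

theorem Ens.loop_of_holds {t : Test} {p : Prog} {s : Store} {T₁ T₂ : ℕ} {Q R : Store → Prop}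
    {r : ℝ≥0∞} {f g : Store → ℝ≥0∞} (ht : t.holds s) (hp : Ens G p s T₁ Q r g)
    (hq : ∀ s', Q s' → Ens G (.loop t p) s' T₂ R (g s') f) :
    Ens G (.loop t p) s (T₁ + T₂ + 1) R r f := by
  obtain ⟨μ, h1, h2, h3⟩ := hp
  have : ∀ a : Store × ℕ, ∃ ν : PMF (Store × ℕ), a ∈ μ.support → Sem G (.loop t p) a.1 ν ∧
      (∀ b ∈ ν.support, b.2 ≤ T₂ ∧ R b.1) ∧ g a.1 ≤ ev ν fun b => f b.1 := by
    intro a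
    by_cases ha : a ∈ μ.support
    · obtain ⟨ν, hν⟩ := hq a.1 (h2 a ha).2
      exact ⟨ν, fun _ => hν⟩
    · exact ⟨μ, fun h => absurd h ha⟩
  choose ν hν using this
  have hsem : Sem G (.loop t p) s
      ((μ.bind fun a => (ν a).bind fun b => PMF.pure (b.1, a.2 + b.2)).bind
        fun a => PMF.pure (a.1, a.2 + 1)) := by
    refine Sem.of_step (k' := [p, .loop t p]) (fun k => by rw [step, if_pos ht]; rfl) ?_
    intro k N hN
    have hN' : ∀ a ∈ μ.support, ∀ b ∈ (ν a).support, a.2 + b.2 ≤ N := by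
      intro a ha b hb
      refine hN (b.1, a.2 + b.2) ((PMF.mem_support_bind_iff _ _ _).2 ⟨a, ha, ?_⟩)
      exact (PMF.mem_support_bind_iff _ _ _).2 ⟨b, hb, by simp⟩
    change runSteps G N (p :: (.loop t p :: k), s) = _
    rw [h1 (.loop t p :: k) N, PMF.bind_bind]
    · refine bind_congr_support fun a ha => ?_
      rw [(hν a ha).1 k (N - a.2), PMF.bind_bind]
      · refine bind_congr_support fun b hb => ?_
        rw [PMF.pure_bind, Nat.sub_sub]
      · intro b hb
        have := hN' a ha b hb
        omega
    · intro a ha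
      obtain ⟨b, hb⟩ := exists_support (ν a)
      have := hN' a ha b hb
      omega
  refine ⟨_, hsem, ?_, ?_⟩
  · intro c hc
    obtain ⟨c', hc', hc⟩ := (PMF.mem_support_bind_iff _ _ _).1 hc
    rw [PMF.mem_support_pure_iff] at hc
    subst hc
    obtain ⟨a, ha, hb⟩ := (PMF.mem_support_bind_iff _ _ _).1 hc'
    obtain ⟨b', hb', hb⟩ := (PMF.mem_support_bind_iff _ _ _).1 hb
    rw [PMF.mem_support_pure_iff] at hb
    subst hb
    have e1 := (h2 a ha).1
    have e2 := ((hν a ha).2.1 b' hb')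
    exact ⟨by dsimp only; omega, e2.2⟩
  · rw [ev_bind, ev_bind]
    refine h3.trans (ev_mono_support fun a ha => ?_)
    rw [ev_bind]
    simpa only [ev_pure] using (hν a ha).2.2

/-! ### Frames -/

/-- The natural number register `a` is written by the instruction. -/
def Instr.wn : Instr → ℕ → Bool
  | .const a _ | .add a _ _ | .sub a _ _ | .load a _ | .adj a _ _ | .rand a _ | .flip a _ =>
    fun b => b == a
  | _ => fun _ => false

/-- The real register `a` is written by the instruction. -/
def Instr.wr : Instr → ℕ → Bool
  | .cast a _ | .radd a _ _ | .rsub a _ _ | .rmul a _ _ | .rdiv a _ _ | .rload a _ =>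
    fun b => b == a
  | _ => fun _ => false

/-- The natural number memory is written by the instruction. -/
def Instr.wnm : Instr → Bool
  | .store _ _ => true
  | _ => false

/-- The real memory is written by the instruction. -/
def Instr.wrm : Instr → Bool
  | .rstore _ _ => true
  | _ => false

/-- The natural number register `a` is written by the program. -/
def Prog.wn : Prog → ℕ → Bool
  | .instr i, a => i.wn a
  | .seq p q, a => p.wn a || q.wn a
  | .ite _ p q, a => p.wn a || q.wn a
  | .loop _ p, a => p.wn a

/-- The real register `a` is written by the program. -/
def Prog.wr : Prog → ℕ → Bool
  | .instr i, a => i.wr a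
  | .seq p q, a => p.wr a || q.wr a
  | .ite _ p q, a => p.wr a || q.wr a
  | .loop _ p, a => p.wr a

/-- The natural number memory is written by the program. -/
def Prog.wnm : Prog → Bool
  | .instr i => i.wnm
  | .seq p q => p.wnm || q.wnm
  | .ite _ p q => p.wnm || q.wnm
  | .loop _ p => p.wnm

/-- The real memory is written by the program. -/
def Prog.wrm : Prog → Bool
  | .instr i => i.wrm
  | .seq p q => p.wrm || q.wrm
  | .ite _ p q => p.wrm || q.wrm
  | .loop _ p => p.wrm

/-- The two stores agree on everything that `p` does not write. -/
structure Agree (p : Prog) (s s' : Store) : Prop where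
  nreg : ∀ a, p.wn a = false → s'.nreg a = s.nreg a
  rreg : ∀ a, p.wr a = false → s'.rreg a = s.rreg a
  nmem : p.wnm = false → s'.nmem = s.nmem
  rmem : p.wrm = false → s'.rmem = s.rmem

theorem Agree.refl (p : Prog) (s : Store) : Agree p s s :=
  ⟨fun _ _ => rfl, fun _ _ => rfl, fun _ => rfl, fun _ => rfl⟩

theorem Agree.trans {p : Prog} {s s' s'' : Store} (h : Agree p s s') (h' : Agree p s' s'') :
    Agree p s s'' :=
  ⟨fun a ha => (h'.nreg a ha).trans (h.nreg a ha), fun a ha => (h'.rreg a ha).trans (h.rreg a ha),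
    fun ha => (h'.nmem ha).trans (h.nmem ha), fun ha => (h'.rmem ha).trans (h.rmem ha)⟩

/-- The program `q` writes nothing that `p` does not write. -/
structure WritesSub (q p : Prog) : Prop where
  nreg : ∀ a, p.wn a = false → q.wn a = false
  rreg : ∀ a, p.wr a = false → q.wr a = false
  nmem : p.wnm = false → q.wnm = false
  rmem : p.wrm = false → q.wrm = false

theorem WritesSub.agree {q p : Prog} (h : WritesSub q p) {s s' : Store} (ha : Agree q s s') :
    Agree p s s' :=
  ⟨fun a hp => ha.nreg a (h.nreg a hp), fun a hp => ha.rreg a (h.rreg a hp),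
    fun hp => ha.nmem (h.nmem hp), fun hp => ha.rmem (h.rmem hp)⟩

theorem WritesSub.of_seq {q q' p : Prog} (h : WritesSub (.seq q q') p) :
    WritesSub q p ∧ WritesSub q' p := by
  refine ⟨⟨fun a ha => ?_, fun a ha => ?_, fun ha => ?_, fun ha => ?_⟩,
    ⟨fun a ha => ?_, fun a ha => ?_, fun ha => ?_, fun ha => ?_⟩⟩
  all_goals first
    | exact (Bool.or_eq_false_iff.1 (h.nreg a ha)).1
    | exact (Bool.or_eq_false_iff.1 (h.rreg a ha)).1
    | exact (Bool.or_eq_false_iff.1 (h.nmem ha)).1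
    | exact (Bool.or_eq_false_iff.1 (h.rmem ha)).1
    | exact (Bool.or_eq_false_iff.1 (h.nreg a ha)).2
    | exact (Bool.or_eq_false_iff.1 (h.rreg a ha)).2
    | exact (Bool.or_eq_false_iff.1 (h.nmem ha)).2
    | exact (Bool.or_eq_false_iff.1 (h.rmem ha)).2

theorem agree_exec (i : Instr) (s s' : Store) (h : s' ∈ (i.exec G s).support) :
    Agree (.instr i) s s' := by
  have hupd : ∀ {β : Type} (f : ℕ → β) (a b : ℕ) (y : β), (b == a) = false →
      Function.update f a y b = f b := by
    intro β f a b y hab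
    exact Function.update_of_ne (by simpa using hab) _ _
  cases i <;> simp only [Instr.exec, PMF.mem_support_pure_iff, PMF.mem_support_bind_iff] at h
  all_goals
    first
    | subst h
    | (obtain ⟨j, -, rfl⟩ := h)
    refine ⟨fun a ha => ?_, fun a ha => ?_, fun ha => ?_, fun ha => ?_⟩
    all_goals first
      | rfl
      | exact hupd _ _ _ _ ha
      | exact absurd (show true = false from ha) Bool.true_eq_false.mp

/-- Everything on the stack writes at most what p writes, and this is preserved by every step; so
the syntactic write set of p bounds all changes. -/
theorem agree_runSteps (p : Prog) : ∀ (N : ℕ) (k : List Prog) (s : Store),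
    (∀ q ∈ k, WritesSub q p) → ∀ a ∈ (runSteps G N (k, s)).support, Agree p s a.2
  | 0, k, s, _, a, ha => by
    rw [runSteps, PMF.mem_support_pure_iff] at ha
    subst ha
    exact Agree.refl p s
  | N + 1, k, s, hk, a, ha => by
    rw [runSteps, PMF.mem_support_bind_iff] at ha
    obtain ⟨b, hb, hab⟩ := ha
    have main : (∀ q ∈ b.1, WritesSub q p) ∧ Agree p s b.2 := by
      rcases k with _ | ⟨q, k⟩
      · rw [step, PMF.mem_support_pure_iff] at hb
        subst hb
        exact ⟨hk, Agree.refl p s⟩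
      have hk' : ∀ q ∈ k, WritesSub q p := fun q hq => hk q (List.mem_cons_of_mem _ hq)
      have hq := hk q List.mem_cons_self
      cases q with
      | instr i =>
        rw [step, PMF.mem_support_bind_iff] at hb
        obtain ⟨s', hs', hb⟩ := hb
        rw [PMF.mem_support_pure_iff] at hb
        subst hb
        exact ⟨hk', hq.agree (agree_exec i s s' hs')⟩
      | seq q q' =>
        rw [step, PMF.mem_support_pure_iff] at hb
        subst hb
        refine ⟨fun x hx => ?_, Agree.refl p s⟩
        rcases List.mem_cons.1 hx with rfl | hx
        · exact hq.of_seq.1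
        rcases List.mem_cons.1 hx with rfl | hx
        · exact hq.of_seq.2
        · exact hk' x hx
      | ite t q q' =>
        rw [step, PMF.mem_support_pure_iff] at hb
        subst hb
        refine ⟨fun x hx => ?_, Agree.refl p s⟩
        have hq2 : WritesSub (.seq q q') p := ⟨hq.nreg, hq.rreg, hq.nmem, hq.rmem⟩
        rcases List.mem_cons.1 hx with rfl | hx
        · split_ifs
          · exact hq2.of_seq.1
          · exact hq2.of_seq.2
        · exact hk' x hx
      | loop t q =>
        rw [step, PMF.mem_support_pure_iff] at hb
        subst hb
        refine ⟨fun x hx => ?_, Agree.refl p s⟩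
        dsimp only at hx
        split_ifs at hx
        · rcases List.mem_cons.1 hx with rfl | hx
          · exact ⟨hq.nreg, hq.rreg, hq.nmem, hq.rmem⟩
          rcases List.mem_cons.1 hx with rfl | hx
          · exact hq
          · exact hk' x hx
        · exact hk' x hx
    exact main.2.trans (agree_runSteps p N b.1 b.2 main.1 a hab)

theorem runSteps_nil (N : ℕ) (s : Store) : runSteps G N ([], s) = PMF.pure ([], s) := by
  induction N with
  | zero => rfl
  | succ N ih => rw [runSteps, step, PMF.pure_bind, ih]

/-- The frame rule. Write sets compute, so that "this register is unchanged" is proved by `rfl`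
later on, and specifications mention only what a program is meant to achieve. -/
theorem Ens.frame {p : Prog} {s : Store} {T : ℕ} {Q : Store → Prop} {r : ℝ≥0∞}
    {f : Store → ℝ≥0∞} (h : Ens G p s T Q r f) :
    Ens G p s T (fun s' => Q s' ∧ Agree p s s') r f := by
  obtain ⟨μ, h1, h2, h3⟩ := h
  refine ⟨μ, h1, fun a ha => ⟨(h2 a ha).1, (h2 a ha).2, ?_⟩, h3⟩
  have h4 := h1 [] T fun a ha => (h2 a ha).1
  refine agree_runSteps (G := G) p T [p] s ?_ ([], a.1) ?_
  · intro q hq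
    rw [List.mem_singleton.1 hq]
    exact ⟨fun _ => id, fun _ => id, id, id⟩
  · rw [h4, PMF.mem_support_bind_iff]
    exact ⟨a, ha, by rw [runSteps_nil]; simp⟩

theorem Hoare.frame {p : Prog} {s : Store} {T : ℕ} {Q : Store → Prop} (h : Hoare G p s T Q) :
    Hoare G p s T (fun s' => Q s' ∧ Agree p s s') :=
  Ens.frame h

/-- A counting loop. -/
theorem Ens.loop {t : Test} {p : Prog} {s : Store} {T N : ℕ} (I : ℕ → Store → Prop)
    (g : ℕ → Store → ℝ≥0∞) (h0 : I 0 s)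
    (hbody : ∀ i s', i < N → Agree p s s' → I i s' →
      t.holds s' ∧ Ens G p s' T (I (i + 1)) (g i s') (g (i + 1)))
    (hend : ∀ s', Agree p s s' → I N s' → ¬ t.holds s') :
    Ens G (.loop t p) s (N * (T + 1) + 1) (fun s' => I N s' ∧ Agree p s s') (g 0 s) (g N) := by
  have key : ∀ d i s', i + d = N → Agree p s s' → I i s' →
      Ens G (.loop t p) s' (d * (T + 1) + 1) (fun s' => I N s' ∧ Agree p s s') (g i s')
        (g N) := by
    intro d
    induction d with
    | zero =>
      intro i s' hi ha hI
      obtain rfl : i = N := by omega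
      exact (Ens.loop_of_not (hend s' ha hI) ⟨hI, ha⟩).mono (by omega) (fun _ h => h) le_rfl
        fun _ _ => le_rfl
    | succ d ih =>
      intro i s' hi ha hI
      obtain ⟨ht, hb⟩ := hbody i s' (by omega) ha hI
      refine (Ens.loop_of_holds ht hb.frame fun s'' hs'' =>
        ih (i + 1) s'' (by omega) (ha.trans hs''.2) hs''.1).mono ?_ (fun _ h => h) le_rfl
          fun _ _ => le_rfl
      rw [Nat.succ_mul]
      omega
  exact key N 0 s (by omega) (Agree.refl p s) h0

theorem Hoare.loop {t : Test} {p : Prog} {s : Store} {T N : ℕ} (I : ℕ → Store → Prop)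
    (h0 : I 0 s)
    (hbody : ∀ i s', i < N → Agree p s s' → I i s' → t.holds s' ∧ Hoare G p s' T (I (i + 1)))
    (hend : ∀ s', Agree p s s' → I N s' → ¬ t.holds s') :
    Hoare G (.loop t p) s (N * (T + 1) + 1) (fun s' => I N s' ∧ Agree p s s') :=
  Ens.loop I (fun _ => 0) h0 hbody hend

/-- A loop with a variant. -/
theorem Hoare.loop_variant {t : Test} {p : Prog} {s : Store} {T N : ℕ} (I : Store → Prop)
    (v : Store → ℕ) (h0 : I s) (hv : v s ≤ N)
    (hbody : ∀ s', Agree p s s' → I s' → t.holds s' →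
      Hoare G p s' T (fun s'' => I s'' ∧ v s'' < v s')) :
    Hoare G (.loop t p) s (N * (T + 1) + 1) (fun s' => (I s' ∧ ¬ t.holds s') ∧ Agree p s s') := by
  have key : ∀ d s', v s' ≤ d → Agree p s s' → I s' → Hoare G (.loop t p) s' (d * (T + 1) + 1)
      (fun s' => (I s' ∧ ¬ t.holds s') ∧ Agree p s s') := by
    intro d
    induction d with
    | zero =>
      intro s' hd ha hI
      by_cases ht : t.holds s'
      · obtain ⟨μ, -, h2, -⟩ := hbody s' ha hI ht
        obtain ⟨a, ha⟩ := exists_support μ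
        have := (h2 a ha).2.2
        omega
      · exact Ens.mono (Ens.loop_of_not (f := fun _ => 0) ht ⟨⟨hI, ht⟩, ha⟩) (by omega)
          (fun _ h => h) le_rfl fun _ _ => le_rfl
    | succ d ih =>
      intro s' hd ha hI
      by_cases ht : t.holds s'
      · refine Ens.mono (Ens.loop_of_holds (g := fun _ => 0) ht (hbody s' ha hI ht).frame
          fun s'' hs'' => ih s'' (by omega) (ha.trans hs''.2) hs''.1.1) ?_
          (fun _ h => h) le_rfl fun _ _ => le_rfl
        rw [Nat.succ_mul]
        omega
      · exact Ens.mono (Ens.loop_of_not (f := fun _ => 0) ht ⟨⟨hI, ht⟩, ha⟩) (by omega)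
          (fun _ h => h) le_rfl fun _ _ => le_rfl
  exact key N s hv (Agree.refl p s) h0

/-! ### Instructions and straight-line programs -/

open Classical in
/-- The adjacency query. -/
noncomputable def adjQuery (G : SimpleGraph (Fin n)) (b d : ℕ) : ℕ :=
  if ∃ u v : Fin n, (u : ℕ) = b ∧ (v : ℕ) = d ∧ G.Adj u v then 1 else 0

open Classical in
theorem adjQuery_fin (u v : Fin n) : adjQuery G u v = if G.Adj u v then 1 else 0 := by
  unfold adjQuery
  congr 1
  refine propext ⟨?_, fun h => ⟨u, v, rfl, rfl, h⟩⟩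
  rintro ⟨u', v', h1, h2, h⟩
  rwa [← Fin.ext h1, ← Fin.ext h2]

/-- The effect of a deterministic instruction. -/
noncomputable def Instr.det (G : SimpleGraph (Fin n)) (s : Store) : Instr → Store
  | const a k => s.setN a k
  | add a b d => s.setN a (s.nreg b + s.nreg d)
  | sub a b d => s.setN a (s.nreg b - s.nreg d)
  | load a b => s.setN a (s.nmem (s.nreg b))
  | store a b => { s with nmem := Function.update s.nmem (s.nreg a) (s.nreg b) }
  | cast a b => s.setR a (s.nreg b : ℝ)
  | radd a b d => s.setR a (s.rreg b + s.rreg d)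
  | rsub a b d => s.setR a (s.rreg b - s.rreg d)
  | rmul a b d => s.setR a (s.rreg b * s.rreg d)
  | rdiv a b d => s.setR a (s.rreg b / s.rreg d)
  | rload a b => s.setR a (s.rmem (s.nreg b))
  | rstore a b => { s with rmem := Function.update s.rmem (s.nreg a) (s.rreg b) }
  | adj a b d => s.setN a (adjQuery G (s.nreg b) (s.nreg d))
  | rand _ _ => s
  | flip _ _ => s

/-- The instruction makes no random choice. -/
def Instr.isDet : Instr → Bool
  | rand _ _ => false
  | flip _ _ => false
  | _ => true

theorem Instr.exec_of_isDet {i : Instr} (h : i.isDet = true) (s : Store) :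
    i.exec G s = PMF.pure (i.det G s) := by
  cases i <;> first | rfl | simp [Instr.isDet] at h

theorem Hoare.instr {i : Instr} (h : i.isDet = true) {s : Store} {Q : Store → Prop}
    (hQ : Q (i.det G s)) : Hoare G (.instr i) s 1 Q := by
  refine ⟨_, Sem.instr i s, ?_, zero_le⟩
  intro a ha
  rw [Instr.exec_of_isDet h, PMF.pure_bind, PMF.mem_support_pure_iff] at ha
  subst ha
  exact ⟨le_rfl, hQ⟩

theorem Ens.rand {a b : ℕ} {s : Store} {Q : Store → Prop} {r : ℝ≥0∞} {f : Store → ℝ≥0∞}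
    (hQ : ∀ j ≤ s.nreg b, Q (s.setN a j))
    (hr : r ≤ ∑ j : Fin (s.nreg b + 1), ((s.nreg b + 1 : ℕ) : ℝ≥0∞)⁻¹ * f (s.setN a j)) :
    Ens G (.instr (.rand a b)) s 1 Q r f := by
  refine ⟨_, Sem.instr _ s, ?_, ?_⟩
  · intro x hx
    simp only [Instr.exec, PMF.bind_bind, PMF.pure_bind, PMF.mem_support_bind_iff,
      PMF.mem_support_pure_iff] at hx
    obtain ⟨j, -, rfl⟩ := hx
    exact ⟨le_rfl, hQ _ (Nat.lt_succ_iff.1 j.2)⟩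
  · refine hr.trans (le_of_eq ?_)
    simp only [Instr.exec, PMF.bind_bind, PMF.pure_bind]
    rw [ev_bind, ev_fintype]
    refine Finset.sum_congr rfl fun j _ => ?_
    rw [ev_pure, PMF.uniformOfFintype_apply, Fintype.card_fin]

/-- A random guess hits a given value with the expected probability. -/
theorem Ens.rand_guess {a b : ℕ} {s : Store} {Q : Store → Prop} {r : ℝ≥0∞} {f : Store → ℝ≥0∞}
    (hQ : ∀ j ≤ s.nreg b, Q (s.setN a j)) {j : ℕ} (hj : j ≤ s.nreg b)
    (hr : r ≤ ((s.nreg b + 1 : ℕ) : ℝ≥0∞)⁻¹ * f (s.setN a j)) :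
    Ens G (.instr (.rand a b)) s 1 Q r f :=
  Ens.rand hQ <| hr.trans <| Finset.single_le_sum
    (f := fun j : Fin (s.nreg b + 1) => ((s.nreg b + 1 : ℕ) : ℝ≥0∞)⁻¹ * f (s.setN a j))
    (fun _ _ => zero_le) (Finset.mem_univ (⟨j, Nat.lt_succ_iff.2 hj⟩ : Fin (s.nreg b + 1)))

theorem Ens.flip {a b : ℕ} {s : Store} {Q : Store → Prop} {r : ℝ≥0∞} {f : Store → ℝ≥0∞}
    (h0 : Q (s.setN a 0)) (h1 : Q (s.setN a 1))
    (hr : r ≤ clamp (s.rreg b) * f (s.setN a 1) + (1 - clamp (s.rreg b)) * f (s.setN a 0)) :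
    Ens G (.instr (.flip a b)) s 1 Q r f := by
  refine ⟨_, Sem.instr _ s, ?_, ?_⟩
  · intro x hx
    simp only [Instr.exec, PMF.bind_bind, PMF.pure_bind, PMF.mem_support_bind_iff,
      PMF.mem_support_pure_iff] at hx
    obtain ⟨j, -, rfl⟩ := hx
    refine ⟨le_rfl, ?_⟩
    cases j <;> assumption
  · refine hr.trans (le_of_eq ?_)
    simp only [Instr.exec, PMF.bind_bind, PMF.pure_bind]
    rw [ev_bind, ev_fintype, Fintype.sum_bool, ev_pure, ev_pure]
    rfl

/-- A straight-line program. -/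
def blk : List Instr → Prog
  -- There is no empty program. Register 30 is written for want of one and never read.
  | [] => .instr (.const 30 0)
  | i :: l => .seq (.instr i) (blk l)

/-- The effect of a straight-line program. -/
noncomputable def blkDet (G : SimpleGraph (Fin n)) : List Instr → Store → Store
  | [], s => s.setN 30 0
  | i :: l, s => blkDet G l (i.det G s)

theorem Hoare.blk {l : List Instr} (h : l.all Instr.isDet = true) {s : Store}
    {Q : Store → Prop} (hQ : Q (blkDet G l s)) :
    Hoare G (UGSC.blk l) s (2 * l.length + 1) Q := by
  induction l generalizing s with
  | nil => exact Hoare.instr rfl hQ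
  | cons i l ih =>
    rw [List.all_cons, Bool.and_eq_true] at h
    refine (Hoare.seq (Q := fun s' => s' = i.det G s) (Hoare.instr h.1 rfl) ?_).mono
      (T := 1 + (2 * l.length + 1) + 1) ?_ fun _ h => h
    · rintro _ rfl
      exact ih h.2 hQ
    · rw [List.length_cons]; omega

/-- Sequential composition that remembers the frame of the first program. -/
theorem Hoare.then {p q : Prog} {s : Store} {T₁ T₂ : ℕ} {Q R : Store → Prop}
    (hp : Hoare G p s T₁ Q) (hq : ∀ s', Q s' → Agree p s s' → Hoare G q s' T₂ R) :
    Hoare G (.seq p q) s (T₁ + T₂ + 1) R :=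
  Hoare.seq hp.frame fun s' h => hq s' h.1 h.2

theorem Hoare.then_ens {p q : Prog} {s : Store} {T₁ T₂ : ℕ} {Q R : Store → Prop} {r : ℝ≥0∞}
    {f : Store → ℝ≥0∞} (hp : Hoare G p s T₁ Q)
    (hq : ∀ s', Q s' → Agree p s s' → Ens G q s' T₂ R r f) :
    Ens G (.seq p q) s (T₁ + T₂ + 1) R r f :=
  Ens.seq (hp.frame.ens (f := fun _ => r) fun _ _ => le_rfl) fun s' h => hq s' h.1 h.2

theorem Hoare.comp {p q : Prog} {s : Store} (T₁ T₂ : ℕ) {T : ℕ} {Q R : Store → Prop}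
    (hT : T₁ + T₂ + 1 ≤ T) (hp : Hoare G p s T₁ Q)
    (hq : ∀ s', Q s' → Agree p s s' → Hoare G q s' T₂ R) : Hoare G (.seq p q) s T R :=
  (hp.then hq).mono hT fun _ h => h

theorem Hoare.comp_ens {p q : Prog} {s : Store} (T₁ T₂ : ℕ) {T : ℕ} {Q R : Store → Prop}
    {r : ℝ≥0∞} {f : Store → ℝ≥0∞} (hT : T₁ + T₂ + 1 ≤ T) (hp : Hoare G p s T₁ Q)
    (hq : ∀ s', Q s' → Agree p s s' → Ens G q s' T₂ R r f) : Ens G (.seq p q) s T R r f :=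
  (hp.then_ens hq).mono hT (fun _ h => h) le_rfl fun _ _ => le_rfl

theorem Hoare.line {l : List Instr} {T : ℕ} (h : l.all Instr.isDet = true)
    (hT : 2 * l.length + 1 ≤ T) {s : Store} {Q : Store → Prop} (hQ : Q (blkDet G l s)) :
    Hoare G (UGSC.blk l) s T Q :=
  (Hoare.blk h hQ).mono hT fun _ h => h

theorem Hoare.branch {t : Test} {p q : Prog} {s : Store} (T₁ : ℕ) {T : ℕ} {Q : Store → Prop}
    (hT : T₁ + 1 ≤ T) (hp : t.holds s → Hoare G p s T₁ Q)
    (hq : ¬ t.holds s → Hoare G q s T₁ Q) : Hoare G (.ite t p q) s T Q :=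
  (Hoare.ite hp hq).mono hT fun _ h => h

/-- A program started in the initial store, with its output distribution. -/
theorem Ens.run {P : Prog} {ε c : ℝ} {T : ℕ} {Q : Store → Prop} {r : ℝ≥0∞}
    {A : Set (Finset (Fin n))} {f : Store → ℝ≥0∞}
    (h : Ens G P (initStore n ε c) T Q r f) (hf0 : ∀ s, f s ≤ 1)
    (hf : ∀ s, Q s → f s ≠ 0 → Config.output n ([], s) ∈ A) :
    P.HaltsWithin G ε c T ∧ r ≤ (P.outputDist G ε c T).toOuterMeasure A ∧
      ∀ S ∈ (P.outputDist G ε c T).support, ∃ s, Q s ∧ S = Config.output n ([], s) := by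
  obtain ⟨μ, h1, h2, h3⟩ := h
  have h4 : P.run G ε c T = μ.bind fun a => PMF.pure ([], a.1) := by
    rw [Prog.run, h1 [] T fun a ha => (h2 a ha).1]
    simp only [runSteps_nil]
  refine ⟨?_, ?_, ?_⟩
  · intro a ha
    rw [h4, PMF.mem_support_bind_iff] at ha
    obtain ⟨b, -, hb⟩ := ha
    rw [PMF.mem_support_pure_iff] at hb
    rw [hb]
  · classical
    rw [Prog.outputDist, h4, PMF.bind_bind, ← ev_indicator, ev_bind]
    simp only [PMF.pure_bind, ev_pure]
    refine h3.trans (ev_mono_support fun a ha => ?_)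
    by_cases h0 : f a.1 = 0
    · rw [h0]; exact zero_le
    · rw [if_pos (hf _ (h2 a ha).2 h0)]
      exact hf0 _
  · intro S hS
    rw [Prog.outputDist, h4, PMF.bind_bind, PMF.mem_support_bind_iff] at hS
    obtain ⟨a, ha, hS⟩ := hS
    rw [PMF.pure_bind, PMF.mem_support_pure_iff] at hS
    exact ⟨a.1, (h2 a ha).2, hS⟩

end Semantics

end UGSC

namespace UGSC

/-! ### Data layout

Three arrays of real numbers are interleaved in the real memory: the degree estimates (`0`), the
fractional or integral solution (`1`), and the coefficients of the current constraint (`2`). The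
best set found so far stands in the natural number memory, its utility in the real register
`9`. -/

attribute [simp] blkDet Instr.det Store.setN Store.setR

/-- The address of entry `v` of the array `j`. -/
def adr (j v : ℕ) : ℕ := v + v + (v + v) + j

/-- Entry `v` of the array `j`. -/
def arr (s : Store) (j v : ℕ) : ℝ := s.rmem (adr j v)

/-- The stride is 4 although three arrays are stored, because the machine cannot multiply natural
numbers and 4 v comes from two doublings. -/
theorem adr_inj {j k v w : ℕ} (hj : j < 4) (hk : k < 4) (h : adr j v = adr k w) :
    j = k ∧ v = w := by
  unfold adr at h
  omega

/-- Compute the address of the entry of the array `j` whose index stands in register `r`. -/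
def adrCode (r j : ℕ) : List Instr := [.add 4 r r, .add 4 4 4, .const 5 j, .add 4 4 5]

/-- Load an array entry. -/
def ldCode (a r j : ℕ) : List Instr := adrCode r j ++ [.rload a 4]

/-- Store an array entry. -/
def stCode (r j a : ℕ) : List Instr := adrCode r j ++ [.rstore 4 a]

section

variable {n : ℕ} {G : SimpleGraph (Fin n)}

/-- Apart from the target, an access changes the registers 4 and 5 only. With this summary an array
access is executed symbolically by one rewriting step. -/
theorem blkDet_ldCode (a r j : ℕ) (l : List Instr) (s : Store) :
    blkDet G (ldCode a r j ++ l) s =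
      blkDet G l ((((s.setN 4 (adr j (s.nreg r))).setN 5 j).setR a (arr s j (s.nreg r)))) := by
  simp only [ldCode, adrCode, List.cons_append, List.nil_append, blkDet, Instr.det, Store.setN,
    Store.setR, arr, adr]
  congr 1
  congr 1
  · funext b
    simp only [Function.update_apply]
    split_ifs <;> simp_all

theorem blkDet_stCode (a r j : ℕ) (l : List Instr) (s : Store) :
    blkDet G (stCode r j a ++ l) s =
      blkDet G l { ((s.setN 4 (adr j (s.nreg r))).setN 5 j) with
        rmem := Function.update s.rmem (adr j (s.nreg r)) (s.rreg a) } := by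
  simp only [stCode, adrCode, List.cons_append, List.nil_append, blkDet, Instr.det, Store.setN,
    adr]
  congr 1
  congr 1
  · funext b
    simp only [Function.update_apply]
    split_ifs <;> simp_all

theorem update_adr_self (m : ℕ → ℝ) (j v : ℕ) (y : ℝ) :
    Function.update m (adr j v) y (adr j v) = y := Function.update_self _ _ _

theorem update_adr_of_ne (m : ℕ → ℝ) {j v w : ℕ} (y : ℝ) (hj : j < 4) (h : w ≠ v) :
    Function.update m (adr j v) y (adr j w) = m (adr j w) :=
  Function.update_of_ne (fun e => h (adr_inj hj hj e).2) _ _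

theorem update_adr_of_ne_idx (m : ℕ → ℝ) {j k v w : ℕ} (y : ℝ) (hj : j < 4) (hk : k < 4)
    (h : k ≠ j) : Function.update m (adr j v) y (adr k w) = m (adr k w) :=
  Function.update_of_ne (fun e => h (adr_inj hk hj e).1) _ _

/-- The constants that the program keeps in registers. -/
structure Consts (n : ℕ) (ε c : ℝ) (s : Store) : Prop where
  n0 : s.nreg 0 = n
  n2 : s.nreg 2 = 1
  n9 : s.nreg 9 = n - 1
  n13 : s.nreg 13 = 2
  n14 : s.nreg 14 = n + 2
  r0 : s.rreg 0 = ε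
  r1 : s.rreg 1 = c
  r10 : s.rreg 10 = ε * n / 4
  r11 : s.rreg 11 = 0
  r17 : s.rreg 17 = n * (n - 1) / 2
  r18 : s.rreg 18 = ε ^ 2 * n / 8
  r19 : s.rreg 19 = ε ^ 2 / 32
  r20 : s.rreg 20 = 1
  r21 : s.rreg 21 = n
  r22 : s.rreg 22 = 1 - ε

/-- The program leaves the constants alone. -/
def Prog.keepsConsts (p : Prog) : Bool :=
  [0, 2, 9, 13, 14].all (fun a => !p.wn a) &&
    [0, 1, 10, 11, 17, 18, 19, 20, 21, 22].all fun a => !p.wr a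

theorem Consts.agree {ε c : ℝ} {s s' : Store} {p : Prog} (h : Consts n ε c s)
    (ha : Agree p s s') (hp : p.keepsConsts = true) : Consts n ε c s' := by
  simp only [Prog.keepsConsts, List.all_cons, List.all_nil, Bool.and_true, Bool.and_eq_true,
    Bool.not_eq_true'] at hp
  obtain ⟨⟨a0, a2, a9, a13, a14⟩, b0, b1, b10, b11, b17, b18, b19, b20, b21, b22⟩ := hp
  exact ⟨(ha.nreg _ a0).trans h.n0, (ha.nreg _ a2).trans h.n2, (ha.nreg _ a9).trans h.n9,
    (ha.nreg _ a13).trans h.n13, (ha.nreg _ a14).trans h.n14, (ha.rreg _ b0).trans h.r0,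
    (ha.rreg _ b1).trans h.r1, (ha.rreg _ b10).trans h.r10, (ha.rreg _ b11).trans h.r11,
    (ha.rreg _ b17).trans h.r17, (ha.rreg _ b18).trans h.r18, (ha.rreg _ b19).trans h.r19,
    (ha.rreg _ b20).trans h.r20, (ha.rreg _ b21).trans h.r21, (ha.rreg _ b22).trans h.r22⟩

theorem Agree.arr_eq {s s' : Store} {p : Prog} (ha : Agree p s s') (hp : p.wrm = false)
    (j v : ℕ) : arr s' j v = arr s j v := by
  rw [arr, arr, ha.rmem hp]

/-- The set of nodes with positive entries in `x`. -/
noncomputable def posSet (n : ℕ) (x : ℕ → ℝ) : Finset (Fin n) :=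
  open Classical in Finset.univ.filter fun v => 0 < x v

theorem mem_posSet {x : ℕ → ℝ} {v : Fin n} : v ∈ posSet n x ↔ 0 < x v := by
  simp [posSet]

/-! ### Evaluation of a set -/

/-- Add up the entries of the array `1` at the neighbours of the node in register `3`. -/
def degLoop : Prog :=
  .loop (.lt 1 0) (blk (ldCode 15 1 1 ++
    [.adj 5 3 1, .cast 16 5, .rmul 16 15 16, .radd 14 14 16, .add 1 1 2]))

/-- The degree of `v`, weighted by `x`. -/
noncomputable def wdeg (G : SimpleGraph (Fin n)) (x : ℕ → ℝ) (v : ℕ) : ℝ :=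
  ∑ u ∈ Finset.range n, x u * adjQuery G v u

theorem degLoop_spec {ε c : ℝ} {s : Store} (hs : Consts n ε c s) (h1 : s.nreg 1 = 0)
    (h14 : s.rreg 14 = 0) :
    Hoare G degLoop s (22 * n + 1)
      (fun s' => s'.rreg 14 = wdeg G (arr s 1) (s.nreg 3)) := by
  refine (Hoare.loop (N := n) (T := 21) (fun i s' => s'.nreg 1 = i ∧
    s'.rreg 14 = ∑ u ∈ Finset.range i, arr s 1 u * adjQuery G (s.nreg 3) u) ⟨h1, by simpa⟩
    ?_ ?_).mono (by omega) fun s' h => h.1.2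
  · rintro i s' hi ha ⟨g1, g2⟩
    have hc := hs.agree ha rfl
    refine ⟨by simp only [Test.holds, g1, hc.n0, hi], Hoare.blk rfl ?_⟩
    rw [blkDet_ldCode _ _ _ _ _]
    have h3 := ha.nreg 3 rfl
    have ha1 := ha.arr_eq rfl 1 i
    simp [g1, hc.n2, g2, h3, ha1, Finset.sum_range_succ]
  · rintro s' ha ⟨g1, -⟩
    have hc := hs.agree ha rfl
    simp [Test.holds, g1, hc.n0]

/-- Take the node in register `3` into account in the evaluation of a set. -/
def evalBody : Prog :=
  .seq (blk [.radd 14 11 11, .const 1 0])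
    (.seq degLoop
      (.seq (blk (ldCode 15 3 1 ++ []))
        (.seq
          (.ite (.rlt 11 15)
            (.ite (.rlt 11 14) (blk [.rdiv 16 20 14, .radd 12 12 16, .radd 13 13 14])
              (blk [.const 10 1]))
            (blk []))
          (blk [.add 3 3 2]))))

/-- The state of the evaluation after `i` nodes: no node of degree `0` has been seen and the sums
are correct, or there is such a node. -/
def EvalInv (G : SimpleGraph (Fin n)) (x : ℕ → ℝ) (i : ℕ) (s : Store) : Prop :=
  s.nreg 3 = i ∧
    ((s.nreg 10 = 0 ∧ (∀ v < i, 0 < x v → 0 < wdeg G x v) ∧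
      s.rreg 12 = (∑ v ∈ Finset.range i, if 0 < x v then 1 / wdeg G x v else 0) ∧
      s.rreg 13 = ∑ v ∈ Finset.range i, if 0 < x v then wdeg G x v else 0) ∨
    (s.nreg 10 = 1 ∧ ∃ v < i, 0 < x v ∧ ¬ 0 < wdeg G x v))

theorem evalBody_spec {ε c : ℝ} {s : Store} {i : ℕ} (hs : Consts n ε c s)
    (h : EvalInv G (arr s 1) i s) :
    Hoare G evalBody s (22 * n + 40) (EvalInv G (arr s 1) (i + 1)) := by
  obtain ⟨h3, h⟩ := h
  refine (Hoare.then (Q := fun s' => s'.nreg 1 = 0 ∧ s'.rreg 14 = 0) (Hoare.blk rfl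
    (by simp [hs.r11])) ?_).mono
    (T := 5 + ((22 * n + 1) + (11 + (9 + 3 + 1) + 1) + 1) + 1) (by omega) fun _ h => h
  rintro s1 ⟨a1, a14⟩ ha1
  have hs1 := hs.agree ha1 rfl
  have hx1 : arr s1 1 = arr s 1 := funext fun v => ha1.arr_eq rfl 1 v
  refine Hoare.then (T₁ := 22 * n + 1) (T₂ := 11 + (9 + 3 + 1) + 1) (degLoop_spec (G := G) hs1 a1 a14) ?_
  intro s2 b14 ha2
  have hs2 := hs1.agree ha2 rfl
  have hx2 : arr s2 1 = arr s 1 := (funext fun v => ha2.arr_eq rfl 1 v).trans hx1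
  have b3 : s2.nreg 3 = i := by rw [ha2.nreg 3 rfl, ha1.nreg 3 rfl, h3]
  rw [hx1, ha1.nreg 3 rfl, h3] at b14
  refine Hoare.then (Q := fun s' => s'.rreg 15 = arr s 1 i) (Hoare.blk rfl
    (by rw [blkDet_ldCode _ _ _ _ _]; simp [hx2, b3])) ?_
  intro s3 c15 ha3
  have hs3 := hs2.agree ha3 rfl
  have c3 : s3.nreg 3 = i := by rw [ha3.nreg 3 rfl, b3]
  have c14 : s3.rreg 14 = wdeg G (arr s 1) i := by rw [ha3.rreg 14 rfl, b14]
  have c10 : s3.nreg 10 = s.nreg 10 := by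
    rw [ha3.nreg 10 rfl, ha2.nreg 10 rfl, ha1.nreg 10 rfl]
  have c12 : s3.rreg 12 = s.rreg 12 := by
    rw [ha3.rreg 12 rfl, ha2.rreg 12 rfl, ha1.rreg 12 rfl]
  have c13 : s3.rreg 13 = s.rreg 13 := by
    rw [ha3.rreg 13 rfl, ha2.rreg 13 rfl, ha1.rreg 13 rfl]
  -- The invariant for i + 1 is stated for the store with register 3 already advanced, since the
  -- increment shared by all branches comes after them.
  refine Hoare.seq (T₁ := 9) (T₂ := 3) (Q := fun s' => Consts n ε c s' ∧ s'.nreg 3 = i ∧ EvalInv G (arr s 1) (i + 1)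
    { s' with nreg := Function.update s'.nreg 3 (i + 1) }) ?_ ?_
  · have key : ∀ p : Prog, p.keepsConsts = true → p.wn 3 = false →
        Hoare G p s3 9 (fun s' => EvalInv G (arr s 1) (i + 1)
          { s' with nreg := Function.update s'.nreg 3 (i + 1) }) →
        Hoare G p s3 9 (fun s' => Consts n ε c s' ∧ s'.nreg 3 = i ∧ EvalInv G (arr s 1) (i + 1)
          { s' with nreg := Function.update s'.nreg 3 (i + 1) }) := by
      intro p h1 h2 h
      exact h.frame.mono le_rfl fun s' h' =>
        ⟨hs3.agree h'.2 h1, by rw [h'.2.nreg 3 h2, c3], h'.1⟩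
    refine key _ rfl rfl ?_
    refine (Hoare.ite (T := 8) (fun ht => Hoare.ite (T := 7) (fun ht' => Hoare.blk rfl ?_)
      fun ht' => (Hoare.blk rfl ?_).mono (by simp) fun _ h => h) fun ht =>
        (Hoare.blk rfl ?_).mono (by simp) fun _ h => h).mono (by simp) fun _ h => h
    all_goals simp only [Test.holds, hs3.r11, c15] at ht
    · simp only [Test.holds, hs3.r11, c14] at ht'
      refine ⟨by simp, ?_⟩
      rcases h with ⟨g1, g2, g3, g4⟩ | ⟨g1, v, hv, g2⟩
      · left
        refine ⟨by simp [c10, g1], ?_, ?_, ?_⟩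
        · intro v hv hxv
          rcases Nat.lt_succ_iff_lt_or_eq.1 hv with hv | rfl
          · exact g2 v hv hxv
          · exact ht'
        · simp [Finset.sum_range_succ, ht, c12, g3, c14, hs3.r20]
        · simp [Finset.sum_range_succ, ht, c13, g4, c14]
      · right
        exact ⟨by simp [c10, g1], v, by omega, g2⟩
    · simp only [Test.holds, hs3.r11, c14] at ht'
      refine ⟨by simp, Or.inr ⟨by simp, i, by omega, ht, ht'⟩⟩
    · refine ⟨by simp, ?_⟩
      rcases h with ⟨g1, g2, g3, g4⟩ | ⟨g1, v, hv, g2⟩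
      · left
        refine ⟨by simp [c10, g1], ?_, ?_, ?_⟩
        · intro v hv hxv
          rcases Nat.lt_succ_iff_lt_or_eq.1 hv with hv | rfl
          · exact g2 v hv hxv
          · exact absurd hxv ht
        · simp [Finset.sum_range_succ, ht, c12, g3]
        · simp [Finset.sum_range_succ, ht, c13, g4]
      · right
        exact ⟨by simp [c10, g1], v, by omega, g2⟩
  · rintro s4 ⟨hs4, d3, d⟩
    refine Hoare.blk rfl ?_
    unfold EvalInv at d ⊢
    simpa [d3, hs4.n2] using d

/-- Evaluate the set in the array `1`. -/
def evalLoop : Prog :=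
  .seq (blk [.radd 12 11 11, .radd 13 11 11, .const 10 0, .const 3 0])
    (.loop (.lt 3 0) evalBody)

theorem evalLoop_spec {ε c : ℝ} {s : Store} (hs : Consts n ε c s) :
    Hoare G evalLoop s (n * (22 * n + 41) + 11) (EvalInv G (arr s 1) n) := by
  refine (Hoare.then (Q := EvalInv G (arr s 1) 0) (Hoare.blk rfl ?_) ?_).mono
    (T := 9 + (n * (22 * n + 41) + 1) + 1) (by omega) fun _ h => h
  · refine ⟨by simp, Or.inl ?_⟩
    simp [hs.r11]
  · intro s1 h1 ha1
    have hs1 := hs.agree ha1 rfl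
    have hx1 : arr s1 1 = arr s 1 := funext fun v => ha1.arr_eq rfl 1 v
    refine (Hoare.loop (T := 22 * n + 40) (N := n) (EvalInv G (arr s 1)) h1 ?_ ?_).mono le_rfl
      fun s' h => h.1
    · intro i s2 hi ha2 h2
      have hs2 := hs1.agree ha2 rfl
      have hx2 : arr s2 1 = arr s 1 := (funext fun v => ha2.arr_eq rfl 1 v).trans hx1
      refine ⟨by simp [Test.holds, h2.1, hs2.n0, hi], ?_⟩
      have := evalBody_spec (G := G) hs2 (i := i) (by rw [hx2]; exact h2)
      rwa [hx2] at this
    · intro s2 ha2 h2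
      have hs2 := hs1.agree ha2 rfl
      simp [Test.holds, h2.1, hs2.n0]

/-- Copy the set in the array `1` to the output. -/
def copyLoop : Prog :=
  .loop (.lt 1 0)
    (.seq (blk (ldCode 15 1 1 ++ []))
      (.seq (.ite (.rlt 11 15) (blk [.store 1 2]) (blk [.const 5 0, .store 1 5]))
        (blk [.add 1 1 2])))

theorem copyLoop_spec {ε c : ℝ} {s : Store} (hs : Consts n ε c s) (h1 : s.nreg 1 = 0) :
    Hoare G copyLoop s (24 * n + 1)
      (fun s' => Config.output n ([], s') = posSet n (arr s 1)) := by
  refine (Hoare.loop (N := n) (T := 23) (fun i s' => s'.nreg 1 = i ∧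
    ∀ v < i, s'.nmem v ≠ 0 ↔ 0 < arr s 1 v) ⟨h1, by simp⟩ ?_ ?_).mono (by omega) ?_
  · rintro i s1 hi ha1 ⟨g1, g2⟩
    have hs1 := hs.agree ha1 rfl
    have hx1 : arr s1 1 = arr s 1 := funext fun v => ha1.arr_eq rfl 1 v
    refine ⟨by simp [Test.holds, g1, hs1.n0, hi], ?_⟩
    refine (Hoare.then (Q := fun s' => s'.rreg 15 = arr s 1 i) (Hoare.blk rfl
      (by rw [blkDet_ldCode _ _ _ _ _]; simp [hx1, g1])) ?_).mono
        (T := 11 + (6 + 3 + 1) + 1) (by omega) fun _ h => h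
    intro s2 b15 ha2
    have hs2 := hs1.agree ha2 rfl
    have b1 : s2.nreg 1 = i := by rw [ha2.nreg 1 rfl, g1]
    refine Hoare.then (T₁ := 6) (T₂ := 3) (Q := fun s' => ∀ v < i + 1, s'.nmem v ≠ 0 ↔ 0 < arr s 1 v) ?_ ?_
    · refine Hoare.ite (T := 5) (fun ht => (Hoare.blk rfl ?_).mono (by simp) fun _ h => h)
        fun ht => Hoare.blk rfl ?_
      all_goals
        simp only [Test.holds, hs2.r11, b15] at ht
        intro v hv
        simp only [blkDet, Instr.det, Store.setN, Function.update_apply, b1, hs2.n2]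
        rcases Nat.lt_succ_iff_lt_or_eq.1 hv with hv | rfl
        · simpa [hv.ne, ha2.nmem rfl, b1] using g2 v hv
        · simp [ht]
    · intro s3 c ha3
      have hs3 := hs2.agree ha3 rfl
      refine Hoare.blk rfl ?_
      simpa [ha3.nreg 1 rfl, b1, hs3.n2] using c
  · rintro s' ha ⟨g1, -⟩
    have hc := hs.agree ha rfl
    simp [Test.holds, g1, hc.n0]
  · rintro s' ⟨⟨-, h⟩, -⟩
    ext v
    simp [Config.output, mem_posSet, ← h v v.2]

/-- Compare the set in the array `1` with the best set found so far. -/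
def evalProg : Prog :=
  .seq evalLoop
    (.seq (blk [.rmul 16 1 17, .rmul 16 16 12, .rsub 16 20 16, .radd 15 20 20, .rdiv 13 13 15,
        .rdiv 13 13 17, .rmul 16 16 13])
      (.ite (.lt 10 2)
        (.ite (.rlt 9 16) (.seq (blk [.radd 9 16 11, .const 1 0]) copyLoop) (blk []))
        (blk [])))

/-- The register `9` holds the utility of the set in the output. -/
def BestInv (G : SimpleGraph (Fin n)) (c : ℝ) (s : Store) : Prop :=
  utility G c (Config.output n ([], s)) = (s.rreg 9 : EReal)

theorem wdeg_eq_degIn {x : ℕ → ℝ} (hx : ∀ v < n, x v = 0 ∨ x v = 1) (v : Fin n) :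
    wdeg G x v = degIn G (posSet n x) v := by
  classical
  rw [wdeg, Finset.sum_range, degIn_eq_sum, posSet, Finset.sum_filter]
  push_cast
  refine Finset.sum_congr rfl fun u _ => ?_
  rw [adjQuery_fin]
  rcases hx u u.2 with h | h <;> simp [h]

theorem edgeMax_fin : edgeMax (Fin n) = n * (n - 1) / 2 := by
  rw [edgeMax, Fintype.card_fin, Nat.cast_choose_two]

/-- Register 10 flags a node of degree 0, that is, utility -∞; such a set is never copied, so a real
register suffices for the best utility. For n ≤ 1 no special case arises: the machine divides by
E_max = 0 with the same result as the definition of the utility. -/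
theorem evalProg_spec {ε c : ℝ} {s : Store} (hs : Consts n ε c s)
    (hx : ∀ v < n, arr s 1 v = 0 ∨ arr s 1 v = 1) (hbest : BestInv G c s) :
    Hoare G evalProg s (n * (22 * n + 65) + 50) (fun s' => BestInv G c s' ∧
      utility G c (Config.output n ([], s)) ≤ utility G c (Config.output n ([], s')) ∧
      utility G c (posSet n (arr s 1)) ≤ utility G c (Config.output n ([], s'))) := by
  refine (Hoare.then (evalLoop_spec (G := G) hs) ?_).mono
    (T := (n * (22 * n + 41) + 11) + (15 + (24 * n + 9) + 1) + 1) (by ring_nf; omega) fun _ h => h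
  rintro s1 ⟨-, h⟩ ha1
  have hs1 := hs.agree ha1 rfl
  set x := arr s 1 with hxdef
  have hx1 : arr s1 1 = x := funext fun v => ha1.arr_eq rfl 1 v
  refine Hoare.then (Q := fun s' => s'.rreg 16 = (1 - c * (n * (n - 1) / 2) * s1.rreg 12) *
    (s1.rreg 13 / (1 + 1) / (n * (n - 1) / 2))) (Hoare.blk rfl ?_) ?_
  · simp [hs1.r1, hs1.r17, hs1.r20]
  intro s2 b16 ha2
  have hs2 := hs1.agree ha2 rfl
  have hx2 : arr s2 1 = x := (funext fun v => ha2.arr_eq rfl 1 v).trans hx1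
  have b10 : s2.nreg 10 = s1.nreg 10 := ha2.nreg 10 rfl
  have b9 : s2.rreg 9 = s.rreg 9 := (ha2.rreg 9 rfl).trans (ha1.rreg 9 rfl)
  have bout : Config.output n ([], s2) = Config.output n ([], s) := by
    rw [Config.output, Config.output, ha2.nmem rfl, ha1.nmem rfl]
  have hutil : s1.nreg 10 = 0 → utility G c (posSet n x) = (s2.rreg 16 : EReal) := by
    intro h10
    rcases h with ⟨-, g2, g3, g4⟩ | ⟨g1, -⟩
    · have hpos : ∀ v ∈ posSet n x, 0 < degIn G (posSet n x) v := by
        intro v hv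
        have := g2 v v.2 (mem_posSet.1 hv)
        rw [wdeg_eq_degIn hx] at this
        exact_mod_cast this
      rw [utility_of_pos G c hpos, b16]
      have e1 : s1.rreg 12 = ∑ v ∈ posSet n x, 1 / (degIn G (posSet n x) v : ℝ) := by
        rw [g3, Finset.sum_range]
        conv_rhs => rw [posSet, Finset.sum_filter]
        refine Finset.sum_congr rfl fun v _ => ?_
        rw [← posSet, wdeg_eq_degIn hx]
      have e2 : s1.rreg 13 = 2 * edgesIn G (posSet n x) := by
        have : ((2 * edgesIn G (posSet n x) : ℕ) : ℝ) = 2 * edgesIn G (posSet n x) := by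
          push_cast; rfl
        rw [g4, Finset.sum_range, ← this, ← sum_degIn]
        push_cast
        conv_rhs => rw [posSet, Finset.sum_filter]
        refine Finset.sum_congr rfl fun v _ => ?_
        rw [← posSet, wdeg_eq_degIn hx]
      rw [e1, e2, edgeMax_fin]
      congr 3
      ring
    · omega
  have hbot : s1.nreg 10 ≠ 0 → utility G c (posSet n x) = ⊥ := by
    intro h10
    rcases h with ⟨g1, -⟩ | ⟨-, v, hv, hxv, hdeg⟩
    · exact absurd g1 h10
    · rw [utility, if_neg]
      intro hall
      apply hdeg
      have e := wdeg_eq_degIn (G := G) hx ⟨v, hv⟩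
      dsimp only at e
      rw [e]
      exact_mod_cast hall ⟨v, hv⟩ (mem_posSet.2 hxv)
  -- The two branches that leave the output alone need only that the new set is not better.
  have hkeep : utility G c (posSet n x) ≤ utility G c (Config.output n ([], s)) →
      Hoare G (blk []) s2 1 (fun s' => BestInv G c s' ∧
      utility G c (Config.output n ([], s)) ≤ utility G c (Config.output n ([], s')) ∧
      utility G c (posSet n x) ≤ utility G c (Config.output n ([], s'))) := by
    intro hle
    refine Hoare.blk rfl ?_
    have e : Config.output n ([], blkDet G [] s2) = Config.output n ([], s) := by
      rw [← bout]; rfl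
    rw [BestInv, e]
    refine ⟨?_, le_rfl, hle⟩
    rw [hbest]
    exact congrArg _ b9.symm
  refine Hoare.ite (fun ht => Hoare.ite (T := 24 * n + 7) (fun ht' => ?_) fun ht' => ?_)
    fun ht => ?_
  all_goals simp only [Test.holds, b10, hs2.n2] at ht
  · simp only [Test.holds, b9] at ht'
    have h10 : s1.nreg 10 = 0 := by omega
    refine (Hoare.then (Q := fun s' => s'.rreg 9 = s2.rreg 16 ∧ s'.nreg 1 = 0)
      (Hoare.blk rfl (by simp [hs2.r11])) ?_).mono (T := 5 + (24 * n + 1) + 1) (by omega)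
        fun _ h => h
    rintro s3 ⟨c9, c1⟩ ha3
    have hs3 : Consts n ε c s3 := hs2.agree ha3 rfl
    have hx3 : arr s3 1 = x := (funext fun v => ha3.arr_eq rfl 1 v).trans hx2
    refine (copyLoop_spec (G := G) hs3 c1).frame.mono le_rfl ?_
    rintro s4 ⟨d, ha4⟩
    rw [hx3] at d
    have d9 : s4.rreg 9 = s2.rreg 16 := (ha4.rreg 9 rfl).trans c9
    rw [BestInv, d, d9, hutil h10]
    refine ⟨rfl, ?_, le_rfl⟩
    rw [hbest]
    exact_mod_cast ht'.le
  · refine (hkeep ?_).mono (by omega) fun _ h => h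
    simp only [Test.holds, b9] at ht'
    rw [hutil (by omega), hbest]
    exact_mod_cast not_lt.1 ht'
  · refine (hkeep ?_).mono (by omega) fun _ h => h
    rw [hbot (by omega)]
    exact bot_le

end

end UGSC

namespace UGSC

/-! ### The linear program, solved by relaxation -/

/-- A real number clamped to `[0,1]`. -/
noncomputable def clampR (y : ℝ) : ℝ := if y < 0 then 0 else if 1 < y then 1 else y

theorem clampR_mem (y : ℝ) : 0 ≤ clampR y ∧ clampR y ≤ 1 := by
  unfold clampR
  split_ifs <;> constructor <;> linarith

/-- Clamping is the projection to the convex set [0,1], and z lies in it. -/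
theorem clampR_sub_sq_le {y z : ℝ} (h0 : 0 ≤ z) (h1 : z ≤ 1) :
    (clampR y - z) ^ 2 ≤ (y - z) ^ 2 := by
  unfold clampR
  split_ifs <;> nlinarith

/-- A relaxation step for a violated constraint decreases the distance to all solutions. -/
theorem relax_step {n : ℕ} {a x z : ℕ → ℝ} {b tol η : ℝ} (hη : 0 ≤ η)
    (hz : ∀ u < n, 0 ≤ z u ∧ z u ≤ 1) (ha : ∀ u < n, |a u| ≤ 2)
    (hfeas : b ≤ ∑ u ∈ Finset.range n, a u * z u)
    (hviol : ∑ u ∈ Finset.range n, a u * x u < b - tol) :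
    ∑ u ∈ Finset.range n, (clampR (x u + a u * η) - z u) ^ 2 + (2 * η * tol - 4 * n * η ^ 2) ≤
      ∑ u ∈ Finset.range n, (x u - z u) ^ 2 := by
  -- Expand the square: the violation yields the gain 2 η tol in the linear term, and |a| ≤ 2 bounds
  -- each of the n quadratic terms by 4 η².
  have h1 : ∑ u ∈ Finset.range n, (clampR (x u + a u * η) - z u) ^ 2 ≤
      ∑ u ∈ Finset.range n, ((x u - z u) ^ 2 + 2 * η * (a u * x u - a u * z u) + 4 * η ^ 2) := by
    refine Finset.sum_le_sum fun u hu => ?_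
    have hu := Finset.mem_range.1 hu
    refine (clampR_sub_sq_le (hz u hu).1 (hz u hu).2).trans ?_
    have : a u ^ 2 ≤ 4 := by
      have := ha u hu
      rw [← sq_abs]
      nlinarith [abs_nonneg (a u)]
    nlinarith [sq_nonneg η]
  rw [Finset.sum_add_distrib, Finset.sum_add_distrib, ← Finset.mul_sum, Finset.sum_sub_distrib,
    Finset.sum_const, Finset.card_range, nsmul_eq_mul] at h1
  nlinarith

section

variable {n : ℕ} {G : SimpleGraph (Fin n)}

/-- The coefficients of the constraints of the linear program: the number of edges, the cost, and
the degrees of all nodes. -/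
noncomputable def rowCoef (G : SimpleGraph (Fin n)) (ε : ℝ) (d : ℕ → ℝ) (j u : ℕ) : ℝ :=
  if d u < ε * n / 4 then 0
  -- Row 0 is divided by n and row 1 multiplied by εn/4. For estimates between εn/4 and 2n all
  -- coefficients are then at most 2 in absolute value, as `relax_step` requires.
  else if j < 1 then d u / n
  else if j < 2 then -(ε * n / 4 / d u)
  else adjQuery G (j - 2) u

/-- The right-hand sides of the constraints of the linear program. -/
noncomputable def rowRhs (n : ℕ) (ε : ℝ) (d : ℕ → ℝ) (r₁ r₂ j : ℕ) : ℝ :=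
  if j < 1 then r₁
  -- The objective in the form of a constraint: r₂ ε is a guessed upper bound for the sum of x / d,
  -- negated to fit the direction of the other rows.
  else if j < 2 then -(r₂ * ε * (ε * n / 4))
  else if d (j - 2) < ε * n / 4 then 0
  else (1 - ε) * d (j - 2)

/-- Compute the coefficients of a constraint and its value. -/
def rowLoop : Prog :=
  .loop (.lt 1 0)
    (.seq (blk (ldCode 16 1 0 ++ []))
      (.seq
        (.ite (.rlt 16 10) (blk [.radd 15 11 11])
          (.ite (.lt 3 2) (blk [.rdiv 15 16 21])
            (.ite (.lt 3 13) (blk [.rdiv 15 10 16, .rsub 15 11 15])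
              (blk [.sub 5 3 13, .adj 5 5 1, .cast 15 5]))))
        (blk (stCode 1 2 15 ++ (ldCode 16 1 1 ++ [.rmul 16 15 16, .radd 14 14 16, .add 1 1 2])))))

theorem rowLoop_spec {ε c : ℝ} {s : Store} (hs : Consts n ε c s) (h1 : s.nreg 1 = 0)
    (h14 : s.rreg 14 = 0) :
    Hoare G rowLoop s (60 * n + 1) (fun s' =>
      s'.rreg 14 = ∑ u ∈ Finset.range n, rowCoef G ε (arr s 0) (s.nreg 3) u * arr s 1 u ∧
      (∀ u < n, arr s' 2 u = rowCoef G ε (arr s 0) (s.nreg 3) u) ∧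
      arr s' 0 = arr s 0 ∧ arr s' 1 = arr s 1) := by
  refine (Hoare.loop (N := n) (T := 59) (fun i s' => s'.nreg 1 = i ∧
    s'.rreg 14 = ∑ u ∈ Finset.range i, rowCoef G ε (arr s 0) (s.nreg 3) u * arr s 1 u ∧
      (∀ u < i, arr s' 2 u = rowCoef G ε (arr s 0) (s.nreg 3) u) ∧
      arr s' 0 = arr s 0 ∧ arr s' 1 = arr s 1) ⟨h1, by simpa, by simp, rfl, rfl⟩
    ?_ ?_).mono (by omega) fun s' h => h.1.2
  · rintro i s1 hi ha1 ⟨g1, g2, g3, g4, g5⟩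
    have hs1 := hs.agree ha1 rfl
    refine ⟨by simp only [Test.holds, g1, hs1.n0, hi], ?_⟩
    refine Hoare.comp (Q := fun s' => s'.rreg 16 = arr s 0 i) 11 40 (by omega)
      (Hoare.line rfl (by decide) (by rw [blkDet_ldCode]; simp [g1, g4])) ?_
    intro s2 b16 ha2
    have hs2 := hs1.agree ha2 rfl
    have b3 : s2.nreg 3 = s.nreg 3 := (ha2.nreg 3 rfl).trans (ha1.nreg 3 rfl)
    have b1 : s2.nreg 1 = i := (ha2.nreg 1 rfl).trans g1
    refine Hoare.comp (Q := fun s' => s'.rreg 15 = rowCoef G ε (arr s 0) (s.nreg 3) i) 12 27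
      (by omega) ?_ ?_
    · refine Hoare.branch 11 (by omega) (fun t1 => Hoare.line rfl (by decide) ?_) fun t1 =>
        Hoare.branch 10 (by omega) (fun t2 => Hoare.line rfl (by decide) ?_) fun t2 =>
        Hoare.branch 9 (by omega) (fun t3 => Hoare.line rfl (by decide) ?_) fun t3 =>
        Hoare.line rfl (by decide) ?_
      all_goals simp only [Test.holds, b16, hs2.r10] at t1
      · rw [rowCoef, if_pos t1]
        simp [hs2.r11]
      all_goals simp only [Test.holds, b3, hs2.n2] at t2
      · rw [rowCoef, if_neg t1, if_pos t2]
        simp [b16, hs2.r21]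
      all_goals simp only [Test.holds, b3, hs2.n13] at t3
      · rw [rowCoef, if_neg t1, if_neg t2, if_pos t3]
        simp [b16, hs2.r10, hs2.r11]
      · rw [rowCoef, if_neg t1, if_neg t2, if_neg t3]
        simp [b3, hs2.n13, b1]
    intro s3 c15 ha3
    have hs3 := hs2.agree ha3 rfl
    have c1 : s3.nreg 1 = i := (ha3.nreg 1 rfl).trans b1
    have c14 : s3.rreg 14 = s1.rreg 14 := (ha3.rreg 14 rfl).trans (ha2.rreg 14 rfl)
    have c2 : ∀ u j, arr s3 j u = arr s1 j u := fun u j => by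
      rw [ha3.arr_eq rfl, ha2.arr_eq rfl]
    refine Hoare.line rfl (by decide) ?_
    rw [blkDet_stCode, blkDet_ldCode]
    have e1 : ∀ u, Function.update s3.rmem (adr 2 i) (s3.rreg 15) (adr 1 u) = arr s 1 u := by
      intro u
      rw [update_adr_of_ne_idx _ _ (by norm_num) (by norm_num) (by norm_num), ← g5, ← c2]
      rfl
    have e0 : ∀ u, Function.update s3.rmem (adr 2 i) (s3.rreg 15) (adr 0 u) = arr s 0 u := by
      intro u
      rw [update_adr_of_ne_idx _ _ (by norm_num) (by norm_num) (by norm_num), ← g4, ← c2]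
      rfl
    refine ⟨by simp [c1, hs3.n2], ?_, ?_, ?_, ?_⟩
    · simp [c1, c15, c14, g2, Finset.sum_range_succ]
      rw [c15] at e1
      exact Or.inl (e1 i)
    · intro u hu
      simp only [arr, c1, c15, blkDet, Instr.det, Store.setN, Store.setR]
      rcases Nat.lt_succ_iff_lt_or_eq.1 hu with hu | rfl
      · rw [update_adr_of_ne _ _ (by norm_num) hu.ne, ← arr, c2, g3 u hu]
      · rw [update_adr_self]
    · funext u
      simpa [arr, c1] using e0 u
    · funext u
      simpa [arr, c1] using e1 u
  · rintro s' ha ⟨g1, -⟩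
    have hc := hs.agree ha rfl
    simp [Test.holds, g1, hc.n0]

/-- Compute the right-hand side of a constraint. -/
def rhsProg : Prog :=
  .ite (.lt 3 2) (blk [.cast 23 11])
    (.ite (.lt 3 13) (blk [.cast 23 12, .rmul 23 23 0, .rmul 23 23 10, .rsub 23 11 23])
      (.seq (blk (.sub 15 3 13 :: (ldCode 16 15 0 ++ [])))
        (.ite (.rlt 16 10) (blk [.radd 23 11 11]) (blk [.rmul 23 22 16]))))

theorem rhsProg_spec {ε c : ℝ} {s : Store} (hs : Consts n ε c s) :
    Hoare G rhsProg s 30 (fun s' =>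
      s'.rreg 23 = rowRhs n ε (arr s 0) (s.nreg 11) (s.nreg 12) (s.nreg 3)) := by
  refine Hoare.branch 29 (by omega) (fun t1 => Hoare.line rfl (by decide) ?_) fun t1 =>
    Hoare.branch 28 (by omega) (fun t2 => Hoare.line rfl (by decide) ?_) fun t2 =>
    Hoare.comp (Q := fun s' => s'.rreg 16 = arr s 0 (s.nreg 3 - 2)) 13 10 (by omega)
      (Hoare.line rfl (by decide) ?_) fun s1 b ha => ?_
  all_goals simp only [Test.holds, hs.n2, hs.n13] at *
  · rw [rowRhs, if_pos t1]
    simp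
  · rw [rowRhs, if_neg t1, if_pos t2]
    simp [hs.r0, hs.r10, hs.r11]
  · rw [blkDet, blkDet_ldCode]
    simp [hs.n13, arr]
  · have hs1 := hs.agree ha rfl
    refine Hoare.branch 9 (by omega) (fun t3 => Hoare.line rfl (by decide) ?_) fun t3 =>
      Hoare.line rfl (by decide) ?_
    all_goals simp only [Test.holds, b, hs1.r10] at t3
    · rw [rowRhs, if_neg t1, if_neg t2, if_pos t3]
      simp [hs1.r11]
    · rw [rowRhs, if_neg t1, if_neg t2, if_neg t3]
      simp [hs1.r22, b]

/-- Move the fractional solution along the coefficients of the violated constraint. -/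
def moveLoop : Prog :=
  .loop (.lt 1 0)
    (.seq (blk (ldCode 15 1 1 ++ (ldCode 16 1 2 ++ [.rmul 16 16 19, .radd 15 15 16])))
      (.seq
        (.ite (.rlt 15 11) (blk [.radd 15 11 11])
          (.ite (.rlt 20 15) (blk [.radd 15 20 11]) (blk [])))
        (blk (stCode 1 1 15 ++ [.add 1 1 2]))))

theorem moveLoop_spec {ε c : ℝ} {s : Store} (hs : Consts n ε c s) (h1 : s.nreg 1 = 0) :
    Hoare G moveLoop s (60 * n + 1) (fun s' =>
      (∀ u < n, arr s' 1 u = clampR (arr s 1 u + arr s 2 u * (ε ^ 2 / 32))) ∧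
      arr s' 0 = arr s 0) := by
  refine (Hoare.loop (N := n) (T := 59) (fun i s' => s'.nreg 1 = i ∧
    (∀ u < i, arr s' 1 u = clampR (arr s 1 u + arr s 2 u * (ε ^ 2 / 32))) ∧
    (∀ u, i ≤ u → arr s' 1 u = arr s 1 u) ∧
      arr s' 0 = arr s 0 ∧ arr s' 2 = arr s 2) ⟨h1, by simp, fun _ _ => rfl, rfl, rfl⟩
    ?_ ?_).mono (by omega) fun s' h => ⟨h.1.2.1, h.1.2.2.2.1⟩
  · rintro i s1 hi ha1 ⟨g1, g2, g3, g4, g5⟩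
    have hs1 := hs.agree ha1 rfl
    refine ⟨by simp only [Test.holds, g1, hs1.n0, hi], ?_⟩
    refine Hoare.comp (Q := fun s' => s'.rreg 15 = arr s 1 i + arr s 2 i * (ε ^ 2 / 32)) 25 30
      (by omega) (Hoare.line rfl (by decide) ?_) ?_
    · rw [blkDet_ldCode, blkDet_ldCode]
      have e1 : s1.rmem (adr 1 i) = arr s 1 i := g3 i le_rfl
      have e2 : s1.rmem (adr 2 i) = arr s 2 i := congrFun g5 i
      simp [g1, arr, hs1.r19, e1, e2]
    intro s2 b15 ha2
    have hs2 := hs1.agree ha2 rfl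
    have b1 : s2.nreg 1 = i := (ha2.nreg 1 rfl).trans g1
    refine Hoare.comp (Q := fun s' => s'.rreg 15 =
      clampR (arr s 1 i + arr s 2 i * (ε ^ 2 / 32))) 6 20 (by omega) ?_ ?_
    · refine Hoare.branch 5 (by omega) (fun t1 => Hoare.line rfl (by decide) ?_) fun t1 =>
        Hoare.branch 3 (by omega) (fun t2 => Hoare.line rfl (by decide) ?_) fun t2 =>
        Hoare.line rfl (by decide) ?_
      all_goals simp only [Test.holds, b15, hs2.r11] at t1
      · rw [clampR, if_pos t1]
        simp [hs2.r11]
      all_goals simp only [Test.holds, b15, hs2.r20] at t2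
      · rw [clampR, if_neg t1, if_pos t2]
        simp [hs2.r11, hs2.r20]
      · rw [clampR, if_neg t1, if_neg t2]
        simp [b15]
    intro s3 c15 ha3
    have hs3 := hs2.agree ha3 rfl
    have c1 : s3.nreg 1 = i := (ha3.nreg 1 rfl).trans b1
    have c2 : ∀ u j, s3.rmem (adr j u) = arr s1 j u := fun u j => by
      rw [← ha2.arr_eq rfl, ← ha3.arr_eq rfl]; rfl
    refine Hoare.line rfl (by decide) ?_
    rw [blkDet_stCode]
    have e : ∀ j u, arr (blkDet G [.add 1 1 2] { ((s3.setN 4 (adr 1 (s3.nreg 1))).setN 5 1) with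
        rmem := Function.update s3.rmem (adr 1 (s3.nreg 1)) (s3.rreg 15) }) j u =
        Function.update s3.rmem (adr 1 i) (s3.rreg 15) (adr j u) := by
      intro j u
      rw [c1]
      rfl
    refine ⟨by simp [c1, hs3.n2], fun u hu => ?_, fun u hu => ?_, funext fun u => ?_,
      funext fun u => ?_⟩
    all_goals rw [e]
    · rcases Nat.lt_succ_iff_lt_or_eq.1 hu with hu | rfl
      · rw [update_adr_of_ne _ _ (by norm_num) hu.ne, c2, g2 u hu]
      · rw [update_adr_self, c15]
    · rw [update_adr_of_ne _ _ (by norm_num) (by omega), c2, g3 u (by omega)]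
    · rw [update_adr_of_ne_idx _ _ (by norm_num) (by norm_num) (by norm_num), c2, g4]
    · rw [update_adr_of_ne_idx _ _ (by norm_num) (by norm_num) (by norm_num), c2, g5]
  · rintro s' ha ⟨g1, -⟩
    have hc := hs.agree ha rfl
    simp [Test.holds, g1, hc.n0]

/-- Treat the constraint in register `3`; the search for a violated constraint starts again after
every move, and is given up after `n + 1` moves. -/
def lpBody : Prog :=
  .seq (blk [.radd 14 11 11, .const 1 0])
    (.seq rowLoop
      (.seq rhsProg
        (.seq (blk [.rsub 16 23 18])
          (.ite (.rlt 14 16)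
            (.seq (blk [.const 1 0])
              (.seq moveLoop
                (.seq (blk [.const 3 0, .add 6 6 2])
                  (.ite (.lt 0 6) (blk [.const 5 0, .add 3 14 5]) (blk [])))))
            (blk [.add 3 3 2])))))

/-- `z` is an exact solution of the linear program, whose coefficients are small. -/
structure RowFeasible (G : SimpleGraph (Fin n)) (ε : ℝ) (d : ℕ → ℝ) (r₁ r₂ : ℕ)
    (z : ℕ → ℝ) : Prop where
  mem_unit : ∀ u < n, 0 ≤ z u ∧ z u ≤ 1
  coef_le : ∀ j < n + 2, ∀ u < n, |rowCoef G ε d j u| ≤ 2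
  rows : ∀ j < n + 2, rowRhs n ε d r₁ r₂ j ≤ ∑ u ∈ Finset.range n, rowCoef G ε d j u * z u

/-- The state of the relaxation method. -/
structure LPInv (G : SimpleGraph (Fin n)) (ε : ℝ) (d : ℕ → ℝ) (r₁ r₂ : ℕ) (s : Store) :
    Prop where
  est : arr s 0 = d
  mem_unit : ∀ u < n, 0 ≤ arr s 1 u ∧ arr s 1 u ≤ 1
  outside : ∀ u < n, d u < ε * n / 4 → arr s 1 u = 0
  moves_le : s.nreg 6 ≤ n + 1
  halted : s.nreg 6 = n + 1 → s.nreg 3 = n + 2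
  sat : s.nreg 6 ≤ n → ∀ j < s.nreg 3, rowRhs n ε d r₁ r₂ j - ε ^ 2 * n / 8 ≤
    ∑ u ∈ Finset.range n, rowCoef G ε d j u * arr s 1 u
  dist : ∀ z, RowFeasible G ε d r₁ r₂ z → ∑ u ∈ Finset.range n, (arr s 1 u - z u) ^ 2 +
    s.nreg 6 * (ε ^ 4 * n / 256) ≤ n

/-- The variant of the relaxation method. -/
def lpVariant (n : ℕ) (s : Store) : ℕ := (n + 1 - s.nreg 6) * (n + 3) + (n + 2 - s.nreg 3)

/-- A move is paid for by the distance to all feasible points, a satisfied row by the row counter.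
Move number n + 1 gives up by setting the row counter to n + 2, which ends the loop and leaves the
clause `sat` void. -/
theorem lpBody_spec {ε c : ℝ} {s : Store} {d : ℕ → ℝ} {r₁ r₂ : ℕ} (hs : Consts n ε c s)
    (h11 : s.nreg 11 = r₁) (h12 : s.nreg 12 = r₂) (h : LPInv G ε d r₁ r₂ s)
    (hj : s.nreg 3 < n + 2) :
    Hoare G lpBody s (120 * n + 100)
      (fun s' => LPInv G ε d r₁ r₂ s' ∧ lpVariant n s' < lpVariant n s) := by
  have hq : s.nreg 6 ≤ n := by
    by_contra hcon
    have h1 := h.moves_le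
    have := h.halted (by omega)
    omega
  refine Hoare.comp (Q := fun s' => s'.nreg 1 = 0 ∧ s'.rreg 14 = 0) 5 (120 * n + 94) (by omega)
    (Hoare.line rfl (by decide) (by simp [hs.r11])) ?_
  rintro s1 ⟨a1, a14⟩ ha1
  have hs1 := hs.agree ha1 rfl
  refine Hoare.comp (60 * n + 1) (60 * n + 92) (by omega) (rowLoop_spec (G := G) hs1 a1 a14) ?_
  rintro s2 ⟨b14, b2, b0, b1⟩ ha2
  have hs2 := hs1.agree ha2 rfl
  have e0 : arr s1 0 = d := (funext fun v => ha1.arr_eq rfl 0 v).trans h.est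
  have e1 : arr s1 1 = arr s 1 := funext fun v => ha1.arr_eq rfl 1 v
  rw [e0, e1, ha1.nreg 3 rfl] at b14
  rw [e0, ha1.nreg 3 rfl] at b2
  rw [e0] at b0
  rw [e1] at b1
  refine Hoare.comp 30 (60 * n + 61) (by omega) (rhsProg_spec (G := G) hs2) ?_
  intro s3 c23 ha3
  have hs3 := hs2.agree ha3 rfl
  rw [b0, ha2.nreg 11 rfl, ha1.nreg 11 rfl, h11, ha2.nreg 12 rfl, ha1.nreg 12 rfl, h12,
    ha2.nreg 3 rfl, ha1.nreg 3 rfl] at c23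
  refine Hoare.comp (Q := fun s' => s'.rreg 16 =
    rowRhs n ε d r₁ r₂ (s.nreg 3) - ε ^ 2 * n / 8) 3 (60 * n + 57) (by omega)
    (Hoare.line rfl (by decide) (by simp [c23, hs3.r18])) ?_
  intro s4 d16 ha4
  have hs4 := hs3.agree ha4 rfl
  have d14 : s4.rreg 14 =
      ∑ u ∈ Finset.range n, rowCoef G ε d (s.nreg 3) u * arr s 1 u := by
    rw [ha4.rreg 14 rfl, ha3.rreg 14 rfl, b14]
  have d0 : arr s4 0 = d := by
    funext v; rw [ha4.arr_eq rfl, ha3.arr_eq rfl, b0]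
  have d1 : arr s4 1 = arr s 1 := by
    funext v; rw [ha4.arr_eq rfl, ha3.arr_eq rfl, b1]
  have d2 : ∀ u < n, arr s4 2 u = rowCoef G ε d (s.nreg 3) u := fun u hu => by
    rw [ha4.arr_eq rfl, ha3.arr_eq rfl, b2 u hu]
  have d3 : s4.nreg 3 = s.nreg 3 := by
    rw [ha4.nreg 3 rfl, ha3.nreg 3 rfl, ha2.nreg 3 rfl, ha1.nreg 3 rfl]
  have d6 : s4.nreg 6 = s.nreg 6 := by
    rw [ha4.nreg 6 rfl, ha3.nreg 6 rfl, ha2.nreg 6 rfl, ha1.nreg 6 rfl]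
  refine Hoare.branch (60 * n + 30) (by omega) (fun t => ?_) fun t => ?_
  · simp only [Test.holds, d14, d16] at t
    refine Hoare.comp (Q := fun s' => s'.nreg 1 = 0) 3 (60 * n + 25) (by omega)
      (Hoare.line rfl (by decide) (by simp)) ?_
    intro s5 f1 ha5
    have hs5 := hs4.agree ha5 rfl
    refine Hoare.comp (60 * n + 1) 20 (by omega) (moveLoop_spec (G := G) hs5 f1) ?_
    rintro s6 ⟨g1, g0⟩ ha6
    have hs6 := hs5.agree ha6 rfl
    have g6 : s6.nreg 6 = s.nreg 6 := by rw [ha6.nreg 6 rfl, ha5.nreg 6 rfl, d6]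
    have g0' : arr s6 0 = d := by
      rw [g0]; funext v; rw [ha5.arr_eq rfl, d0]
    have g1' : ∀ u < n, arr s6 1 u =
        clampR (arr s 1 u + rowCoef G ε d (s.nreg 3) u * (ε ^ 2 / 32)) := by
      intro u hu
      rw [g1 u hu, ha5.arr_eq rfl, ha5.arr_eq rfl, d1, d2 u hu]
    have hunit : ∀ u < n, 0 ≤ arr s6 1 u ∧ arr s6 1 u ≤ 1 := fun u hu => by
      rw [g1' u hu]; exact clampR_mem _
    have hout : ∀ u < n, d u < ε * n / 4 → arr s6 1 u = 0 := by
      intro u hu hd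
      rw [g1' u hu, h.outside u hu hd, rowCoef, if_pos hd]
      simp [clampR]
    have hdist : ∀ z, RowFeasible G ε d r₁ r₂ z →
        ∑ u ∈ Finset.range n, (arr s6 1 u - z u) ^ 2 +
          ((s.nreg 6 + 1 : ℕ) : ℝ) * (ε ^ 4 * n / 256) ≤ n := by
      intro z hz
      have h1 := relax_step (η := ε ^ 2 / 32) (by positivity) hz.mem_unit (hz.coef_le _ hj)
        (hz.rows _ hj) t
      have h2 := h.dist z hz
      have h3 : ∑ u ∈ Finset.range n, (arr s6 1 u - z u) ^ 2 = ∑ u ∈ Finset.range n,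
          (clampR (arr s 1 u + rowCoef G ε d (s.nreg 3) u * (ε ^ 2 / 32)) - z u) ^ 2 :=
        Finset.sum_congr rfl fun u hu => by rw [g1' u (Finset.mem_range.1 hu)]
      rw [h3]
      push_cast
      -- For the tolerance ε²n/8 the best step length is tol / (4n) = ε²/32: a gain ε⁴n/128 against
      -- a loss ε⁴n/256.
      have e : 2 * (ε ^ 2 / 32) * (ε ^ 2 * n / 8) - 4 * n * (ε ^ 2 / 32) ^ 2 =
          ε ^ 4 * n / 256 := by ring
      rw [e] at h1
      linarith
    refine Hoare.comp (Q := fun s' => s'.nreg 3 = 0 ∧ s'.nreg 6 = s.nreg 6 + 1) 5 10 (by omega)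
      (Hoare.line rfl (by decide) (by simp [g6, hs6.n2])) ?_
    rintro s7 ⟨k3, k6⟩ ha7
    have hs7 := hs6.agree ha7 rfl
    have k0 : arr s7 0 = d := by rw [← g0']; funext v; rw [ha7.arr_eq rfl]
    have k1 : arr s7 1 = arr s6 1 := funext fun v => ha7.arr_eq rfl 1 v
    refine Hoare.branch 9 (by omega) (fun t' => ?_) fun t' => ?_
    all_goals simp only [Test.holds, hs7.n0, k6] at t'
    · refine (Hoare.line (Q := fun s' => s'.nreg 3 = n + 2) rfl (by decide)
        (by simp [hs7.n14])).frame.mono le_rfl ?_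
      rintro s8 ⟨l3, ha8⟩
      have l6 : s8.nreg 6 = s.nreg 6 + 1 := (ha8.nreg 6 rfl).trans k6
      have l0 : arr s8 0 = d := by rw [← k0]; funext v; rw [ha8.arr_eq rfl]
      have l1 : arr s8 1 = arr s6 1 := by rw [← k1]; funext v; rw [ha8.arr_eq rfl]
      refine ⟨⟨l0, by rwa [l1], by rwa [l1], by omega, fun _ => l3, fun hle => by omega,
        by rwa [l1, l6]⟩, ?_⟩
      unfold lpVariant
      rw [l3, l6]
      have : n + 1 - s.nreg 6 = (n + 1 - (s.nreg 6 + 1)) + 1 := by omega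
      rw [this, Nat.succ_mul]
      omega
    · refine (Hoare.line (Q := fun _ => True) rfl (by decide) trivial).frame.mono le_rfl ?_
      rintro s8 ⟨-, ha8⟩
      have l3 : s8.nreg 3 = 0 := (ha8.nreg 3 rfl).trans k3
      have l6 : s8.nreg 6 = s.nreg 6 + 1 := (ha8.nreg 6 rfl).trans k6
      have l0 : arr s8 0 = d := by rw [← k0]; funext v; rw [ha8.arr_eq rfl]
      have l1 : arr s8 1 = arr s6 1 := by rw [← k1]; funext v; rw [ha8.arr_eq rfl]
      refine ⟨⟨l0, by rwa [l1], by rwa [l1], by omega, fun hh => by omega,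
        fun _ j hjj => by omega, by rwa [l1, l6]⟩, ?_⟩
      unfold lpVariant
      rw [l3, l6]
      -- A move sends the row counter back to 0, so it has to outweigh n + 2 rows; hence the weight
      -- n + 3 in the variant.
      have : n + 1 - s.nreg 6 = (n + 1 - (s.nreg 6 + 1)) + 1 := by omega
      rw [this, Nat.succ_mul]
      omega
  · simp only [Test.holds, d14, d16, not_lt] at t
    refine (Hoare.line (T := 60 * n + 30) (Q := fun s' => s'.nreg 3 = s.nreg 3 + 1) rfl
      (by simp) (by simp [hs4.n2, d3])).frame.mono le_rfl ?_
    rintro s5 ⟨f3, ha5⟩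
    have f6 : s5.nreg 6 = s.nreg 6 := (ha5.nreg 6 rfl).trans d6
    have f0 : arr s5 0 = d := by rw [← d0]; funext v; rw [ha5.arr_eq rfl]
    have f1 : arr s5 1 = arr s 1 := by rw [← d1]; funext v; rw [ha5.arr_eq rfl]
    refine ⟨⟨f0, by rw [f1]; exact h.mem_unit, by rw [f1]; exact h.outside, by omega,
      fun hh => by omega, ?_, by rw [f1, f6]; exact h.dist⟩, ?_⟩
    · intro _ j hjj
      rw [f1]
      rw [f3] at hjj
      rcases Nat.lt_succ_iff_lt_or_eq.1 hjj with hlt | rfl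
      · exact h.sat hq j hlt
      · exact t
    · unfold lpVariant
      rw [f3, f6]
      omega

/-- Solve the linear program approximately. -/
def lpProg : Prog := .seq (blk [.const 3 0, .const 6 0]) (.loop (.lt 3 14) lpBody)

/-- The squared distance from 0 to a feasible point is at most n, and each move lowers it by
ε⁴n/256. For n ≥ 256/ε⁴ a feasible system therefore admits at most n moves, and the search is not
given up. The time bound does not presuppose feasibility, since wrong guesses must terminate too. -/
theorem lpProg_spec {ε c : ℝ} {s : Store} {r₁ r₂ : ℕ} (hs : Consts n ε c s) (hε : 0 < ε)
    (h11 : s.nreg 11 = r₁) (h12 : s.nreg 12 = r₂) (hx : ∀ u < n, arr s 1 u = 0) :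
    Hoare G lpProg s ((n + 2) * (n + 3) * (120 * n + 101) + 7) (fun s' =>
      arr s' 0 = arr s 0 ∧ (∀ u < n, 0 ≤ arr s' 1 u ∧ arr s' 1 u ≤ 1) ∧
      (∀ u < n, arr s 0 u < ε * n / 4 → arr s' 1 u = 0) ∧
      (256 / ε ^ 4 ≤ n → (∃ z, RowFeasible G ε (arr s 0) r₁ r₂ z) → ∀ j < n + 2,
        rowRhs n ε (arr s 0) r₁ r₂ j - ε ^ 2 * n / 8 ≤
          ∑ u ∈ Finset.range n, rowCoef G ε (arr s 0) j u * arr s' 1 u)) := by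
  refine Hoare.comp (Q := fun s' => s'.nreg 3 = 0 ∧ s'.nreg 6 = 0) 5
    ((n + 2) * (n + 3) * (120 * n + 101) + 1) (by omega)
    (Hoare.line rfl (by decide) (by simp)) ?_
  rintro s1 ⟨a3, a6⟩ ha1
  have hs1 := hs.agree ha1 rfl
  have e0 : arr s1 0 = arr s 0 := funext fun v => ha1.arr_eq rfl 0 v
  have e1 : arr s1 1 = arr s 1 := funext fun v => ha1.arr_eq rfl 1 v
  have hinit : LPInv G ε (arr s 0) r₁ r₂ s1 := by
    refine ⟨e0, ?_, ?_, by omega, fun hh => by omega, fun _ j hj => by omega, ?_⟩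
    · intro u hu
      rw [e1, hx u hu]
      norm_num
    · intro u hu _
      rw [e1, hx u hu]
    · intro z hz
      rw [a6, e1]
      have : ∑ u ∈ Finset.range n, (arr s 1 u - z u) ^ 2 ≤ ∑ u ∈ Finset.range n, (1 : ℝ) := by
        refine Finset.sum_le_sum fun u hu => ?_
        have := hz.mem_unit u (Finset.mem_range.1 hu)
        rw [hx u (Finset.mem_range.1 hu)]
        nlinarith
      simpa using this
  refine (Hoare.loop_variant (T := 120 * n + 100) (N := (n + 2) * (n + 3))
    (LPInv G ε (arr s 0) r₁ r₂) (lpVariant n) hinit ?_ ?_).mono le_rfl ?_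
  · unfold lpVariant
    rw [a3, a6]
    simp only [Nat.sub_zero]
    nlinarith
  · intro s2 ha2 h2 ht
    have hs2 := hs1.agree ha2 rfl
    simp only [Test.holds, hs2.n14] at ht
    exact lpBody_spec hs2 (by rw [ha2.nreg 11 rfl, ha1.nreg 11 rfl, h11])
      (by rw [ha2.nreg 12 rfl, ha1.nreg 12 rfl, h12]) h2 ht
  · rintro s2 ⟨⟨h2, ht⟩, ha2⟩
    have hs2 := hs1.agree ha2 rfl
    simp only [Test.holds, hs2.n14, not_lt] at ht
    refine ⟨h2.est, h2.mem_unit, h2.outside, ?_⟩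
    rintro hn ⟨z, hz⟩ j hj
    refine h2.sat ?_ j (by omega)
    have h3 := h2.dist z hz
    have h4 : 0 ≤ ∑ u ∈ Finset.range n, (arr s2 1 u - z u) ^ 2 :=
      Finset.sum_nonneg fun _ _ => sq_nonneg _
    have hε4 : 0 < ε ^ 4 := by positivity
    rw [div_le_iff₀ hε4] at hn
    have hn0 : (0 : ℝ) < n := by
      by_contra hcon
      nlinarith [not_lt.1 hcon]
    have h5 : (s2.nreg 6 : ℝ) * (ε ^ 4 * n / 256) ≤ n := by linarith
    have h6 : (s2.nreg 6 : ℝ) ≤ n := by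
      have h7 : (s2.nreg 6 : ℝ) * (ε ^ 4 * n) ≤ n * (ε ^ 4 * n) := by nlinarith
      exact le_of_mul_le_mul_right h7 (by positivity)
    exact_mod_cast h6

end

end UGSC

namespace UGSC

/-! ### Sampling, rounding and enumeration -/

section

variable {n : ℕ} {G : SimpleGraph (Fin n)}

theorem Ens.comp {p q : Prog} {s : Store} (T₁ T₂ : ℕ) {T : ℕ} {Q R : Store → Prop} {r : ℝ≥0∞}
    {f : Store → ℝ≥0∞} (g : Store → ℝ≥0∞) (hT : T₁ + T₂ + 1 ≤ T) (hp : Ens G p s T₁ Q r g)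
    (hq : ∀ s', Q s' → Agree p s s' → Ens G q s' T₂ R (g s') f) : Ens G (.seq p q) s T R r f :=
  (Ens.seq hp.frame fun s' h => hq s' h.1 h.2).mono hT (fun _ h => h) le_rfl fun _ _ => le_rfl

/-- The entries of an array as a vector. -/
noncomputable def vec (n : ℕ) (s : Store) (j : ℕ) : Fin n → ℝ := fun v => arr s j v

/-- Add the sampled node to the degree estimates. -/
def addLoop : Prog :=
  .loop (.lt 1 0) (blk (ldCode 15 1 0 ++ (.adj 5 1 8 :: .cast 16 5 :: .rmul 16 16 6 ::
    .radd 15 15 16 :: (stCode 1 0 15 ++ [.add 1 1 2]))))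

theorem addLoop_spec {ε c : ℝ} {s : Store} (hs : Consts n ε c s) (h1 : s.nreg 1 = 0) :
    Hoare G addLoop s (40 * n + 1) (fun s' =>
      (∀ u < n, arr s' 0 u = arr s 0 u + adjQuery G u (s.nreg 8) * s.rreg 6) ∧
      arr s' 1 = arr s 1) := by
  refine (Hoare.loop (N := n) (T := 39) (fun i s' => s'.nreg 1 = i ∧
    (∀ u < i, arr s' 0 u = arr s 0 u + adjQuery G u (s.nreg 8) * s.rreg 6) ∧
    (∀ u, i ≤ u → arr s' 0 u = arr s 0 u) ∧ arr s' 1 = arr s 1)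
    ⟨h1, by simp, fun _ _ => rfl, rfl⟩ ?_ ?_).mono (by omega) fun s' h => ⟨h.1.2.1, h.1.2.2.2⟩
  · rintro i s1 hi ha1 ⟨g1, g2, g3, g4⟩
    have hs1 := hs.agree ha1 rfl
    refine ⟨by simp only [Test.holds, g1, hs1.n0, hi], Hoare.line rfl (by decide) ?_⟩
    rw [blkDet_ldCode, blkDet, blkDet, blkDet, blkDet, blkDet_stCode]
    have e0 : s1.rmem (adr 0 i) = arr s 0 i := g3 i le_rfl
    have e8 : s1.nreg 8 = s.nreg 8 := ha1.nreg 8 rfl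
    have e6 : s1.rreg 6 = s.rreg 6 := ha1.rreg 6 rfl
    have c2 : ∀ u j, s1.rmem (adr j u) = arr s1 j u := fun u j => rfl
    set s2 := blkDet G [.add 1 1 2] _ with hs2
    have e : ∀ u, arr s2 0 u = Function.update s1.rmem (adr 0 i)
        (s1.rmem (adr 0 i) + adjQuery G i (s1.nreg 8) * s1.rreg 6) (adr 0 u) := by
      intro u
      rw [← g1]
      rfl
    refine ⟨by simp [hs2, g1, hs1.n2], fun u hu => ?_, fun u hu => ?_, funext fun u => ?_⟩
    · rw [e]
      rcases Nat.lt_succ_iff_lt_or_eq.1 hu with hu | rfl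
      · rw [update_adr_of_ne _ _ (by norm_num) hu.ne, c2, g2 u hu]
      · rw [update_adr_self, e0, e8, e6]
    · rw [e]
      rw [update_adr_of_ne _ _ (by norm_num) (by omega), c2, g3 u (by omega)]
    · refine Eq.trans ?_ (congrFun g4 u)
      exact update_adr_of_ne_idx _ _ (by norm_num) (by norm_num) (by norm_num)
  · rintro s' ha ⟨g1, -⟩
    have hc := hs.agree ha rfl
    simp [Test.holds, g1, hc.n0]

/-- The average of `F` over the degree estimates obtained from `e` by `r` further samples. -/
noncomputable def sampleAvg (G : SimpleGraph (Fin n)) (F : (Fin n → ℝ) → ℝ≥0∞) (inc : ℝ) (r : ℕ)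
    (e : Fin n → ℝ) : ℝ≥0∞ :=
  ∑ M : Fin r → Fin n, ((n : ℝ≥0∞)⁻¹) ^ r * F fun v => e v + sampleDeg G M v * inc

theorem sampleDeg_cons {r : ℕ} (a : Fin n) (M : Fin r → Fin n) (v : Fin n) :
    sampleDeg G (Fin.cons a M : Fin (r + 1) → Fin n) v = adjQuery G v a + sampleDeg G M v := by
  classical
  rw [sampleDeg, sampleDeg, Finset.card_filter, Finset.card_filter, Fin.sum_univ_succ,
    adjQuery_fin]
  simp only [Fin.cons_zero, Fin.cons_succ]

theorem sampleAvg_zero (F : (Fin n → ℝ) → ℝ≥0∞) (inc : ℝ) (e : Fin n → ℝ) :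
    sampleAvg G F inc 0 e = F e := by
  have : ∀ M : Fin 0 → Fin n, (fun v => e v + sampleDeg G M v * inc) = e := by
    intro M
    funext v
    simp [sampleDeg]
  simp [sampleAvg, this]

/-- Condition on the first node. The machine follows this recursion: it adds each node to the
estimates as soon as it is drawn and does not store the sample. -/
theorem sampleAvg_succ (F : (Fin n → ℝ) → ℝ≥0∞) (inc : ℝ) (r : ℕ) (e : Fin n → ℝ) :
    sampleAvg G F inc (r + 1) e =
      ∑ a : Fin n, (n : ℝ≥0∞)⁻¹ * sampleAvg G F inc r fun v => e v + adjQuery G v a * inc := by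
  unfold sampleAvg
  rw [← (Fin.consEquiv fun _ : Fin (r + 1) => Fin n).sum_comp, Fintype.sum_prod_type]
  refine Finset.sum_congr rfl fun a _ => ?_
  rw [Finset.mul_sum]
  refine Finset.sum_congr rfl fun M _ => ?_
  rw [← mul_assoc, ← pow_succ']
  congr 2
  funext v
  change e v + ((sampleDeg G (Fin.cons a M : Fin (r + 1) → Fin n) v : ℕ) : ℝ) * inc = _
  rw [sampleDeg_cons]
  push_cast
  ring

/-- Draw a node and update the degree estimates. -/
def sampleBody : Prog :=
  .seq (.instr (.rand 8 9)) (.seq (blk [.const 1 0]) (.seq addLoop (blk [.radd 5 5 20])))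

/-- Draw the sample. -/
def sampleLoop : Prog := .loop (.rlt 5 4) sampleBody

theorem sampleBody_spec {ε c : ℝ} {s : Store} (hs : Consts n ε c s) (hn : 0 < n)
    (F : (Fin n → ℝ) → ℝ≥0∞) (r : ℕ) :
    Ens G sampleBody s (40 * n + 20)
      (fun s' => s'.rreg 5 = s.rreg 5 + 1 ∧ arr s' 1 = arr s 1)
      (sampleAvg G F (s.rreg 6) (r + 1) (vec n s 0))
      (fun s' => sampleAvg G F (s.rreg 6) r (vec n s' 0)) := by
  -- `rand` draws from {0, …, k}, which is why the register holds n - 1.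
  have h9 : s.nreg 9 + 1 = n := by rw [hs.n9]; omega
  refine Ens.comp (Q := fun s' => s'.nreg 8 < n) 1 (40 * n + 18) (fun s' => sampleAvg G F (s.rreg 6) r
    fun v => vec n s 0 v + adjQuery G v (s'.nreg 8) * s.rreg 6) (by omega)
    (Ens.rand (fun j hj => ?_) ?_) ?_
  · simp only [Store.setN, Function.update_self]
    omega
  · rw [sampleAvg_succ]
    refine le_of_eq (Fintype.sum_equiv (finCongr h9.symm) _ _ fun a => ?_)
    have : ((s.nreg 9 + 1 : ℕ) : ℝ≥0∞) = n := by rw [h9]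
    simp [this]
  intro s1 b8 ha1
  have hs1 := hs.agree ha1 rfl
  refine Hoare.ens (Q := fun s' => (s'.rreg 5 = s.rreg 5 + 1 ∧ arr s' 1 = arr s 1) ∧
    vec n s' 0 = fun v => vec n s 0 v + adjQuery G v (s1.nreg 8) * s.rreg 6) ?_
    (fun s' h => by rw [h.2]) |>.mono le_rfl (fun s' h => h.1) le_rfl fun _ _ => le_rfl
  refine Hoare.comp (Q := fun s' => s'.nreg 1 = 0) 3 (40 * n + 12) (by omega)
    (Hoare.line rfl (by decide) (by simp)) ?_
  intro s2 b1 ha2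
  have hs2 := hs1.agree ha2 rfl
  refine Hoare.comp (40 * n + 1) 3 (by omega) (addLoop_spec (G := G) hs2 b1) ?_
  rintro s3 ⟨c0, c1⟩ ha3
  have hs3 := hs2.agree ha3 rfl
  refine (Hoare.line (Q := fun s' => s'.rreg 5 = s.rreg 5 + 1) rfl (by decide) ?_).frame.mono
    le_rfl ?_
  · simp [hs3.r20, ha3.rreg 5 rfl, ha2.rreg 5 rfl, ha1.rreg 5 rfl]
  · rintro s4 ⟨d5, ha4⟩
    refine ⟨⟨d5, ?_⟩, ?_⟩
    · funext u
      rw [ha4.arr_eq rfl, c1, ha2.arr_eq rfl, ha1.arr_eq rfl]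
    · funext v
      rw [vec, ha4.arr_eq rfl, c0 v v.2, ha2.arr_eq rfl, ha1.arr_eq rfl, ha2.nreg 8 rfl,
        ha2.rreg 6 rfl, ha1.rreg 6 rfl]
      rfl

/-- The invariant expectation is the average of F over the draws that are still to come; when none
are left it is F itself. -/
theorem sampleLoop_spec {ε c : ℝ} {s : Store} {m : ℕ} (hs : Consts n ε c s) (hn : 0 < n)
    (h4 : s.rreg 4 = m) (h5 : s.rreg 5 = 0) (F : (Fin n → ℝ) → ℝ≥0∞) :
    Ens G sampleLoop s (m * (40 * n + 21) + 1) (fun s' => arr s' 1 = arr s 1)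
      (sampleAvg G F (s.rreg 6) m (vec n s 0)) (fun s' => F (vec n s' 0)) := by
  refine (Ens.loop (N := m) (T := 40 * n + 20)
    (fun i s' => s'.rreg 5 = i ∧ arr s' 1 = arr s 1)
    (fun i s' => sampleAvg G F (s.rreg 6) (m - i) (vec n s' 0)) ⟨by simpa, rfl⟩ ?_ ?_).mono
    le_rfl (fun s' h => h.1.2) le_rfl fun s' _ => ?_
  · rintro i s1 hi ha1 ⟨g5, g1⟩
    have hs1 := hs.agree ha1 rfl
    refine ⟨?_, ?_⟩
    · simp only [Test.holds, g5, ha1.rreg 4 rfl, h4]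
      exact_mod_cast hi
    · have e : m - i = (m - (i + 1)) + 1 := by omega
      have := sampleBody_spec (G := G) hs1 hn F (m - (i + 1))
      rw [← e, ha1.rreg 6 rfl] at this
      refine this.mono le_rfl (fun s' h => ⟨?_, h.2.trans g1⟩) le_rfl fun _ _ => le_rfl
      rw [h.1, g5]
      push_cast
      ring
  · rintro s1 ha1 ⟨g5, -⟩
    simp only [Test.holds, g5, ha1.rreg 4 rfl, h4, lt_irrefl, not_false_eq_true]
  · rw [Nat.sub_self, sampleAvg_zero]

open Classical in
-- Condition on the coin of v: by independence, fixing its outcome amounts to replacing its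
-- probability by 1 or 0.
theorem roundSet_split {V : Type} [Fintype V] (x : V → ℝ) (v : V) (S : Finset V) :
    roundSet x S = clamp (x v) * roundSet (Function.update x v 1) S +
      (1 - clamp (x v)) * roundSet (Function.update x v 0) S := by
  have c1 : clamp 1 = 1 := by simp [clamp]
  have c0 : clamp 0 = 0 := by simp [clamp]
  rw [roundSet_apply, roundSet_apply, roundSet_apply]
  by_cases hv : v ∈ S
  · have e : ∀ y : ℝ, (∏ u ∈ S, clamp (Function.update x v y u)) *
        ∏ u ∈ Finset.univ \ S, (1 - clamp (Function.update x v y u)) =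
        clamp y * ((∏ u ∈ S.erase v, clamp (x u)) * ∏ u ∈ Finset.univ \ S, (1 - clamp (x u))) := by
      intro y
      rw [← Finset.mul_prod_erase _ _ hv, Function.update_self, mul_assoc]
      congr 2
      · refine Finset.prod_congr rfl fun u hu => ?_
        rw [Function.update_of_ne (Finset.ne_of_mem_erase hu)]
      · refine Finset.prod_congr rfl fun u hu => ?_
        rw [Function.update_of_ne]
        rintro rfl
        exact (Finset.mem_sdiff.1 hu).2 hv
    rw [e 1, e 0, c1, c0, ← Finset.mul_prod_erase _ _ hv]
    ring
  · have hv' : v ∈ Finset.univ \ S := by simp [hv]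
    have e : ∀ y : ℝ, (∏ u ∈ S, clamp (Function.update x v y u)) *
        ∏ u ∈ Finset.univ \ S, (1 - clamp (Function.update x v y u)) =
        (1 - clamp y) * ((∏ u ∈ S, clamp (x u)) *
          ∏ u ∈ (Finset.univ \ S).erase v, (1 - clamp (x u))) := by
      intro y
      rw [← Finset.mul_prod_erase _ _ hv', Function.update_self, mul_left_comm]
      congr 2
      · refine Finset.prod_congr rfl fun u hu => ?_
        rw [Function.update_of_ne]
        rintro rfl
        exact hv hu
      · refine Finset.prod_congr rfl fun u hu => ?_
        rw [Function.update_of_ne (Finset.ne_of_mem_erase hu)]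
    rw [e 1, e 0, c1, c0, ← Finset.mul_prod_erase _ _ hv']
    simp only [tsub_self, tsub_zero]
    ring

open Classical in
theorem ev_roundSet_split {V : Type} [Fintype V] (x : V → ℝ) (v : V) (F : Finset V → ℝ≥0∞) :
    ev (roundSet x) F = clamp (x v) * ev (roundSet (Function.update x v 1)) F +
      (1 - clamp (x v)) * ev (roundSet (Function.update x v 0)) F := by
  simp only [ev_fintype, Finset.mul_sum]
  rw [← Finset.sum_add_distrib]
  refine Finset.sum_congr rfl fun S _ => ?_
  rw [roundSet_split x v S]
  ring

open Classical in
theorem ev_roundSet_integral {V : Type} [Fintype V] {x : V → ℝ} (hx : ∀ v, x v = 0 ∨ x v = 1)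
    (F : Finset V → ℝ≥0∞) :
    ev (roundSet x) F = F (Finset.univ.filter fun v => 0 < x v) := by
  have c1 : clamp 1 = 1 := by simp [clamp]
  have c0 : clamp 0 = 0 := by simp [clamp]
  rw [ev_fintype, Finset.sum_eq_single (Finset.univ.filter fun v => 0 < x v)]
  · rw [roundSet_apply, Finset.prod_eq_one, Finset.prod_eq_one, one_mul, one_mul]
    · intro v hv
      rcases hx v with h | h
      · rw [h, c0, tsub_zero]
      · simp [h] at hv
    · intro v hv
      rcases hx v with h | h
      · simp [h] at hv
      · rw [h, c1]
  · intro S _ hS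
    have : ∃ v, ¬ (v ∈ S ↔ 0 < x v) := by
      by_contra hcon
      push Not at hcon
      exact hS (Finset.ext fun v => by simp [hcon v])
    obtain ⟨v, hv⟩ := this
    rw [roundSet_apply]
    by_cases hvS : v ∈ S
    · rcases hx v with h | h
      · rw [Finset.prod_eq_zero hvS (by rw [h, c0]), zero_mul, zero_mul]
      · simp [hvS, h] at hv
    · rcases hx v with h | h
      · simp [hvS, h] at hv
      · rw [Finset.prod_eq_zero (i := v) (s := Finset.univ \ S) (by simp [hvS])
          (by rw [h, c1, tsub_self]), mul_zero, zero_mul]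
  · simp

/-- Round the fractional solution. -/
def roundLoop : Prog :=
  .loop (.lt 1 0)
    (.seq (blk (ldCode 15 1 1 ++ []))
      (.seq (.instr (.flip 15 15)) (blk (.cast 16 15 :: (stCode 1 1 16 ++ [.add 1 1 2])))))

/-- The array is rounded in place. Rounding what is still fractional keeps the expectation
throughout, and an integral vector rounds to its own support. -/
theorem roundLoop_spec {ε c : ℝ} {s : Store} (hs : Consts n ε c s) (h1 : s.nreg 1 = 0)
    (F : Finset (Fin n) → ℝ≥0∞) :
    Ens G roundLoop s (31 * n + 1) (fun s' => ∀ v < n, arr s' 1 v = 0 ∨ arr s' 1 v = 1)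
      (ev (roundSet (vec n s 1)) F) (fun s' => F (posSet n (arr s' 1))) := by
  refine (Ens.loop (N := n) (T := 30)
    (fun i s' => s'.nreg 1 = i ∧ ∀ v < i, arr s' 1 v = 0 ∨ arr s' 1 v = 1)
    (fun i s' => ev (roundSet (vec n s' 1)) F) ⟨h1, by simp⟩ ?_ ?_).mono
    (by omega) (fun s' h => h.1.2) le_rfl fun s' h => ?_
  · rintro i s1 hi ha1 ⟨g1, g2⟩
    have hs1 := hs.agree ha1 rfl
    refine ⟨by simp only [Test.holds, g1, hs1.n0, hi], ?_⟩
    refine Hoare.comp_ens (Q := fun s' => s'.rreg 15 = arr s1 1 i) 11 18 (by omega)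
      (Hoare.line rfl (by decide) (by rw [blkDet_ldCode]; simp [g1])) ?_
    intro s2 b15 ha2
    have hs2 := hs1.agree ha2 rfl
    have b1 : s2.nreg 1 = i := (ha2.nreg 1 rfl).trans g1
    have hx2 : ∀ v, s2.rmem (adr 1 v) = arr s1 1 v := fun v => ha2.arr_eq rfl 1 v
    refine Ens.comp (Q := fun s' => s'.nreg 15 = 0 ∨ s'.nreg 15 = 1) 1 15 (fun s' =>
      ev (roundSet (Function.update (vec n s1 1) ⟨i, hi⟩ (s'.nreg 15))) F)
      (by omega) (Ens.flip (by simp) (by simp) ?_) ?_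
    · refine le_of_eq ((ev_roundSet_split (vec n s1 1) ⟨i, hi⟩ F).trans ?_)
      rw [b15]
      simp only [Store.setN, Function.update_self, Nat.cast_one, Nat.cast_zero]
      congr!
    · intro s3 c15 ha3
      have hs3 := hs2.agree ha3 rfl
      have c1 : s3.nreg 1 = i := (ha3.nreg 1 rfl).trans b1
      have hx3 : ∀ v, s3.rmem (adr 1 v) = arr s1 1 v := fun v => by
        rw [ha3.rmem rfl, hx2]
      refine Hoare.ens (Q := fun s' => (s'.nreg 1 = i + 1 ∧ ∀ v < i + 1, arr s' 1 v = 0 ∨ arr s' 1 v = 1) ∧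
        vec n s' 1 = Function.update (vec n s1 1) ⟨i, hi⟩ (s3.nreg 15)) ?_
        (fun s' h => by rw [h.2]) |>.mono le_rfl (fun s' h => h.1) le_rfl fun _ _ => le_rfl
      refine Hoare.line rfl (by decide) ?_
      rw [blkDet, blkDet_stCode]
      have e : ∀ v, arr (blkDet G [.add 1 1 2]
          { (((Instr.cast 16 15).det G s3).setN 4
              (adr 1 (((Instr.cast 16 15).det G s3).nreg 1))).setN 5 1 with
            rmem := Function.update ((Instr.cast 16 15).det G s3).rmem
              (adr 1 (((Instr.cast 16 15).det G s3).nreg 1))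
              (((Instr.cast 16 15).det G s3).rreg 16) }) 1 v =
          Function.update s3.rmem (adr 1 i) (s3.nreg 15 : ℝ) (adr 1 v) := by
        intro v
        rw [← c1]
        rfl
      refine ⟨⟨by simp [c1, hs3.n2], fun v hv => ?_⟩, ?_⟩
      · rw [e]
        rcases Nat.lt_succ_iff_lt_or_eq.1 hv with hv | rfl
        · rw [update_adr_of_ne _ _ (by norm_num) hv.ne, hx3]
          exact g2 v hv
        · rw [update_adr_self]
          rcases c15 with h | h <;> simp [h]
      · funext v
        rw [vec, e]
        by_cases hv : v = ⟨i, hi⟩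
        · subst hv
          rw [update_adr_self, Function.update_self]
        · rw [update_adr_of_ne _ _ (by norm_num) (fun h => hv (Fin.ext h)), hx3,
            Function.update_of_ne hv]
          rfl
  · rintro s' ha ⟨g1, -⟩
    have hc := hs.agree ha rfl
    simp [Test.holds, g1, hc.n0]
  · refine le_of_eq ((ev_roundSet_integral (x := vec n s' 1) (fun v => h.1.2 v v.2) F).trans
      (congrArg F ?_))
    ext v
    rw [mem_posSet, Finset.mem_filter]
    simp [vec]

/-- Clear the arrays. -/
def clearLoop : Prog :=
  .loop (.lt 1 0) (blk (stCode 1 0 11 ++ (stCode 1 1 11 ++ [.add 1 1 2])))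

theorem clearLoop_spec {ε c : ℝ} {s : Store} (hs : Consts n ε c s) (h1 : s.nreg 1 = 0) :
    Hoare G clearLoop s (30 * n + 1) (fun s' => ∀ u < n, arr s' 0 u = 0 ∧ arr s' 1 u = 0) := by
  refine (Hoare.loop (N := n) (T := 29) (fun i s' => s'.nreg 1 = i ∧
    ∀ u < i, arr s' 0 u = 0 ∧ arr s' 1 u = 0) ⟨h1, by simp⟩ ?_ ?_).mono (by omega)
      fun s' h => h.1.2
  · rintro i s1 hi ha1 ⟨g1, g2⟩
    have hs1 := hs.agree ha1 rfl
    refine ⟨by simp only [Test.holds, g1, hs1.n0, hi], Hoare.line rfl (by decide) ?_⟩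
    rw [blkDet_stCode, blkDet_stCode]
    set s2 := blkDet G [.add 1 1 2] _ with hs2
    have e : ∀ j u, arr s2 j u = Function.update (Function.update s1.rmem (adr 0 i) 0)
        (adr 1 i) 0 (adr j u) := by
      intro j u
      rw [← g1, ← hs1.r11]
      rfl
    refine ⟨by simp [hs2, g1, hs1.n2], fun u hu => ?_⟩
    rw [e, e]
    rw [update_adr_of_ne_idx _ _ (by norm_num) (by norm_num) (by norm_num)]
    rcases Nat.lt_succ_iff_lt_or_eq.1 hu with hu | rfl
    · rw [update_adr_of_ne _ _ (by norm_num) hu.ne, update_adr_of_ne _ _ (by norm_num) hu.ne,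
        update_adr_of_ne_idx _ _ (by norm_num) (by norm_num) (by norm_num)]
      exact g2 u hu
    · rw [update_adr_self, update_adr_self]
      exact ⟨rfl, rfl⟩
  · rintro s' ha ⟨g1, -⟩
    have hc := hs.agree ha rfl
    simp [Test.holds, g1, hc.n0]

/-! ### Enumeration of all sets -/

/-- The number whose binary digits stand in `x`. -/
noncomputable def binVal (x : ℕ → ℝ) (i : ℕ) : ℕ :=
  ∑ v ∈ Finset.range i, open Classical in if 0 < x v then 2 ^ v else 0

theorem binVal_succ (x : ℕ → ℝ) (i : ℕ) :
    binVal x (i + 1) = binVal x i + open Classical in if 0 < x i then 2 ^ i else 0 :=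
  Finset.sum_range_succ _ _

theorem binVal_congr {x y : ℕ → ℝ} {i : ℕ} (h : ∀ v < i, x v = y v) : binVal x i = binVal y i :=
  Finset.sum_congr rfl fun v hv => by rw [h v (Finset.mem_range.1 hv)]

theorem binVal_lt (x : ℕ → ℝ) (i : ℕ) : binVal x i < 2 ^ i := by
  induction i with
  | zero => simp [binVal]
  | succ i ih =>
    rw [binVal_succ, pow_succ]
    split_ifs <;> omega

/-- Proceed to the next set. -/
def nextProg : Prog :=
  .seq (blk [.const 1 0, .const 10 1])
    (.loop (.lt 1 0)
      (.seq (blk (ldCode 15 1 1 ++ [.const 15 0]))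
        (.seq
          (.ite (.lt 15 10)
            (.ite (.rlt 11 15) (blk (stCode 1 1 11 ++ [])) (blk (stCode 1 1 20 ++ [.const 10 0])))
            (blk []))
          (blk [.add 1 1 2]))))

/-- Binary increment with the carry in register 10: below digit i, the new value plus carry times
2^i is the old value plus one. The carry out of the last digit is lost, hence the condition. -/
theorem nextProg_spec {ε c : ℝ} {s : Store} (hs : Consts n ε c s)
    (hx : ∀ v < n, arr s 1 v = 0 ∨ arr s 1 v = 1) :
    Hoare G nextProg s (40 * n + 10) (fun s' => (∀ v < n, arr s' 1 v = 0 ∨ arr s' 1 v = 1) ∧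
      (binVal (arr s 1) n + 1 < 2 ^ n → binVal (arr s' 1) n = binVal (arr s 1) n + 1)) := by
  refine Hoare.comp (Q := fun s' => s'.nreg 1 = 0 ∧ s'.nreg 10 = 1) 5 (40 * n + 1) (by omega)
    (Hoare.line rfl (by decide) (by simp)) ?_
  rintro s1 ⟨a1, a10⟩ ha1
  have hs1 := hs.agree ha1 rfl
  have hx1 : arr s1 1 = arr s 1 := funext fun v => ha1.arr_eq rfl 1 v
  refine (Hoare.loop (N := n) (T := 39) (fun i s' => s'.nreg 1 = i ∧ s'.nreg 10 ≤ 1 ∧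
    (∀ v < n, arr s' 1 v = 0 ∨ arr s' 1 v = 1) ∧ (∀ v, i ≤ v → arr s' 1 v = arr s 1 v) ∧
    binVal (arr s' 1) i + s'.nreg 10 * 2 ^ i = binVal (arr s 1) i + 1)
    ⟨a1, a10.le, by rwa [hx1], fun _ _ => by rw [hx1], by simp [binVal, a10]⟩ ?_ ?_).mono
      (by omega) ?_
  · rintro i s2 hi ha2 ⟨g1, g10, g2, g3, g4⟩
    have hs2 := hs1.agree ha2 rfl
    refine ⟨by simp only [Test.holds, g1, hs2.n0, hi], ?_⟩
    refine Hoare.comp (Q := fun s' => s'.rreg 15 = arr s 1 i ∧ s'.nreg 15 = 0) 13 25 (by omega)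
      (Hoare.line rfl (by decide) (by rw [blkDet_ldCode]; simp [g1, g3])) ?_
    rintro s3 ⟨b15, n15⟩ ha3
    have hs3 := hs2.agree ha3 rfl
    have b1 : s3.nreg 1 = i := (ha3.nreg 1 rfl).trans g1
    have b10 : s3.nreg 10 = s2.nreg 10 := ha3.nreg 10 rfl
    have hx3 : ∀ v, s3.rmem (adr 1 v) = arr s2 1 v := fun v => ha3.arr_eq rfl 1 v
    have upd : ∀ y : ℝ, y = 0 ∨ y = 1 → ∀ s' : Store,
        (∀ v, arr s' 1 v = Function.update s3.rmem (adr 1 i) y (adr 1 v)) →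
        (∀ v < n, arr s' 1 v = 0 ∨ arr s' 1 v = 1) ∧
        (∀ v, i + 1 ≤ v → arr s' 1 v = arr s 1 v) ∧ arr s' 1 i = y ∧
        binVal (arr s' 1) i = binVal (arr s2 1) i := by
      intro y hy s' h
      have hne : ∀ v, v ≠ i → arr s' 1 v = arr s2 1 v := fun v hv => by
        rw [h, update_adr_of_ne _ _ (by norm_num) hv, hx3]
      have heq : arr s' 1 i = y := by rw [h, update_adr_self]
      refine ⟨fun v hv => ?_, fun v hv => ?_, heq, binVal_congr fun v hv => hne v hv.ne⟩
      · by_cases hvi : v = i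
        · rw [hvi, heq]; exact hy
        · rw [hne v hvi]; exact g2 v hv
      · rw [hne v (by omega), g3 v (by omega)]
    refine Hoare.comp (Q := fun s' => Consts n ε c s' ∧ s'.nreg 1 = i ∧ s'.nreg 10 ≤ 1 ∧
      (∀ v < n, arr s' 1 v = 0 ∨ arr s' 1 v = 1) ∧
      (∀ v, i + 1 ≤ v → arr s' 1 v = arr s 1 v) ∧
      binVal (arr s' 1) (i + 1) + s'.nreg 10 * 2 ^ (i + 1) = binVal (arr s 1) (i + 1) + 1)
      20 4 (by omega) ?_ ?_
    · have key : ∀ p : Prog, p.keepsConsts = true → p.wn 1 = false → ∀ T R,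
          Hoare G p s3 T R → Hoare G p s3 T fun s' => Consts n ε c s' ∧ s'.nreg 1 = i ∧ R s' :=
        fun p h1 h2 T R h => h.frame.mono le_rfl fun s' h' =>
          ⟨hs3.agree h'.2 h1, by rw [h'.2.nreg 1 h2, b1], h'.1⟩
      refine key _ rfl rfl _ _ ?_
      refine Hoare.branch 19 (by omega) (fun t => ?_) fun t => ?_
      all_goals simp only [Test.holds, n15, b10] at t
      · have h10 : s2.nreg 10 = 1 := by omega
        rw [h10] at g4
        refine Hoare.branch 18 (by omega) (fun t' => Hoare.line rfl (by decide) ?_)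
          fun t' => Hoare.line rfl (by decide) ?_
        all_goals
          simp only [Test.holds, hs3.r11, b15] at t'
          rw [blkDet_stCode]
        · obtain ⟨u1, u2, u3, u4⟩ := upd 0 (Or.inl rfl) (blkDet G [] { ((s3.setN 4
              (adr 1 (s3.nreg 1))).setN 5 1) with
                rmem := Function.update s3.rmem (adr 1 (s3.nreg 1)) (s3.rreg 11) })
            (fun v => by rw [b1, hs3.r11]; rfl)
          refine ⟨by simp [b10, h10], u1, u2, ?_⟩
          rw [binVal_succ, u3, u4, if_neg (lt_irrefl _), binVal_succ, if_pos t', pow_succ]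
          simp [b10, h10]
          omega
        · obtain ⟨u1, u2, u3, u4⟩ := upd 1 (Or.inr rfl) (blkDet G [.const 10 0] { ((s3.setN 4
              (adr 1 (s3.nreg 1))).setN 5 1) with
                rmem := Function.update s3.rmem (adr 1 (s3.nreg 1)) (s3.rreg 20) })
            (fun v => by rw [b1, hs3.r20]; rfl)
          refine ⟨by simp, u1, u2, ?_⟩
          rw [binVal_succ, u3, u4, if_pos one_pos, binVal_succ, if_neg t']
          simp
          omega
      · have h10 : s2.nreg 10 = 0 := by omega
        rw [h10] at g4
        refine Hoare.line rfl (by decide) ?_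
        have hx4 : arr (blkDet G [] s3) 1 = arr s2 1 := funext hx3
        rw [hx4]
        refine ⟨by simp [b10, h10], g2, fun v hv => g3 v (by omega), ?_⟩
        rw [binVal_succ, binVal_succ, g3 i le_rfl]
        simp [b10, h10]
        omega
    · rintro s4 ⟨hs4, d1, d⟩ ha4
      refine Hoare.line rfl (by decide) ?_
      have e : arr (blkDet G [.add 1 1 2] s4) 1 = arr s4 1 := rfl
      rw [e]
      refine ⟨by simp [d1, hs4.n2], ?_⟩
      simpa using d
  · rintro s' ha ⟨g1, -⟩
    have hc := hs1.agree ha rfl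
    simp [Test.holds, g1, hc.n0]
  · rintro s' ⟨⟨-, h10, h2, -, h4⟩, -⟩
    refine ⟨h2, fun hlt => ?_⟩
    have h0 : s'.nreg 10 = 0 := by
      by_contra hne
      have : s'.nreg 10 = 1 := by omega
      rw [this] at h4
      omega
    rw [h0] at h4
    omega

/-- The code of a set. -/
def setCode (S : Finset (Fin n)) : ℕ := ∑ v ∈ S, 2 ^ (v : ℕ)

theorem setCode_injective : Function.Injective (setCode (n := n)) := by
  intro S T h
  have h1 : ∀ S : Finset (Fin n), setCode S = ∑ i ∈ S.map Fin.valEmbedding, 2 ^ i := fun S => by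
    rw [Finset.sum_map]; rfl
  rw [h1, h1] at h
  exact Finset.map_injective _ (Finset.geomSum_injective le_rfl h)

theorem setCode_posSet (x : ℕ → ℝ) : setCode (posSet n x) = binVal x n := by
  rw [setCode, posSet, Finset.sum_filter, binVal, Finset.sum_range]

theorem setCode_lt (S : Finset (Fin n)) : setCode S < 2 ^ n := by
  classical
  have : posSet n (fun v => if ∃ u ∈ S, (u : ℕ) = v then 1 else 0) = S := by
    ext v
    rw [mem_posSet]
    constructor
    · intro h
      by_contra hv
      rw [if_neg] at h
      · exact lt_irrefl _ h
      · rintro ⟨u, hu, huv⟩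
        exact hv (Fin.ext huv ▸ hu)
    · intro hv
      rw [if_pos ⟨v, hv, rfl⟩]
      exact one_pos
  rw [← this, setCode_posSet]
  exact binVal_lt _ _

end

end UGSC

namespace UGSC

/-! ### One iteration of the machine -/

section

variable {n : ℕ} {G : SimpleGraph (Fin n)}

theorem sum_rowCoef_indicator (ε : ℝ) (d : ℕ → ℝ) (K : Finset (Fin n)) (j : ℕ) {z : ℕ → ℝ}
    (hz : ∀ v : Fin n, z v = open Classical in if v ∈ K then 1 else 0) :
    ∑ u ∈ Finset.range n, rowCoef G ε d j u * z u = ∑ v ∈ K, rowCoef G ε d j v := by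
  classical
  rw [Finset.sum_range]
  simp only [hz, mul_ite, mul_one, mul_zero]
  rw [Finset.sum_ite_mem, Finset.univ_inter]

theorem exists_indicator (K : Finset (Fin n)) : ∃ z : ℕ → ℝ,
    (∀ v : Fin n, z v = open Classical in if v ∈ K then 1 else 0) ∧
    ∀ u < n, 0 ≤ z u ∧ z u ≤ 1 := by
  classical
  have h : ∀ v : Fin n, (if ∃ w ∈ K, (w : ℕ) = v then (1 : ℝ) else 0) = if v ∈ K then 1 else 0 := by
    intro v
    congr 1
    rw [eq_iff_iff]
    exact ⟨fun ⟨w, hw, e⟩ => Fin.ext e ▸ hw, fun hv => ⟨v, hv, rfl⟩⟩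
  refine ⟨fun u => if ∃ w ∈ K, (w : ℕ) = u then 1 else 0, fun v => ?_, fun u _ => ?_⟩
  · convert h v
  · dsimp only
    split_ifs <;> norm_num

/-- The indicator of a core solves the linear program. -/
theorem rowFeasible_core {ε : ℝ} {K : Finset (Fin n)} {d : ℕ → ℝ} {r₁ r₂ : ℕ} (hε : 0 < ε)
    (hε1 : ε ≤ 1 / 7) (hn : 0 < n) (hK : ∀ v ∈ K, ε * n / 3 ≤ degIn G K v)
    (hd : ∀ v : Fin n, |d v - degIn G K v| ≤ ε ^ 2 / 5 * n)
    (h₁ : r₁ * (n : ℝ) ≤ 2 * (1 - ε) * edgesIn G K) (h₂ : invDegSum G K ≤ r₂ * ((1 - ε) * ε)) :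
    ∃ z, RowFeasible G ε d r₁ r₂ z := by
  classical
  obtain ⟨z, hz, hz01⟩ := exists_indicator K
  have hN : 0 < (n : ℝ) := by exact_mod_cast hn
  have hεN : 0 < ε * n := by positivity
  have hge : ∀ v ∈ K, ε * n / 4 ≤ d v := by
    intro v hv
    have h1 := (est_bounds hε (hd v) (by linarith [hK v hv])).1
    nlinarith [hK v hv]
  have hdeg : ∀ v : Fin n, (degIn G K v : ℝ) ≤ n := fun v => by
    have h1 := degIn_le_card G K v
    have h2 := Finset.card_le_univ K
    rw [Fintype.card_fin] at h2
    exact_mod_cast h1.trans h2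
  have hle : ∀ v : Fin n, d v ≤ 2 * n := fun v => est_le_two_mul hε hN.le hε1 (hd v) (hdeg v)
  refine ⟨z, hz01, ?_, ?_⟩
  · intro j _ u hu
    rw [rowCoef]
    split_ifs with h1 h2 h3
    · simp
    · have := hle ⟨u, hu⟩
      rw [abs_of_nonneg (div_nonneg (by push Not at h1; linarith) hN.le), div_le_iff₀ hN]
      exact this
    · push Not at h1
      have h0 : 0 < d u := by linarith
      rw [abs_neg, abs_of_nonneg (by positivity), div_le_iff₀ h0]
      linarith
    · unfold adjQuery
      split_ifs <;> norm_num
  · intro j hj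
    rw [sum_rowCoef_indicator ε d K j hz, rowRhs]
    split_ifs with h1 h2 h3
    · have : ∑ v ∈ K, rowCoef G ε d j v = (∑ v ∈ K, d v) / n := by
        rw [Finset.sum_div]
        refine Finset.sum_congr rfl fun v hv => ?_
        rw [rowCoef, if_neg (not_lt.2 (hge v hv)), if_pos h1]
      rw [this, le_div_iff₀ hN]
      refine h₁.trans (le_sum_est (d := fun v : Fin n => d v) hε ?_ ?_)
      · simpa using hK
      · simpa using hd
    · have : ∑ v ∈ K, rowCoef G ε d j v = -(ε * n / 4 * ∑ v ∈ K, 1 / d v) := by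
        rw [Finset.mul_sum, ← Finset.sum_neg_distrib]
        refine Finset.sum_congr rfl fun v hv => ?_
        rw [rowCoef, if_neg (not_lt.2 (hge v hv)), if_neg h1, if_pos h2, mul_one_div]
      have h4 := sum_inv_est_le (G := G) (K := K) (d := fun v : Fin n => d v) hε hε1
        (by simpa using hn) (by simpa using hK) (by simpa using hd)
      rw [this]
      -- The factor 1 - ε lost to the estimates was already built into the condition on r₂.
      have h5 : ∑ v ∈ K, 1 / d v ≤ r₂ * ε := by
        have : 0 < 1 - ε := by linarith
        nlinarith
      nlinarith
    · refine Finset.sum_nonneg fun v hv => ?_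
      rw [rowCoef, if_neg (not_lt.2 (hge v hv)), if_neg h1, if_neg h2]
      positivity
    · set v : Fin n := ⟨j - 2, by omega⟩ with hv
      push Not at h3
      have h4 := (est_bounds hε (hd v) (est_deg_ge hε hN.le hε1 (hd v) h3)).2
      have h5 : ∑ u ∈ K, rowCoef G ε d j u = degIn G K v := by
        rw [degIn_eq_sum]
        push_cast
        refine Finset.sum_congr rfl fun u hu => ?_
        rw [rowCoef, if_neg (not_lt.2 (hge u hu)), if_neg h1, if_neg h2,
          show j - 2 = (v : ℕ) from rfl, adjQuery_fin]
        push_cast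
        congr 1
      rw [h5]
      have h6 : (0 : ℝ) ≤ degIn G K v := Nat.cast_nonneg _
      -- The row uses 1 - ε in place of 1 / (1 + ε); this is safe since (1 - ε)(1 + ε) ≤ 1.
      change (1 - ε) * d v ≤ _
      nlinarith [mul_nonneg (sq_nonneg ε) h6]

open Classical in
/-- An approximate solution of the linear program is a good fractional solution. -/
theorem fracGood_of_rows {c ε : ℝ} {K : Finset (Fin n)} {d x : ℕ → ℝ} {r₁ r₂ : ℕ} (hc : 0 < c)
    (hε : 0 < ε) (hε1 : ε ≤ 1 / 7) (hn : 1 ≤ ε * n) (hK : IsOptCore G c ε K) (hKne : K.Nonempty)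
    (hd : ∀ v : Fin n, |d v - degIn G K v| ≤ ε ^ 2 / 5 * n)
    (h₁ : 2 * (1 - ε) * edgesIn G K ≤ (r₁ + 1) * (n : ℝ))
    (h₂ : (r₂ : ℝ) * ((1 - ε) * ε) ≤ invDegSum G K + (1 - ε) * ε)
    (hx : ∀ u < n, 0 ≤ x u ∧ x u ≤ 1) (hout : ∀ u < n, d u < ε * n / 4 → x u = 0)
    (hrows : ∀ j < n + 2, rowRhs n ε d r₁ r₂ j - ε ^ 2 * n / 8 ≤
      ∑ u ∈ Finset.range n, rowCoef G ε d j u * x u) :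
    FracGood G c ε K (Finset.univ.filter fun v : Fin n => ε * n / 4 ≤ d v) (fun v => d v)
      (fun v => x v) := by
  have hN : 0 < (n : ℝ) := by
    by_contra h
    nlinarith
  have hεN : 0 < ε * n := by positivity
  have hcard : Fintype.card (Fin n) = n := Fintype.card_fin n
  have hn0 : 0 < n := by exact_mod_cast hN
  have hn2 : 2 ≤ Fintype.card (Fin n) := by
    have : (2 : ℝ) ≤ n := by nlinarith
    rw [hcard]
    exact_mod_cast this
  set H := Finset.univ.filter fun v : Fin n => ε * n / 4 ≤ d v with hH
  have hmem : ∀ v, v ∈ H ↔ ε * n / 4 ≤ d v := fun v => by simp [hH]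
  have hdeg : ∀ v : Fin n, (degIn G K v : ℝ) ≤ n := fun v => by
    have h1 := degIn_le_card G K v
    have h2 := Finset.card_le_univ K
    rw [Fintype.card_fin] at h2
    exact_mod_cast h1.trans h2
  have hsum : ∀ j, ∑ u ∈ Finset.range n, rowCoef G ε d j u * x u =
      ∑ v ∈ H, rowCoef G ε d j v * x v := by
    intro j
    rw [Finset.sum_range, hH, Finset.sum_filter]
    refine Finset.sum_congr rfl fun v _ => ?_
    split_ifs with h
    · rfl
    · rw [hout v v.2 (not_le.1 h), mul_zero]
  refine ⟨fun v => hx v v.2, fun v hv => hout v v.2 ?_, fun v hv => ?_, fun v _ => ?_,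
    fun v hv => ?_, ?_, ?_⟩
  · rwa [hmem, not_le] at hv
  · rw [hcard]
    exact (hmem v).1 hv
  · rw [hcard]
    exact est_le_two_mul hε hN.le hε1 (hd v) (hdeg v)
  · have h := hrows (v + 2) (by omega)
    have hv' := (hmem v).1 hv
    rw [hsum, rowRhs, if_neg (by omega), if_neg (by omega), Nat.add_sub_cancel,
      if_neg (not_lt.2 hv')] at h
    have e : ∑ u ∈ H, rowCoef G ε d (v + 2) u * x u = ∑ u ∈ H.filter (fun u => G.Adj v u), x u := by
      refine Eq.trans ?_ (Finset.sum_filter _ _).symm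
      refine Finset.sum_congr rfl fun u hu => ?_
      rw [rowCoef, if_neg (not_lt.2 ((hmem u).1 hu)), if_neg (by omega), if_neg (by omega),
        Nat.add_sub_cancel, adjQuery_fin]
      split_ifs <;> simp
    rw [e] at h
    -- On H the tolerance ε²n/8 is at most ε d(v) / 2, which takes 1 - ε to no less than 1 - 2ε.
    nlinarith
  · have h := hrows 0 (by omega)
    rw [hsum, rowRhs, if_pos (by omega)] at h
    have e : ∑ u ∈ H, rowCoef G ε d 0 u * x u = (∑ u ∈ H, d u * x u) / n := by
      rw [Finset.sum_div]
      refine Finset.sum_congr rfl fun u hu => ?_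
      rw [rowCoef, if_neg (not_lt.2 ((hmem u).1 hu)), if_pos (by omega)]
      ring
    rw [e, le_div_iff₀ hN] at h
    have hE := edgesIn_le_edgeMax G K
    have hE2 := two_edgeMax_le (V := Fin n)
    rw [hcard] at hE2 ⊢
    have h3 : ε * (2 * (edgesIn G K : ℝ)) ≤ ε * (n : ℝ) ^ 2 :=
      mul_le_mul_of_nonneg_left (by linarith) hε.le
    -- The edge bound is guessed only up to a multiple of n; this error fits because εn ≥ 1.
    have h4 : (n : ℝ) ≤ ε * n ^ 2 := by nlinarith
    have h5 : ε ^ 2 * n / 8 * n ≤ ε * n ^ 2 := by nlinarith [mul_nonneg hε.le (sq_nonneg (n : ℝ))]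
    nlinarith
  · have h := hrows 1 (by omega)
    rw [hsum, rowRhs, if_neg (by omega), if_pos (by omega)] at h
    have e : ∑ u ∈ H, rowCoef G ε d 1 u * x u = -(ε * n / 4 * ∑ u ∈ H, 1 / d u * x u) := by
      rw [Finset.mul_sum, ← Finset.sum_neg_distrib]
      refine Finset.sum_congr rfl fun u hu => ?_
      rw [rowCoef, if_neg (not_lt.2 ((hmem u).1 hu)), if_neg (by omega), if_pos (by omega)]
      ring
    rw [e] at h
    set X := ∑ u ∈ H, 1 / d u * x u with hX
    -- After undoing the scaling by εn/4, the tolerance ε²n/8 reads ε/2.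
    have h3 : X ≤ r₂ * ε + ε / 2 := by
      have : ε * n / 4 * X ≤ ε * n / 4 * (r₂ * ε + ε / 2) := by linarith
      exact le_of_mul_le_mul_left this (by positivity)
    have hE0 : 0 < edgeMax (Fin n) := by
      have := edgeMax_ge hn2
      rw [hcard] at this
      nlinarith
    have hcE : 0 < c * edgeMax (Fin n) := by positivity
    have hh := one_le_invDegSum G hKne (hK.deg_pos hε (by omega))
    set h' := invDegSum G K
    have hcost := hK.cost_le
    have hcE1 : c * edgeMax (Fin n) ≤ 1 := by nlinarith
    -- Rounding up r₂ adds at most ε, which 3 ε h' absorbs along with the factor 1 / (1 - ε) because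
    -- h' ≥ 1.
    have hr : r₂ * ε ≤ h' + 3 * ε * h' := by
      have h1 : 0 < 1 - ε := by linarith
      refine le_of_mul_le_mul_left (a := 1 - ε) ?_ h1
      nlinarith [mul_nonneg hε.le (by linarith : 0 ≤ h' - 1),
        mul_nonneg (mul_nonneg hε.le hε.le) (by linarith : 0 ≤ h' - 1)]
    calc c * edgeMax (Fin n) * X ≤ c * edgeMax (Fin n) * (h' + 3 * ε * h' + ε / 2) :=
          mul_le_mul_of_nonneg_left (by linarith) hcE.le
      _ = c * edgeMax (Fin n) * h' + 3 * ε * (c * edgeMax (Fin n) * h') +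
          c * edgeMax (Fin n) * (ε / 2) := by ring
      _ ≤ _ := by nlinarith

/-- Sample, solve the linear program, and round. -/
def sampleRound : Prog :=
  .seq (blk [.cast 6 7, .rdiv 6 6 4, .radd 5 11 11, .const 1 0])
    (.seq clearLoop (.seq sampleLoop (.seq lpProg (.seq (blk [.const 1 0]) roundLoop))))

/-- `x` is what the relaxation method computes from the estimates `d`. -/
structure LPOutcome (G : SimpleGraph (Fin n)) (ε : ℝ) (r₁ r₂ : ℕ) (d x : ℕ → ℝ) : Prop where
  mem_unit : ∀ u < n, 0 ≤ x u ∧ x u ≤ 1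
  outside : ∀ u < n, d u < ε * n / 4 → x u = 0
  rows : 256 / ε ^ 4 ≤ n → (∃ z, RowFeasible G ε d r₁ r₂ z) → ∀ j < n + 2,
    rowRhs n ε d r₁ r₂ j - ε ^ 2 * n / 8 ≤ ∑ u ∈ Finset.range n, rowCoef G ε d j u * x u

open Classical in
-- `Good` singles out the estimates for which the computed vector rounds well; on all others success
-- is bounded below by 0. The analysis of the linear program and of rounding enters through `hgood`
-- only.
theorem sampleRound_spec {ε c : ℝ} {s : Store} {m : ℕ} (hs : Consts n ε c s) (hε : 0 < ε)
    (hn : 0 < n) (h4 : s.rreg 4 = m) {F : Finset (Fin n) → ℝ≥0∞} {Good : (Fin n → ℝ) → Prop}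
    {r₀ : ℝ≥0∞} (hgood : ∀ d x : ℕ → ℝ, Good (fun v => d v) →
      LPOutcome G ε (s.nreg 11) (s.nreg 12) d x → r₀ ≤ ev (roundSet fun v : Fin n => x v) F) :
    Ens G sampleRound s
      (m * (40 * n + 21) + (n + 2) * (n + 3) * (120 * n + 101) + 61 * n + 30)
      (fun s' => ∀ v < n, arr s' 1 v = 0 ∨ arr s' 1 v = 1)
      (sampleAvg G (fun e => if Good e then r₀ else 0) (s.nreg 7 / m) m fun _ => 0)
      (fun s' => F (posSet n (arr s' 1))) := by
  set Gd : (Fin n → ℝ) → ℝ≥0∞ := fun e => if Good e then r₀ else 0 with hGd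
  refine Hoare.comp_ens (Q := fun s' => s'.rreg 6 = s.nreg 7 / m ∧ s'.rreg 5 = 0 ∧ s'.nreg 1 = 0)
    9 (m * (40 * n + 21) + (n + 2) * (n + 3) * (120 * n + 101) + 61 * n + 18) (by omega)
    (Hoare.line rfl (by decide) (by simp [h4, hs.r11])) ?_
  rintro s1 ⟨a6, a5, a1⟩ ha1
  have hs1 := hs.agree ha1 rfl
  refine Hoare.comp_ens (30 * n + 1)
    (m * (40 * n + 21) + (n + 2) * (n + 3) * (120 * n + 101) + 31 * n + 16) (by omega)
    (clearLoop_spec (G := G) hs1 a1) ?_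
  intro s2 b ha2
  have hs2 := hs1.agree ha2 rfl
  have b6 : s2.rreg 6 = s.nreg 7 / m := (ha2.rreg 6 rfl).trans a6
  have b4 : s2.rreg 4 = m := ((ha2.rreg 4 rfl).trans (ha1.rreg 4 rfl)).trans h4
  have b5 : s2.rreg 5 = 0 := (ha2.rreg 5 rfl).trans a5
  have b0 : vec n s2 0 = fun _ => 0 := funext fun v => (b v v.2).1
  have hsample := sampleLoop_spec (G := G) hs2 hn b4 b5 Gd
  rw [b6, b0] at hsample
  refine Ens.comp (m * (40 * n + 21) + 1) ((n + 2) * (n + 3) * (120 * n + 101) + 31 * n + 14)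
    (fun s' => Gd (vec n s' 0)) (by omega) hsample ?_
  intro s3 d1 ha3
  have hs3 := hs2.agree ha3 rfl
  refine Hoare.comp_ens ((n + 2) * (n + 3) * (120 * n + 101) + 7) (31 * n + 5) (by omega)
    (lpProg_spec (G := G) hs3 hε (((ha3.nreg 11 rfl).trans (ha2.nreg 11 rfl)).trans
      (ha1.nreg 11 rfl)) (((ha3.nreg 12 rfl).trans (ha2.nreg 12 rfl)).trans (ha1.nreg 12 rfl))
      fun u hu => by rw [d1]; exact (b u hu).2) ?_
  rintro s4 ⟨-, e1, e2, e3⟩ ha4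
  have hs4 := hs3.agree ha4 rfl
  refine Hoare.comp_ens (Q := fun s' => s'.nreg 1 = 0) 3 (31 * n + 1) (by omega)
    (Hoare.line rfl (by decide) (by simp)) ?_
  intro s5 f1 ha5
  refine (roundLoop_spec (G := G) (hs4.agree ha5 rfl) f1 F).mono le_rfl (fun _ h => h) ?_
    fun _ _ => le_rfl
  have hv : vec n s5 1 = fun v : Fin n => arr s4 1 v := funext fun v => ha5.arr_eq rfl 1 v
  rw [hv, hGd]
  dsimp only
  split_ifs with hg
  · exact hgood _ _ hg ⟨e1, e2, e3⟩
  · exact zero_le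

/-- Guess the parameters of a core and generate a set at random. -/
def generate : Prog :=
  .seq (.instr (.rand 7 0)) (.seq (.instr (.rand 11 0)) (.seq (.instr (.rand 12 0)) sampleRound))

open Classical in
-- The three parameters are guessed at random instead of being tried in turn; the factor (n + 1)⁻³
-- is made up for by more iterations. Each intermediate expectation vanishes unless the guesses so
-- far are right.
theorem generate_spec {ε c : ℝ} {s : Store} {m κ r₁ r₂ : ℕ} (hs : Consts n ε c s) (hε : 0 < ε)
    (hn : 0 < n) (h4 : s.rreg 4 = m) (hκ : κ ≤ n) (hr₁ : r₁ ≤ n) (hr₂ : r₂ ≤ n)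
    {F : Finset (Fin n) → ℝ≥0∞} {Good : (Fin n → ℝ) → Prop} {r₀ : ℝ≥0∞}
    (hgood : ∀ d x : ℕ → ℝ, Good (fun v => d v) → LPOutcome G ε r₁ r₂ d x →
      r₀ ≤ ev (roundSet fun v : Fin n => x v) F) :
    Ens G generate s
      (m * (40 * n + 21) + (n + 2) * (n + 3) * (120 * n + 101) + 61 * n + 36)
      (fun s' => ∀ v < n, arr s' 1 v = 0 ∨ arr s' 1 v = 1)
      (((n + 1 : ℕ) : ℝ≥0∞)⁻¹ ^ 3 *
        sampleAvg G (fun e => if Good e then r₀ else 0) (κ / m) m fun _ => 0)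
      (fun s' => F (posSet n (arr s' 1))) := by
  set A := sampleAvg G (fun e => if Good e then r₀ else 0) (κ / m) m fun _ => 0 with hA
  set q : ℝ≥0∞ := ((n + 1 : ℕ) : ℝ≥0∞)⁻¹ with hq
  set T := m * (40 * n + 21) + (n + 2) * (n + 3) * (120 * n + 101) + 61 * n + 30 with hT
  refine Ens.comp (Q := fun _ => True) 1 (T + 4)
    (fun s' => if s'.nreg 7 = κ then q ^ 2 * A else 0) (by omega)
    (Ens.rand_guess (fun _ _ => trivial) (hκ.trans hs.n0.ge) ?_) ?_
  · rw [hs.n0]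
    simp only [Store.setN, Function.update_self, if_true]
    rw [← hq, ← mul_assoc, ← pow_succ']
  intro s1 _ ha1
  have hs1 := hs.agree ha1 rfl
  refine Ens.comp (Q := fun _ => True) 1 (T + 2)
    (fun s' => if s'.nreg 7 = κ ∧ s'.nreg 11 = r₁ then q * A else 0) (by omega)
    (Ens.rand_guess (fun _ _ => trivial) (hr₁.trans hs1.n0.ge) ?_) ?_
  · rw [hs1.n0]
    simp only [Store.setN, Function.update_self, and_true]
    rw [Function.update_of_ne (by norm_num), ← hq]
    split_ifs
    · rw [← mul_assoc, ← pow_two]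
    · exact zero_le
  intro s2 _ ha2
  have hs2 := hs1.agree ha2 rfl
  refine Ens.comp (Q := fun _ => True) 1 T
    (fun s' => if s'.nreg 7 = κ ∧ s'.nreg 11 = r₁ ∧ s'.nreg 12 = r₂ then A else 0) (by omega)
    (Ens.rand_guess (fun _ _ => trivial) (hr₂.trans hs2.n0.ge) ?_) ?_
  · rw [hs2.n0]
    simp only [Store.setN, Function.update_self, and_true]
    rw [Function.update_of_ne (by norm_num), Function.update_of_ne (by norm_num), ← hq]
    split_ifs
    · exact le_rfl
    · exact zero_le
  intro s3 _ ha3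
  have hs3 := hs2.agree ha3 rfl
  have h43 : s3.rreg 4 = m :=
    (((ha3.rreg 4 rfl).trans (ha2.rreg 4 rfl)).trans (ha1.rreg 4 rfl)).trans h4
  split_ifs with h
  · obtain ⟨rfl, rfl, rfl⟩ := h
    exact sampleRound_spec hs3 hε hn h43 hgood
  · exact (sampleRound_spec (G := G) (F := 0) (Good := fun _ => False) (r₀ := 0) hs3 hε hn h43
      fun _ _ h => h.elim).hoare.ens fun _ _ => zero_le

/-- With no estimate declared good, termination and integrality remain, and they hold whether or not
there is a core. -/
theorem generate_hoare {ε c : ℝ} {s : Store} {m : ℕ} (hs : Consts n ε c s) (hε : 0 < ε)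
    (hn : 0 < n) (h4 : s.rreg 4 = m) :
    Hoare G generate s
      (m * (40 * n + 21) + (n + 2) * (n + 3) * (120 * n + 101) + 61 * n + 36)
      (fun s' => ∀ v < n, arr s' 1 v = 0 ∨ arr s' 1 v = 1) :=
  (generate_spec (G := G) (F := 0) (Good := fun _ => False) (r₀ := 0) hs hε hn h4 (Nat.zero_le n)
    (Nat.zero_le n) (Nat.zero_le n) fun _ _ h => h.elim).hoare

open Classical in
theorem le_sampleAvg {Good : (Fin n → ℝ) → Prop} (inc : ℝ) (m : ℕ) (r₀ : ℝ≥0∞) :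
    (Finset.univ.filter fun M : Fin m → Fin n => Good fun v => inc * sampleDeg G M v).card *
      (((n : ℝ≥0∞)⁻¹) ^ m * r₀) ≤
      sampleAvg G (fun e => if Good e then r₀ else 0) inc m fun _ => 0 := by
  rw [sampleAvg, ← nsmul_eq_mul, ← Finset.sum_const, Finset.sum_filter]
  refine Finset.sum_le_sum fun M _ => ?_
  simp only [zero_add, mul_comm _ inc]
  split_ifs
  · exact le_rfl
  · exact zero_le

open Classical in
/-- With a core, one iteration succeeds with a small probability. -/
theorem generate_core {ε c : ℝ} {s : Store} {m : ℕ} {K : Finset (Fin n)} (hs : Consts n ε c s)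
    (hc : 0 < c) (hε : 0 < ε) (hε1 : ε ≤ 1 / 7) (hn : 2 ^ 2 * 3 ^ 4 / ε ^ 8 ≤ (n : ℝ))
    (h4 : s.rreg 4 = m) (hm : (3 : ℝ) ^ 6 / ε ^ 4 * Real.log n ≤ m) (hK : IsOptCore G c ε K)
    (hKne : K.Nonempty) :
    Ens G generate s
      (m * (40 * n + 21) + (n + 2) * (n + 3) * (120 * n + 101) + 61 * n + 36)
      (fun s' => ∀ v < n, arr s' 1 v = 0 ∨ arr s' 1 v = 1)
      (ENNReal.ofReal ((ε / 3) ^ m / (4 * (n + 1) ^ 3)))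
      (fun s' => if NearOptimal G c (30 * ε) (posSet n (arr s' 1)) then 1 else 0) := by
  have hcard : Fintype.card (Fin n) = n := Fintype.card_fin n
  have hε8 : ε ^ 8 ≤ ε ^ 4 := pow_le_pow_of_le_one hε.le (by linarith) (by norm_num)
  have hε4 : ε ^ 8 ≤ ε ^ 2 := pow_le_pow_of_le_one hε.le (by linarith) (by norm_num)
  have hε3 : ε ^ 8 ≤ ε ^ 1 := pow_le_pow_of_le_one hε.le (by linarith) (by norm_num)
  have hnε : 324 ≤ n * ε ^ 8 := by
    rw [div_le_iff₀ (by positivity)] at hn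
    linarith
  have hN : 0 < (n : ℝ) := by
    by_contra h
    nlinarith [pow_pos hε 8]
  have hn0 : 0 < n := by exact_mod_cast hN
  have hεn : 324 ≤ n * ε := by nlinarith
  have hn2 : 2 ≤ n := by
    have : (2 : ℝ) ≤ n := by nlinarith
    exact_mod_cast this
  have : Nonempty (Fin n) := ⟨⟨0, hn0⟩⟩
  have hcore := hK.le_deg
  rw [hcard] at hcore
  have h1ε : 0 < 1 - ε := by linarith
  have hq : 0 < (1 - ε) * ε := by positivity
  set E : ℝ := (edgesIn G K : ℝ) with hE
  have hE0 : 0 ≤ E := Nat.cast_nonneg _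
  have hE1 : 2 * E ≤ (n : ℝ) ^ 2 := by
    have h1 := edgesIn_le_edgeMax G K
    have h2 := two_edgeMax_le (V := Fin n)
    rw [hcard] at h2
    linarith
  set h := invDegSum G K with hh
  have hh0 : 0 ≤ h := Finset.sum_nonneg fun v _ => by positivity
  -- At most n inverse degrees, each at most 3 / (εn). So r₂ below is of order 1/ε², well within the
  -- range {0, …, n} of the random guess.
  have hh1 : h * ε ≤ 3 := by
    have : h ≤ ∑ v ∈ K, 3 / (ε * n) := by
      refine Finset.sum_le_sum fun v hv => ?_
      have := hcore v hv
      have h0 : 0 < ε * n := by positivity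
      rw [div_le_div_iff₀ (by linarith) h0]
      linarith
    rw [Finset.sum_const, nsmul_eq_mul] at this
    have hKn : (K.card : ℝ) ≤ n := by
      have := Finset.card_le_univ K
      rw [hcard] at this
      exact_mod_cast this
    calc h * ε ≤ K.card * (3 / (ε * n)) * ε := mul_le_mul_of_nonneg_right this hε.le
      _ = 3 * (K.card / n) := by field_simp
      _ ≤ 3 * 1 := by gcongr; exact (div_le_one hN).2 hKn
      _ = 3 := by norm_num
  -- Integer guesses for two real bounds, on grids of width n and (1 - ε)ε. The edge bound is
  -- rounded down and the cost bound up, so that the core stays feasible.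
  set r₁ := ⌊2 * (1 - ε) * E / n⌋₊ with hr₁
  set r₂ := ⌈h / ((1 - ε) * ε)⌉₊ with hr₂
  have a1 : (r₁ : ℝ) * n ≤ 2 * (1 - ε) * E := by
    rw [← le_div_iff₀ hN]
    exact Nat.floor_le (by positivity)
  have a2 : 2 * (1 - ε) * E ≤ (r₁ + 1) * n := by
    rw [← div_le_iff₀ hN]
    exact (Nat.lt_floor_add_one _).le
  have b1 : h ≤ r₂ * ((1 - ε) * ε) := by
    rw [← div_le_iff₀ hq]
    exact Nat.le_ceil _
  have b2 : (r₂ : ℝ) * ((1 - ε) * ε) ≤ h + (1 - ε) * ε := by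
    have := (Nat.ceil_lt_add_one (show 0 ≤ h / ((1 - ε) * ε) by positivity)).le
    calc (r₂ : ℝ) * ((1 - ε) * ε) ≤ (h / ((1 - ε) * ε) + 1) * ((1 - ε) * ε) :=
          mul_le_mul_of_nonneg_right this hq.le
      _ = h + (1 - ε) * ε := by field_simp
  have c1 : r₁ ≤ n := by
    have : (r₁ : ℝ) ≤ n := by
      refine le_of_mul_le_mul_right (a := (n : ℝ)) ?_ hN
      nlinarith
    exact_mod_cast this
  have c2 : r₂ ≤ n := by
    have : (r₂ : ℝ) ≤ n := by
      refine le_of_mul_le_mul_right (a := (1 - ε) * ε * ε) ?_ (by positivity)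
      have h1 : (r₂ : ℝ) * ((1 - ε) * ε) * ε ≤ (h + (1 - ε) * ε) * ε :=
        mul_le_mul_of_nonneg_right b2 hε.le
      have h2 : 324 ≤ n * ε ^ 2 := hnε.trans (mul_le_mul_of_nonneg_left hε4 hN.le)
      have h3 : (1 - ε) * ε * ε ≤ 1 := by nlinarith
      have h4 : n * ε ^ 2 * (6 / 7) ≤ n * ε ^ 2 * (1 - ε) :=
        mul_le_mul_of_nonneg_left (by linarith) (by positivity)
      linarith
    exact_mod_cast this
  have hspec := generate_spec (G := G) (F := fun S => if NearOptimal G c (30 * ε) S then 1 else 0)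
    (Good := fun e => ∀ v, |e v - degIn G K v| ≤ ε ^ 2 / 5 * n) (r₀ := 1 / 2) (κ := K.card)
    (r₁ := r₁) (r₂ := r₂) hs hε hn0 h4 (by simpa using Finset.card_le_univ K) c1 c2 ?_
  -- The success probability collects (n + 1)⁻³ for the guesses, (ε/3)^m / 2 for the sample and 1/2
  -- for the rounding.
  · refine hspec.mono le_rfl (fun _ h => h) ?_ fun _ _ => le_rfl
    refine le_trans ?_ (mul_le_mul_right (le_sampleAvg _ _ _) _)
    have hp := le_prob_goodSample hε hε1 (by rwa [hcard]) G hKne hK.le_deg m (by rwa [hcard])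
    rw [hcard] at hp
    rw [ENNReal.ofReal_le_iff_le_toReal (by
      refine ENNReal.mul_ne_top (ENNReal.pow_ne_top (by simp)) (ENNReal.mul_ne_top (by simp)
        (ENNReal.mul_ne_top (ENNReal.pow_ne_top (by simp; omega)) (by simp))))]
    simp only [ENNReal.toReal_mul, ENNReal.toReal_pow, ENNReal.toReal_inv, ENNReal.toReal_natCast,
      ENNReal.toReal_div, ENNReal.toReal_one, ENNReal.toReal_ofNat]
    set g : ℝ := ((Finset.univ.filter fun M : Fin m → Fin n =>
      GoodSample G K (ε ^ 2 / 5 * n) M).card : ℝ) with hg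
    suffices hsuff : (ε / 3) ^ m / (4 * (n + 1 : ℝ) ^ 3) ≤
        ((n + 1 : ℕ) : ℝ)⁻¹ ^ 3 * (g * ((n : ℝ)⁻¹ ^ m * (1 / 2))) by
      convert hsuff
      exact Iff.rfl
    calc (ε / 3) ^ m / (4 * (n + 1) ^ 3) = ((n + 1 : ℕ) : ℝ)⁻¹ ^ 3 * ((ε / 3) ^ m / 2 * (1 / 2)) := by
          push_cast
          field_simp
          norm_num
      _ ≤ ((n + 1 : ℕ) : ℝ)⁻¹ ^ 3 * (g / (n : ℝ) ^ m * (1 / 2)) := by gcongr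
      _ = _ := by rw [inv_pow (n : ℝ)]; ring
  · intro d x hd hx
    have hev := ev_indicator (roundSet fun v : Fin n => x v) {S | NearOptimal G c (30 * ε) S}
    simp only [Set.mem_ofPred_eq] at hev
    rw [hev]
    refine half_le_nearOptimal (d := fun v : Fin n => d v) hc hε hε1 (by rwa [hcard])
      (by rwa [hcard]) hK hKne
      (fracGood_of_rows hc hε hε1 (by linarith) hK hKne hd a2 b2 hx.mem_unit hx.outside
        (hx.rows ?_ (rowFeasible_core hε hε1 hn0 hcore hd a1 b1)))
    rw [div_le_iff₀ (by positivity)]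
    nlinarith

end

end UGSC

namespace UGSC

/-! ### The whole program -/

section

variable {n : ℕ} {G : SimpleGraph (Fin n)}

/-- Compute the constants. -/
def constsCode : List Instr :=
  [.const 2 1, .sub 9 0 2, .const 13 2, .add 14 0 13, .cast 21 0, .cast 20 2, .cast 15 13,
    .radd 16 15 15, .rmul 10 0 21, .rdiv 10 10 16, .rsub 17 21 20, .rmul 17 21 17,
    .rdiv 17 17 15, .rmul 26 0 0, .radd 27 16 16, .rmul 18 26 21, .rdiv 18 18 27,
    .rmul 27 27 16, .rdiv 19 26 27, .rsub 22 20 0, .rmul 26 26 26, .rmul 28 26 26,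
    .const 5 324, .cast 27 5, .rdiv 27 27 28]

/-- The machine is ready for the main loop. -/
structure Ready (G : SimpleGraph (Fin n)) (ε c : ℝ) (s : Store) : Prop where
  consts : Consts n ε c s
  best : BestInv G c s
  output : Config.output n ([], s) = ∅
  zero : ∀ v, arr s 1 v = 0

theorem output_congr {s s' : Store} (h : s'.nmem = s.nmem) :
    Config.output n ([], s') = Config.output n ([], s) := by
  simp only [Config.output, h]

theorem Ready.agree {ε c : ℝ} {s s' : Store} {p : Prog} (h : Ready G ε c s) (ha : Agree p s s')
    (hp : p.keepsConsts = true) (h9 : p.wr 9 = false) (hnm : p.wnm = false)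
    (hrm : p.wrm = false) : Ready G ε c s' := by
  have ho := output_congr (n := n) (ha.nmem hnm)
  refine ⟨h.consts.agree ha hp, ?_, ho.trans h.output, fun v => ?_⟩
  · rw [BestInv, ho, ha.rreg 9 h9]
    exact h.best
  · rw [ha.arr_eq hrm, h.zero]

theorem constsCode_spec (ε c : ℝ) :
    Hoare G (blk constsCode) (initStore n ε c) 51 (fun s' => Ready G ε c s' ∧
      s'.rreg 26 = ε ^ 4 ∧ s'.rreg 27 = 324 / ε ^ 8) := by
  refine Hoare.line rfl (by decide) ⟨⟨?_, ?_, ?_, fun _ => rfl⟩, ?_, ?_⟩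
  · constructor <;> simp [constsCode, blkDet, Instr.det, Store.setN, Store.setR, initStore]
    all_goals ring
  · have : Config.output n ([], blkDet G constsCode (initStore n ε c)) = ∅ := by
      simp [Config.output, constsCode, blkDet, Instr.det, Store.setN, Store.setR, initStore]
    rw [BestInv, this, utility_empty]
    simp [constsCode, blkDet, Instr.det, Store.setN, Store.setR, initStore]
  · simp [Config.output, constsCode, blkDet, Instr.det, Store.setN, Store.setR, initStore]
  · simp [constsCode, blkDet, Instr.det, Store.setN, Store.setR, initStore]
    ring
  · simp [constsCode, blkDet, Instr.det, Store.setN, Store.setR, initStore]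
    ring

/-- Count the binary digits of the number of nodes. -/
def logLoop : Prog := .loop (.rlt 5 21) (blk [.radd 5 5 5, .radd 25 25 20])

/-- The machine has no logarithm; the number of doublings needed to reach n replaces it, at the cost
of a constant factor. -/
theorem logLoop_spec {ε c : ℝ} {s : Store} (hs : Consts n ε c s) (h5 : s.rreg 5 = 1)
    (h25 : s.rreg 25 = 0) :
    Hoare G logLoop s (Nat.clog 2 n * 6 + 1) (fun s' => s'.rreg 25 = Nat.clog 2 n) := by
  have key : ∀ i : ℕ, (2 : ℝ) ^ i < n ↔ i < Nat.clog 2 n := fun i => by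
    rw [Nat.lt_clog_iff_pow_lt (by norm_num)]
    exact_mod_cast Iff.rfl
  refine (Hoare.loop (T := 5) (fun i s' => s'.rreg 5 = 2 ^ i ∧ s'.rreg 25 = i)
    ⟨by simpa, by simpa⟩ ?_ ?_).mono le_rfl fun s' h => h.1.2
  · rintro i s1 hi ha1 ⟨g5, g25⟩
    have hs1 := hs.agree ha1 rfl
    refine ⟨by simpa only [Test.holds, g5, hs1.r21, key] using hi, Hoare.line rfl (by decide) ?_⟩
    constructor
    · simp [g5]
      ring
    · simp [g25, hs1.r20]
  · rintro s' ha ⟨g5, -⟩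
    have hc := hs.agree ha rfl
    simp only [Test.holds, g5, hc.r21, key, lt_irrefl, not_false_eq_true]

/-- Fix the parameters: the mode, the number of samples, and the factors of the number of
iterations. -/
def paramProg : Prog :=
  .ite (.rlt 21 27)
    (blk [.const 16 1, .radd 24 20 20, .radd 25 21 11, .radd 2 20 11])
    (.seq (blk [.const 16 0, .radd 5 20 11, .radd 25 11 11])
      (.seq logLoop (blk [.const 5 1000, .cast 6 5, .rmul 25 6 25, .rdiv 25 25 26, .const 5 3,
        .cast 6 5, .rdiv 24 6 0, .rmul 2 21 21, .rmul 2 2 21, .rmul 2 2 2])))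

/-- Compute the sample size and the number of iterations. -/
def powLoop : Prog := .loop (.rlt 4 25) (blk [.rmul 2 2 24, .radd 4 4 20])

/-- Counting in a real register up to a real bound computes a ceiling without a rounding
instruction; the same loop accumulates the power. -/
theorem powLoop_spec {ε c : ℝ} {s : Store} (hs : Consts n ε c s) (h4 : s.rreg 4 = 0) :
    Hoare G powLoop s (⌈s.rreg 25⌉₊ * 6 + 1) (fun s' => s'.rreg 4 = ⌈s.rreg 25⌉₊ ∧
      s'.rreg 2 = s.rreg 2 * s.rreg 24 ^ ⌈s.rreg 25⌉₊) := by
  refine (Hoare.loop (T := 5) (fun i s' => s'.rreg 4 = i ∧ s'.rreg 2 = s.rreg 2 * s.rreg 24 ^ i)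
    ⟨by simpa, by simp⟩ ?_ ?_).mono le_rfl fun s' h => h.1
  · rintro i s1 hi ha1 ⟨g4, g2⟩
    have hs1 := hs.agree ha1 rfl
    refine ⟨by simpa only [Test.holds, g4, ha1.rreg 25 rfl, Nat.lt_ceil] using hi,
      Hoare.line rfl (by decide) ?_⟩
    constructor
    · simp [g4, hs1.r20]
    · simp [g2, ha1.rreg 24 rfl]
      ring
  · rintro s' ha ⟨g4, -⟩
    simp only [Test.holds, g4, ha.rreg 25 rfl, ← Nat.lt_ceil, lt_irrefl, not_false_eq_true]

/-- The preparation of the main loop. -/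
def setupProg : Prog :=
  .seq (blk constsCode) (.seq paramProg (.seq (blk [.radd 4 11 11])
    (.seq powLoop (blk [.radd 3 11 11]))))

theorem setupProg_small {ε c : ℝ} (hn : (n : ℝ) < 324 / ε ^ 8) :
    Hoare G setupProg (initStore n ε c) (n * 6 + 80) (fun s' => Ready G ε c s' ∧
      s'.rreg 3 = 0 ∧ s'.nreg 16 = 1 ∧ s'.rreg 4 = n ∧ s'.rreg 2 = 2 ^ n) := by
  refine Hoare.comp 51 (n * 6 + 28) (by omega) (constsCode_spec (G := G) ε c) ?_
  rintro s1 ⟨hs1, -, a27⟩ -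
  refine Hoare.comp (Q := fun s' => s'.nreg 16 = 1 ∧ s'.rreg 24 = 2 ∧ s'.rreg 25 = n ∧
    s'.rreg 2 = 1) 10 (n * 6 + 17) (by omega) (Hoare.branch 9 (by omega)
      (fun _ => Hoare.line rfl (by decide) ?_) fun t => ?_) ?_
  · have := hs1.consts.r20
    norm_num [hs1.consts.r20, hs1.consts.r21, hs1.consts.r11]
  · simp only [Test.holds, hs1.consts.r21, a27] at t
    exact absurd hn t
  rintro s2 ⟨b16, b24, b25, b2⟩ ha2
  have hs2 := hs1.agree ha2 rfl rfl rfl rfl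
  refine Hoare.comp (Q := fun s' => s'.rreg 4 = 0) 3 (n * 6 + 13) (by omega)
    (Hoare.line rfl (by decide) (by simp [hs2.consts.r11])) ?_
  intro s3 c4 ha3
  have hs3 := hs2.agree ha3 rfl rfl rfl rfl
  have hpow := powLoop_spec (G := G) hs3.consts c4
  rw [ha3.rreg 25 rfl, ha3.rreg 24 rfl, ha3.rreg 2 rfl, b25, b24, b2, Nat.ceil_natCast,
    one_mul] at hpow
  refine Hoare.comp (n * 6 + 1) 3 (by omega) hpow ?_
  rintro s4 ⟨d4, d2⟩ ha4
  have hs4 := hs3.agree ha4 rfl rfl rfl rfl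
  refine (Hoare.line (Q := fun s' => s'.rreg 3 = 0) rfl (by decide)
    (by simp [hs4.consts.r11])).frame.mono le_rfl ?_
  rintro s5 ⟨e3, ha5⟩
  refine ⟨hs4.agree ha5 rfl rfl rfl rfl, e3, ?_, ?_, ?_⟩
  · rw [ha5.nreg 16 rfl, ha4.nreg 16 rfl, ha3.nreg 16 rfl, b16]
  · rw [ha5.rreg 4 rfl, d4]
  · rw [ha5.rreg 2 rfl, d2]

/-- The sample size of the program. -/
noncomputable def progSize (n : ℕ) (ε : ℝ) : ℕ := ⌈1000 * (Nat.clog 2 n : ℝ) / ε ^ 4⌉₊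

/-- The number of iterations of the program. -/
noncomputable def progIter (n : ℕ) (ε : ℝ) : ℕ := ⌈(n : ℝ) ^ 6 * (3 / ε) ^ progSize n ε⌉₊

theorem setupProg_large {ε c : ℝ} (hn : 324 / ε ^ 8 ≤ (n : ℝ)) :
    Hoare G setupProg (initStore n ε c) (progSize n ε * 6 + Nat.clog 2 n * 6 + 110)
      (fun s' => Ready G ε c s' ∧ s'.rreg 3 = 0 ∧ s'.nreg 16 = 0 ∧ s'.rreg 4 = progSize n ε ∧
        s'.rreg 2 = (n : ℝ) ^ 6 * (3 / ε) ^ progSize n ε) := by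
  refine Hoare.comp 51 (progSize n ε * 6 + Nat.clog 2 n * 6 + 58) (by omega)
    (constsCode_spec (G := G) ε c) ?_
  rintro s1 ⟨hs1, a26, a27⟩ -
  refine Hoare.comp (Q := fun s' => s'.nreg 16 = 0 ∧ s'.rreg 24 = 3 / ε ∧
    s'.rreg 25 = 1000 * (Nat.clog 2 n : ℝ) / ε ^ 4 ∧ s'.rreg 2 = (n : ℝ) ^ 6)
    (Nat.clog 2 n * 6 + 32) (progSize n ε * 6 + 17) (by omega)
    (Hoare.branch (Nat.clog 2 n * 6 + 31) (by omega) (fun t => ?_) fun _ => ?_) ?_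
  · simp only [Test.holds, hs1.consts.r21, a27] at t
    exact absurd t (not_lt.2 hn)
  · refine Hoare.comp (Q := fun s' => s'.nreg 16 = 0 ∧ s'.rreg 5 = 1 ∧ s'.rreg 25 = 0) 7
      (Nat.clog 2 n * 6 + 23) (by omega) (Hoare.line rfl (by decide)
        (by simp [hs1.consts.r20, hs1.consts.r11])) ?_
    rintro s2 ⟨b16, b5, b25⟩ ha2
    have hs2 := hs1.agree ha2 rfl rfl rfl rfl
    refine Hoare.comp (Nat.clog 2 n * 6 + 1) 21 (by omega)
      (logLoop_spec (G := G) hs2.consts b5 b25) ?_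
    intro s3 c25 ha3
    have hs3 := hs2.agree ha3 rfl rfl rfl rfl
    have c26 : s3.rreg 26 = ε ^ 4 := by rw [ha3.rreg 26 rfl, ha2.rreg 26 rfl, a26]
    have c16 : s3.nreg 16 = 0 := by rw [ha3.nreg 16 rfl, b16]
    refine Hoare.line rfl (by decide) ⟨?_, ?_, ?_, ?_⟩
    · simp [c16]
    · simp [hs3.consts.r0]
    · simp [c25, c26]
    · simp [hs3.consts.r21]
      ring
  rintro s2 ⟨b16, b24, b25, b2⟩ ha2
  have hs2 := hs1.agree ha2 rfl rfl rfl rfl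
  refine Hoare.comp (Q := fun s' => s'.rreg 4 = 0) 3 (progSize n ε * 6 + 13) (by omega)
    (Hoare.line rfl (by decide) (by simp [hs2.consts.r11])) ?_
  intro s3 c4 ha3
  have hs3 := hs2.agree ha3 rfl rfl rfl rfl
  have hpow := powLoop_spec (G := G) hs3.consts c4
  rw [ha3.rreg 25 rfl, ha3.rreg 24 rfl, ha3.rreg 2 rfl, b25, b24, b2] at hpow
  refine Hoare.comp (progSize n ε * 6 + 1) 3 (by omega) hpow ?_
  rintro s4 ⟨d4, d2⟩ ha4
  have hs4 := hs3.agree ha4 rfl rfl rfl rfl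
  refine (Hoare.line (Q := fun s' => s'.rreg 3 = 0) rfl (by decide)
    (by simp [hs4.consts.r11])).frame.mono le_rfl ?_
  rintro s5 ⟨e3, ha5⟩
  refine ⟨hs4.agree ha5 rfl rfl rfl rfl, e3, ?_, ?_, ?_⟩
  · rw [ha5.nreg 16 rfl, ha4.nreg 16 rfl, ha3.nreg 16 rfl, b16]
  · rw [ha5.rreg 4 rfl, d4]
    rfl
  · rw [ha5.rreg 2 rfl, d2]
    rfl

end

end UGSC

namespace UGSC

/-! ### The main loop -/

section

variable {n : ℕ} {G : SimpleGraph (Fin n)}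

/-- With a = p and b = 1 - p this combines the success of one iteration with the chance p of those
that follow. -/
theorem Ens.affine {p : Prog} {s : Store} {T : ℕ} {Q : Store → Prop} {r : ℝ≥0∞}
    {f : Store → ℝ≥0∞} (h : Ens G p s T Q r f) (a b : ℝ≥0∞) :
    Ens G p s T Q (a + b * r) (fun s' => a + b * f s') := by
  obtain ⟨μ, h1, h2, h3⟩ := h
  refine ⟨μ, h1, h2, ?_⟩
  have : (ev μ fun x => a + b * f x.1) = a + b * ev μ fun x => f x.1 := by
    simp only [ev, mul_add]
    rw [ENNReal.tsum_add, ENNReal.tsum_mul_right, PMF.tsum_coe, one_mul, ← ENNReal.tsum_mul_left]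
    congr 1
    exact tsum_congr fun x => by ring
  rw [this]
  gcongr

/-- Produce a set and compare it with the best set found so far. -/
def mainBody : Prog :=
  .seq (.ite (.lt 16 2) generate nextProg) (.seq evalProg (blk [.radd 3 3 20]))

/-- A time bound for one iteration with samples of size `m`. -/
def bodyTime (n m : ℕ) : ℕ :=
  m * (40 * n + 21) + (n + 2) * (n + 3) * (120 * n + 101) + n * (22 * n + 65) + 61 * n + 100

theorem eval_ens {ε c : ℝ} {s : Store} (hs : Consts n ε c s)
    (hx : ∀ v < n, arr s 1 v = 0 ∨ arr s 1 v = 1) (hbest : BestInv G c s) :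
    Hoare G (.seq evalProg (blk [.radd 3 3 20])) s (n * (22 * n + 65) + 54) (fun s' =>
      s'.rreg 3 = s.rreg 3 + 1 ∧ (∀ v, arr s' 1 v = arr s 1 v) ∧ BestInv G c s' ∧
      utility G c (Config.output n ([], s)) ≤ utility G c (Config.output n ([], s')) ∧
      utility G c (posSet n (arr s 1)) ≤ utility G c (Config.output n ([], s'))) := by
  refine Hoare.comp (n * (22 * n + 65) + 50) 3 (by omega) (evalProg_spec hs hx hbest) ?_
  rintro s1 ⟨b1, b2, b3⟩ ha1
  have hs1 := hs.agree ha1 rfl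
  refine (Hoare.line (Q := fun s' => s'.rreg 3 = s1.rreg 3 + 1) rfl (by decide)
    (by simp [hs1.r20])).frame.mono le_rfl ?_
  rintro s2 ⟨c3, ha2⟩
  have ho := output_congr (n := n) (ha2.nmem rfl)
  refine ⟨by rw [c3, ha1.rreg 3 rfl], fun v => by rw [ha2.arr_eq rfl, ha1.arr_eq rfl], ?_, ?_, ?_⟩
  · rw [BestInv, ho, ha2.rreg 9 rfl]
    exact b1
  · rwa [ho]
  · rwa [ho]

/-- The enumeration finds an optimal set. -/
theorem mainLoop_small {ε c : ℝ} {s : Store} (hs : Ready G ε c s) (h3 : s.rreg 3 = 0)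
    (h16 : s.nreg 16 = 1) (h2 : s.rreg 2 = 2 ^ n) :
    Hoare G (.loop (.rlt 3 2) mainBody) s (2 ^ n * (bodyTime n 0 + 1) + 1)
      (fun s' => NearOptimal G c 0 (Config.output n ([], s'))) := by
  -- As long as i < 2^n, the array holds the set with code i after i iterations, and all codes up to
  -- i have been compared; code 0 is the initial empty output. The last iteration overflows the
  -- counter and evaluates a superfluous set, which does no harm.
  refine (Hoare.loop (N := 2 ^ n) (T := bodyTime n 0) (fun i s' => s'.rreg 3 = i ∧
    BestInv G c s' ∧ (∀ v < n, arr s' 1 v = 0 ∨ arr s' 1 v = 1) ∧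
    (i < 2 ^ n → binVal (arr s' 1) n = i) ∧
    ∀ T : Finset (Fin n), setCode T ≤ i →
      utility G c T ≤ utility G c (Config.output n ([], s'))) ⟨by simpa, hs.best,
    fun v _ => Or.inl (hs.zero v), fun _ => ?_, fun T hT => ?_⟩ ?_ ?_).mono le_rfl ?_
  · exact Finset.sum_eq_zero fun v _ => by rw [if_neg]; simp [hs.zero]
  · have : T = ∅ := setCode_injective (by rw [Nat.le_zero.1 hT]; rfl)
    rw [this, hs.output]
  · rintro i s1 hi ha1 ⟨g3, gb, gx, gv, gT⟩
    have hs1 := hs.consts.agree ha1 rfl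
    refine ⟨?_, ?_⟩
    · simp only [Test.holds, g3, ha1.rreg 2 rfl, h2]
      exact_mod_cast hi
    have b16 : s1.nreg 16 = 1 := (ha1.nreg 16 rfl).trans h16
    refine Hoare.comp (Q := fun s' => (∀ v < n, arr s' 1 v = 0 ∨ arr s' 1 v = 1) ∧
      (binVal (arr s1 1) n + 1 < 2 ^ n → binVal (arr s' 1) n = binVal (arr s1 1) n + 1) ∧
      Config.output n ([], s') = Config.output n ([], s1) ∧ BestInv G c s' ∧ s'.rreg 3 = i)
      (40 * n + 11) (n * (22 * n + 65) + 54) ?_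
      (Hoare.branch (40 * n + 10) (by omega) (fun t => ?_) fun _ => ?_) ?_
    · rw [bodyTime]
      have := Nat.zero_le ((n + 2) * (n + 3) * (120 * n + 101))
      omega
    · simp only [Test.holds, b16, hs1.n2, lt_irrefl] at t
    · refine (nextProg_spec (G := G) hs1 gx).frame.mono le_rfl ?_
      rintro s2 ⟨⟨d1, d2⟩, ha2⟩
      have ho := output_congr (n := n) (ha2.nmem rfl)
      refine ⟨d1, d2, ho, ?_, (ha2.rreg 3 rfl).trans g3⟩
      rw [BestInv, ho, ha2.rreg 9 rfl]
      exact gb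
    · rintro s2 ⟨d1, d2, d3, d4, d5⟩ ha2
      have hs2 := hs1.agree ha2 rfl
      refine (eval_ens hs2 d1 d4).mono le_rfl ?_
      rintro s3 ⟨e3, ex, eb, e1, e2⟩
      have hx : arr s3 1 = arr s2 1 := funext ex
      have hv : i + 1 < 2 ^ n → binVal (arr s2 1) n = i + 1 := fun hlt => by
        rw [d2 (by rw [gv hi]; exact hlt), gv hi]
      refine ⟨by rw [e3, d5]; push_cast; ring, eb, by rwa [hx], by rwa [hx], fun T hT => ?_⟩
      rcases Nat.le_or_eq_of_le_succ hT with hT | hT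
      · rw [d3] at e1
        exact (gT T hT).trans e1
      · have : T = posSet n (arr s2 1) := setCode_injective (by
          rw [setCode_posSet, hv (by rw [← Nat.succ_eq_add_one, ← hT]; exact setCode_lt T)]
          exact hT)
        rw [this]
        exact e2
  · rintro s' ha ⟨g3, -⟩
    simp only [Test.holds, g3, ha.rreg 2 rfl, h2]
    push_cast
    exact lt_irrefl _
  · rintro s' ⟨⟨-, -, -, -, h⟩, -⟩ T
    have := h T (setCode_lt T).le
    simpa using this

open Classical in
/-- Repeated sampling finds a nearly optimal set with high probability. -/
theorem mainLoop_large {ε c q δ R : ℝ} {s : Store} {m : ℕ} (hs : Ready G ε c s)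
    (h3 : s.rreg 3 = 0) (h16 : s.nreg 16 = 0) (h4 : s.rreg 4 = m) (h2 : s.rreg 2 = R)
    (hq : 0 ≤ q) (hq1 : q ≤ 1)
    (hgen : ∀ s', Consts n ε c s' → s'.rreg 4 = m → Ens G generate s'
      (m * (40 * n + 21) + (n + 2) * (n + 3) * (120 * n + 101) + 61 * n + 36)
      (fun s' => ∀ v < n, arr s' 1 v = 0 ∨ arr s' 1 v = 1) (ENNReal.ofReal q)
      (fun s' => if NearOptimal G c δ (posSet n (arr s' 1)) then 1 else 0)) :
    Ens G (.loop (.rlt 3 2) mainBody) s (⌈R⌉₊ * (bodyTime n m + 1) + 1) (fun _ => True)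
      (if NearOptimal G c δ ∅ then 1 else ENNReal.ofReal (1 - (1 - q) ^ ⌈R⌉₊))
      (fun s' => if NearOptimal G c δ (Config.output n ([], s')) then 1 else 0) := by
  have hp0 : ∀ d : ℕ, 0 ≤ (1 - q) ^ d := fun d => pow_nonneg (by linarith) d
  have hp1 : ∀ d : ℕ, (1 - q) ^ d ≤ 1 := fun d => pow_le_one₀ (by linarith) (by linarith)
  set p : ℕ → ℝ≥0∞ := fun d => ENNReal.ofReal (1 - (1 - q) ^ d) with hp
  have hple : ∀ d, p d ≤ 1 := fun d => by
    rw [hp, ← ENNReal.ofReal_one]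
    exact ENNReal.ofReal_le_ofReal (by linarith [hp0 d])
  have hps : ∀ d, p (d + 1) = p d + (1 - p d) * ENNReal.ofReal q := fun d => by
    have h1 : 1 - p d = ENNReal.ofReal ((1 - q) ^ d) := by
      simp only [hp]
      rw [← ENNReal.ofReal_one, ← ENNReal.ofReal_sub _ (by linarith [hp1 d]), sub_sub_cancel]
    rw [h1]
    simp only [hp]
    rw [← ENNReal.ofReal_mul (hp0 d),
      ← ENNReal.ofReal_add (by linarith [hp1 d]) (mul_nonneg (hp0 d) hq)]
    congr 1
    ring
  -- The invariant expectation is 1 once the best set is good enough, and otherwise the chance p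
  -- that one of the remaining iterations succeeds. Success is never lost, as the best utility does
  -- not decrease.
  refine (Ens.loop (N := ⌈R⌉₊) (T := bodyTime n m)
    (fun i s' => s'.rreg 3 = i ∧ BestInv G c s')
    (fun i s' => if NearOptimal G c δ (Config.output n ([], s')) then 1 else p (⌈R⌉₊ - i))
    ⟨by simpa, hs.best⟩ ?_ ?_).mono le_rfl (fun _ _ => trivial) ?_ ?_
  · rintro i s1 hi ha1 ⟨g3, gb⟩
    have hs1 := hs.consts.agree ha1 rfl
    have b4 : s1.rreg 4 = m := (ha1.rreg 4 rfl).trans h4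
    have b16 : s1.nreg 16 = 0 := (ha1.nreg 16 rfl).trans h16
    refine ⟨?_, ?_⟩
    · simpa only [Test.holds, g3, ha1.rreg 2 rfl, h2, Nat.lt_ceil] using hi
    set d := ⌈R⌉₊ - (i + 1) with hd
    have hd1 : ⌈R⌉₊ - i = d + 1 := by omega
    rw [hd1]
    have hg := (hgen s1 hs1 b4).frame
    have ht : (Test.lt 16 2).holds s1 := by simp [Test.holds, b16, hs1.n2]
    refine Ens.comp (Q := fun s' => (∀ v < n, arr s' 1 v = 0 ∨ arr s' 1 v = 1) ∧
        Agree generate s1 s')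
      (m * (40 * n + 21) + (n + 2) * (n + 3) * (120 * n + 101) + 61 * n + 37)
      (n * (22 * n + 65) + 54)
      (fun s' => if NearOptimal G c δ (Config.output n ([], s')) ∨
        NearOptimal G c δ (posSet n (arr s' 1)) then 1 else p d) (by rw [bodyTime]; omega)
      (Ens.ite (fun _ => ?_) fun t => absurd ht t) ?_
    · by_cases hW : NearOptimal G c δ (Config.output n ([], s1))
      · refine hg.hoare.ens fun s' h' => ?_
        rw [if_pos hW, output_congr (h'.2.nmem rfl), if_pos (Or.inl hW)]
      · rw [if_neg hW, hps]
        refine (hg.affine (p d) (1 - p d)).mono le_rfl (fun _ h => h) le_rfl fun s' _ => ?_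
        split_ifs with hA hB hB
        · rw [mul_one, add_tsub_cancel_of_le (hple d)]
        · exact absurd (Or.inr hA) hB
        · rw [mul_zero, add_zero]
          exact hple d
        · rw [mul_zero, add_zero]
    · rintro s2 ⟨c1, hag⟩ ha2
      have hs2 := hs1.agree hag rfl
      have ho := output_congr (n := n) (hag.nmem rfl)
      refine ((eval_ens (G := G) hs2 c1 (by rw [BestInv, ho, hag.rreg 9 rfl]; exact gb)).mono
        le_rfl (Q' := fun s' => (s'.rreg 3 = (i + 1 : ℕ) ∧ BestInv G c s') ∧
          (NearOptimal G c δ (Config.output n ([], s2)) ∨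
            NearOptimal G c δ (posSet n (arr s2 1)) →
              NearOptimal G c δ (Config.output n ([], s')))) ?_).ens (fun s' h' => ?_) |>.mono
                le_rfl (fun s' h' => h'.1) le_rfl fun _ _ => le_rfl
      · rintro s3 ⟨e3, -, eb, e1, e2⟩
        refine ⟨⟨?_, eb⟩, fun h => h.elim (fun h => h.mono_set e1) fun h => h.mono_set e2⟩
        rw [e3, hag.rreg 3 rfl, g3]
        push_cast
        ring
      · split_ifs with hA hB hB
        · exact le_rfl
        · exact absurd (h'.2 hA) hB
        · exact hple d
        · exact le_rfl
  · rintro s' ha ⟨g3, -⟩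
    simp only [Test.holds, g3, ha.rreg 2 rfl, h2, ← Nat.lt_ceil, lt_irrefl, not_false_eq_true]
  · rw [hs.output, Nat.sub_zero]
  · intro s' _
    rw [Nat.sub_self, hp]
    simp

/-- The program. -/
def ptas : Prog := .seq setupProg (.loop (.rlt 3 2) mainBody)

open Classical in
/-- The running time of the program. -/
noncomputable def ptasTime (ε : ℝ) (n : ℕ) : ℕ :=
  if 324 / ε ^ 8 ≤ (n : ℝ) then
    progSize n ε * 6 + Nat.clog 2 n * 6 + 112 + progIter n ε * (bodyTime n (progSize n ε) + 1)
  else n * 6 + 82 + 2 ^ n * (bodyTime n 0 + 1)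

theorem ptas_small (G : SimpleGraph (Fin n)) {ε c : ℝ} (hn : (n : ℝ) < 324 / ε ^ 8) :
    ptas.HaltsWithin G ε c (ptasTime ε n) ∧
      ∀ S ∈ (ptas.outputDist G ε c (ptasTime ε n)).support, NearOptimal G c 0 S := by
  rw [ptasTime, if_neg (not_le.2 hn)]
  have h : Hoare G ptas (initStore n ε c) (n * 6 + 82 + 2 ^ n * (bodyTime n 0 + 1))
      (fun s' => NearOptimal G c 0 (Config.output n ([], s'))) := by
    refine Hoare.comp (n * 6 + 80) (2 ^ n * (bodyTime n 0 + 1) + 1) (by omega)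
      (setupProg_small (G := G) hn) ?_
    rintro s1 ⟨a, a3, a16, a4, a2⟩ -
    exact mainLoop_small a a3 a16 a2
  obtain ⟨h1, -, h3⟩ := Ens.run (A := Set.univ) h (fun _ => zero_le) fun _ _ _ => trivial
  refine ⟨h1, fun S hS => ?_⟩
  obtain ⟨s, hs, rfl⟩ := h3 S hS
  exact hs

end

end UGSC

namespace UGSC

/-! ### Running time and success probability -/

theorem log_le_clog {n : ℕ} (hn : 0 < n) : Real.log n ≤ Nat.clog 2 n := by
  have h1 : (n : ℝ) ≤ 2 ^ Nat.clog 2 n := by exact_mod_cast Nat.le_pow_clog (by norm_num) n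
  have h2 := Real.log_le_log (by exact_mod_cast hn) h1
  rw [Real.log_pow] at h2
  have h3 : Real.log 2 ≤ 1 := by linarith [Real.log_two_lt_d9]
  have h4 : (0 : ℝ) ≤ Nat.clog 2 n := Nat.cast_nonneg _
  nlinarith

theorem clog_le_log {n : ℕ} (hn : 2 ≤ n) : (Nat.clog 2 n : ℝ) ≤ 3 * Real.log n := by
  have h1 : (2 : ℝ) ^ (Nat.clog 2 n - 1) ≤ n := by
    exact_mod_cast (Nat.pow_pred_clog_lt_self (by norm_num) hn).le
  have h2 := Real.log_le_log (by positivity) h1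
  have h3 : Real.log 2 ≤ Real.log n := Real.log_le_log (by norm_num) (by exact_mod_cast hn)
  have h4 : 1 ≤ Nat.clog 2 n := Nat.clog_pos (by norm_num) hn
  rw [Real.log_pow, Nat.cast_sub h4, Nat.cast_one] at h2
  have h5 := Real.log_two_gt_d9
  have h6 : (0 : ℝ) ≤ Nat.clog 2 n := Nat.cast_nonneg _
  nlinarith

theorem exp_one_le_seven : Real.exp 1 ≤ 7 := by linarith [Real.exp_one_lt_d9]

/-- A large instance has many nodes. -/
theorem large_bounds {ε : ℝ} {n : ℕ} (hε : 0 < ε) (hε1 : ε ≤ 1 / 7)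
    (hn : 324 / ε ^ 8 ≤ (n : ℝ)) : 3000000 ≤ (n : ℝ) ∧ 1 / ε ^ 4 ≤ n := by
  have h8 : ε ^ 8 ≤ (1 / 7) ^ 8 := pow_le_pow_left₀ hε.le hε1 8
  have h4 : ε ^ 8 ≤ ε ^ 4 := pow_le_pow_of_le_one hε.le (by linarith) (by norm_num)
  rw [div_le_iff₀ (by positivity)] at hn
  have hN : 0 ≤ (n : ℝ) := Nat.cast_nonneg _
  constructor
  · norm_num at h8
    nlinarith
  · rw [div_le_iff₀ (by positivity)]
    nlinarith

/-- The constant 1000 in the sample size exceeds 3⁶ = 729, and ln n is at most the number of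
doublings. -/
theorem le_progSize {ε : ℝ} {n : ℕ} (hε : 0 < ε) (hn : 0 < n) :
    (3 : ℝ) ^ 6 / ε ^ 4 * Real.log n ≤ progSize n ε := by
  refine le_trans ?_ (Nat.le_ceil _)
  have h1 := log_le_clog hn
  have h2 : 0 ≤ Real.log n := Real.log_natCast_nonneg n
  rw [div_mul_eq_mul_div]
  gcongr
  norm_num

theorem progSize_le {ε : ℝ} {n : ℕ} (hε : 0 < ε) (hε1 : ε ≤ 1 / 7) (hn : 3 ≤ n) :
    (progSize n ε : ℝ) ≤ 3001 * (Real.log n / ε ^ 4) := by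
  have h1 := clog_le_log (by omega : 2 ≤ n)
  have h2 : 1 ≤ Real.log n := by
    rw [Real.le_log_iff_exp_le (by exact_mod_cast (by omega : 0 < n))]
    have : (3 : ℝ) ≤ n := by exact_mod_cast hn
    linarith [Real.exp_one_lt_d9]
  have h3 : 1 ≤ Real.log n / ε ^ 4 := by
    rw [le_div_iff₀ (by positivity)]
    have : ε ^ 4 ≤ 1 := pow_le_one₀ hε.le (by linarith)
    linarith
  have h4 : 1000 * (Nat.clog 2 n : ℝ) / ε ^ 4 ≤ 3000 * (Real.log n / ε ^ 4) := by
    rw [← mul_div_assoc]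
    exact div_le_div_of_nonneg_right (by linarith) (by positivity)
  have h5 := (Nat.ceil_lt_add_one
    (show 0 ≤ 1000 * (Nat.clog 2 n : ℝ) / ε ^ 4 by positivity)).le
  rw [progSize]
  linarith

theorem bodyTime_le {n m : ℕ} (hn : 3000000 ≤ (n : ℝ)) (hm : (m : ℝ) ≤ (n : ℝ) ^ 3) :
    (bodyTime n m : ℝ) + 1 ≤ (n : ℝ) ^ 5 := by
  rw [bodyTime]
  push_cast
  set x : ℝ := (n : ℝ)
  have hx : 0 < x := by linarith
  have hx1 : 1 ≤ x := by linarith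
  have a1 : (m : ℝ) * (40 * x + 21) ≤ x ^ 3 * (41 * x) :=
    mul_le_mul hm (by linarith) (by positivity) (by positivity)
  have a2 : (x + 2) * (x + 3) * (120 * x + 101) ≤ (2 * x) * (2 * x) * (121 * x) := by
    gcongr <;> linarith
  have a3 : x * (22 * x + 65) ≤ x * (23 * x) := mul_le_mul_of_nonneg_left (by linarith) hx.le
  have e1 : x ^ 3 * (41 * x) = 41 * x ^ 4 := by ring
  have e2 : (2 * x) * (2 * x) * (121 * x) = 484 * x ^ 3 := by ring
  have e3 : x * (23 * x) = 23 * x ^ 2 := by ring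
  have b1 : x ^ 1 ≤ x ^ 4 := pow_le_pow_right₀ hx1 (by norm_num)
  have b2 : x ^ 2 ≤ x ^ 4 := pow_le_pow_right₀ hx1 (by norm_num)
  have b3 : x ^ 3 ≤ x ^ 4 := pow_le_pow_right₀ hx1 (by norm_num)
  have b5 : 3000000 * x ^ 4 ≤ x * x ^ 4 := mul_le_mul_of_nonneg_right hn (by positivity)
  have e5 : x * x ^ 4 = x ^ 5 := by ring
  rw [pow_one] at b1
  linarith

/-- The time is at most n⁶ · n⁶ (3/ε)^m, where m ≤ 3001 ln n / ε⁴ and ln(3/ε) ≤ 2 ln(1/ε). The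
exponents add up to 12 + 2 · 3001 = 6014. -/
theorem ptasTime_large {ε : ℝ} {n : ℕ} (hε : 0 < ε) (hε1 : ε ≤ 1 / 7)
    (hn : 324 / ε ^ 8 ≤ (n : ℝ)) :
    (ptasTime ε n : ℝ) ≤ (n : ℝ) ^ (6014 * (Real.log (1 / ε) / ε ^ 4)) := by
  obtain ⟨hN, h4⟩ := large_bounds hε hε1 hn
  have hN0 : 0 < (n : ℝ) := by linarith
  have hn3 : 3 ≤ n := by
    have : (3 : ℝ) ≤ n := by linarith
    exact_mod_cast this
  set x : ℝ := (n : ℝ) with hx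
  set m := progSize n ε with hm
  set lg := Real.log x with hlg
  set lam := Real.log (1 / ε) with hlam
  have hlg0 : 0 ≤ lg := Real.log_natCast_nonneg n
  have hlgx : lg ≤ x := by linarith [Real.log_le_sub_one_of_pos hN0]
  have hmle : (m : ℝ) ≤ 3001 * (lg / ε ^ 4) := progSize_le hε hε1 hn3
  have hmx : (m : ℝ) ≤ x ^ 3 := by
    have h1 : lg / ε ^ 4 ≤ x * x := by
      rw [div_eq_mul_one_div]
      exact mul_le_mul hlgx h4 (by positivity) hN0.le
    nlinarith [mul_pos hN0 hN0]
  have hL : (Nat.clog 2 n : ℝ) ≤ 3 * x := by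
    have := clog_le_log (by omega : 2 ≤ n)
    linarith
  have hε7 : 7 ≤ 1 / ε := by
    rw [le_div_iff₀ hε]
    linarith
  have hlam1 : 1 ≤ lam := by
    rw [hlam, Real.le_log_iff_exp_le (by positivity)]
    exact exp_one_le_seven.trans hε7
  have h3ε : Real.log (3 / ε) ≤ 2 * lam := by
    have : 3 / ε ≤ (1 / ε) ^ 2 := by
      rw [div_eq_mul_one_div, pow_two]
      gcongr
      linarith
    have := Real.log_le_log (by positivity) this
    rwa [Real.log_pow] at this
  set X : ℝ := x ^ 6 * (3 / ε) ^ m with hX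
  have h3 : 1 ≤ 3 / ε := by
    rw [le_div_iff₀ hε]
    linarith
  have hX1 : 1 ≤ X := one_le_mul_of_one_le_of_one_le (one_le_pow₀ (by linarith)) (one_le_pow₀ h3)
  have hiter : (progIter n ε : ℝ) ≤ 2 * X := by
    have := (Nat.ceil_lt_add_one (show 0 ≤ X by linarith)).le
    rw [progIter]
    linarith
  have hbody : (bodyTime n m : ℝ) + 1 ≤ x ^ 5 := bodyTime_le hN hmx
  have htotal : (ptasTime ε n : ℝ) ≤ x ^ 6 * X := by
    rw [ptasTime, if_pos hn]
    push_cast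
    have a1 : (progIter n ε : ℝ) * ((bodyTime n m : ℝ) + 1) ≤ 2 * X * x ^ 5 := by gcongr
    have b3 : x ^ 1 ≤ x ^ 5 := pow_le_pow_right₀ (by linarith) (by norm_num)
    have b5 : x ^ 3 ≤ x ^ 5 := pow_le_pow_right₀ (by linarith) (by norm_num)
    have b6 : 3000000 * x ^ 5 ≤ x * x ^ 5 := mul_le_mul_of_nonneg_right hN (by positivity)
    rw [← pow_succ'] at b6
    rw [pow_one] at b3
    have b9 : 1 ≤ x ^ 5 := one_le_pow₀ (by linarith)
    have b7 : x ^ 5 ≤ x ^ 5 * X := le_mul_of_one_le_right (by positivity) hX1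
    have b8 : 3000000 * x ^ 5 * X ≤ x ^ 6 * X := by gcongr
    linarith
  have hX2 : X = Real.exp (6 * lg + m * Real.log (3 / ε)) := by
    rw [hX, Real.exp_add, mul_comm 6 lg, Real.exp_mul, hlg, Real.exp_log hN0, Real.exp_nat_mul,
      Real.exp_log (by positivity)]
    norm_cast
  have hx6 : x ^ 6 = Real.exp (6 * lg) := by
    rw [mul_comm 6 lg, Real.exp_mul, hlg, Real.exp_log hN0]
    norm_cast
  refine htotal.trans ?_
  rw [hX2, hx6, ← Real.exp_add, Real.rpow_def_of_pos hN0, Real.exp_le_exp]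
  have c1 : (m : ℝ) * Real.log (3 / ε) ≤ 3001 * (lg / ε ^ 4) * (2 * lam) :=
    mul_le_mul hmle h3ε (Real.log_nonneg h3) (by positivity)
  have c2 : lg ≤ lg / ε ^ 4 * lam := by
    have : ε ^ 4 ≤ 1 := pow_le_one₀ hε.le (by linarith)
    have : lg ≤ lg / ε ^ 4 := by
      rw [le_div_iff₀ (by positivity)]
      nlinarith
    nlinarith
  have c3 : lg * (6014 * (lam / ε ^ 4)) = 6014 * (lg / ε ^ 4 * lam) := by ring
  linarith

theorem ptasTime_small {ε : ℝ} {n : ℕ} (hn : (n : ℝ) < 324 / ε ^ 8) :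
    (ptasTime ε n : ℝ) ≤ 2 ^ ((6014 : ℝ) * ((n : ℝ) + 1)) := by
  rw [ptasTime, if_neg (not_le.2 hn)]
  have h1 : n + 1 ≤ 2 ^ n := Nat.lt_two_pow_self
  set P := 2 ^ n with hP
  have hb : bodyTime n 0 + 1 ≤ 1000 * P ^ 3 := by
    calc bodyTime n 0 + 1 ≤ 1000 * (n + 1) ^ 3 := by
          rw [bodyTime]
          ring_nf
          nlinarith
      _ ≤ _ := by gcongr
  -- The main term 1000 P⁴ and the rest fit into 2¹¹ P⁴. The exponent 11 + 4n is far below 6014 (n +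
  -- 1), whose constant comes from the large instances.
  have hle : n * 6 + 82 + P * (bodyTime n 0 + 1) ≤ 2 ^ (11 + 4 * n) := by
    have hP1 : 1 ≤ P := by omega
    have h2 : P ≤ P ^ 4 := Nat.le_self_pow (by norm_num) P
    have h3 : P * (bodyTime n 0 + 1) ≤ P * (1000 * P ^ 3) := Nat.mul_le_mul_left _ hb
    have h4 : 2 ^ (11 + 4 * n) = 2048 * P ^ 4 := by
      rw [pow_add, mul_comm 4 n, pow_mul, ← hP]
      norm_num
    have h5 : P * (1000 * P ^ 3) = 1000 * P ^ 4 := by ring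
    rw [h4]
    omega
  have hle' : ((n * 6 + 82 + P * (bodyTime n 0 + 1) : ℕ) : ℝ) ≤ ((2 ^ (11 + 4 * n) : ℕ) : ℝ) :=
    Nat.cast_le.2 hle
  refine hle'.trans ?_
  push_cast
  rw [← Real.rpow_natCast]
  refine Real.rpow_le_rpow_of_exponent_le (by norm_num) ?_
  push_cast
  have : (0 : ℝ) ≤ n := Nat.cast_nonneg _
  linarith

/-- There are n⁶ (3/ε)^m iterations, each successful with probability (ε/3)^m / (4(n + 1)³); the
product is at least n, as `one_sub_pow_le` wants it. If the core is empty, the initial output is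
good already, and q = 0 is enough. -/
theorem ptas_large {n : ℕ} (G : SimpleGraph (Fin n)) {ε c : ℝ} (hc : 0 < c) (hε : 0 < ε)
    (hε1 : ε ≤ 1 / 7) (hn : 324 / ε ^ 8 ≤ (n : ℝ)) :
    ptas.HaltsWithin G ε c (ptasTime ε n) ∧
      ENNReal.ofReal (1 - 1 / (n : ℝ)) ≤
        (ptas.outputDist G ε c (ptasTime ε n)).toOuterMeasure
          {S | NearOptimal G c (30 * ε) S} := by
  classical
  obtain ⟨hN, -⟩ := large_bounds hε hε1 hn
  have hN0 : 0 < (n : ℝ) := by linarith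
  have hn2 : 2 ≤ n := by
    have : (2 : ℝ) ≤ n := by linarith
    exact_mod_cast this
  set m := progSize n ε with hm
  have hloop : ∀ s, Ready G ε c s → s.rreg 3 = 0 → s.nreg 16 = 0 → s.rreg 4 = m →
      s.rreg 2 = (n : ℝ) ^ 6 * (3 / ε) ^ m →
      Ens G (.loop (.rlt 3 2) mainBody) s (progIter n ε * (bodyTime n m + 1) + 1) (fun _ => True)
        (ENNReal.ofReal (1 - 1 / (n : ℝ)))
        (fun s' => if NearOptimal G c (30 * ε) (Config.output n ([], s')) then 1 else 0) := by
    intro s hs h3 h16 h4 h2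
    have hle1 : ENNReal.ofReal (1 - 1 / (n : ℝ)) ≤ 1 := by
      rw [← ENNReal.ofReal_one]
      exact ENNReal.ofReal_le_ofReal (by linarith [one_div_pos.2 hN0])
    obtain ⟨K, hK⟩ := exists_isOptCore G (c := c) (ε := ε) hc hε (by rwa [Fintype.card_fin])
    rcases K.eq_empty_or_nonempty with rfl | hKne
    · have hempty : NearOptimal G c (30 * ε) ∅ :=
        (nearOptimal_empty_of_core hK).mono (by linarith)
      refine (mainLoop_large (q := 0) (δ := 30 * ε) hs h3 h16 h4 h2 le_rfl zero_le_one
        fun s' hs' h4' => (generate_hoare (G := G) hs' hε (by omega) h4').ens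
          fun _ _ => ?_).mono le_rfl (fun _ h => h) ?_ fun _ _ => le_rfl
      · rw [ENNReal.ofReal_zero]
        exact zero_le
      · rwa [if_pos hempty]
    · set q : ℝ := (ε / 3) ^ m / (4 * (n + 1) ^ 3) with hq
      have hq0 : 0 ≤ q := by positivity
      have hq1 : q ≤ 1 := by
        rw [hq, div_le_one (by positivity)]
        have h1 : (ε / 3) ^ m ≤ 1 := pow_le_one₀ (by positivity) (by linarith)
        have h2 : (1 : ℝ) ≤ (n + 1) ^ 3 := one_le_pow₀ (by linarith)
        linarith
      refine (mainLoop_large (q := q) (δ := 30 * ε) hs h3 h16 h4 h2 hq0 hq1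
        fun s' hs' h4' => generate_core hs' hc hε hε1 (by norm_num; exact hn) h4'
          (le_progSize hε (by omega)) hK hKne).mono le_rfl (fun _ h => h) ?_ fun _ _ => le_rfl
      split_ifs
      · exact hle1
      · refine ENNReal.ofReal_le_ofReal ?_
        have : (1 - q) ^ ⌈(n : ℝ) ^ 6 * (3 / ε) ^ m⌉₊ ≤ 1 / n := by
          refine one_sub_pow_le hq1 hN0 ?_
          calc (n : ℝ) ≤ (n : ℝ) ^ 6 / (4 * (n + 1) ^ 3) := by
                rw [le_div_iff₀ (by positivity)]
                have h1 : ((n : ℝ) + 1) ^ 3 ≤ (2 * n) ^ 3 := by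
                  gcongr
                  linarith
                have h2 : 32 * (n : ℝ) ^ 4 ≤ (n : ℝ) ^ 6 := by
                  have : (32 : ℝ) ≤ (n : ℝ) ^ 2 := by nlinarith
                  nlinarith [pow_pos hN0 4]
                nlinarith
            _ = q * ((n : ℝ) ^ 6 * (3 / ε) ^ m) := by
                have : (ε / 3) ^ m * (3 / ε) ^ m = 1 := by
                  rw [← mul_pow, div_mul_div_comm, mul_comm ε 3, div_self (by positivity), one_pow]
                rw [hq]
                calc (n : ℝ) ^ 6 / (4 * (n + 1) ^ 3) =
                    ((ε / 3) ^ m * (3 / ε) ^ m) * (n : ℝ) ^ 6 / (4 * (n + 1) ^ 3) := by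
                      rw [this, one_mul]
                  _ = _ := by ring
            _ ≤ _ := mul_le_mul_of_nonneg_left (Nat.le_ceil _) hq0
        linarith
  have h : Ens G ptas (initStore n ε c) (ptasTime ε n) (fun _ => True)
      (ENNReal.ofReal (1 - 1 / (n : ℝ)))
      (fun s' => if NearOptimal G c (30 * ε) (Config.output n ([], s')) then 1 else 0) := by
    rw [ptasTime, if_pos hn]
    refine Hoare.comp_ens (m * 6 + Nat.clog 2 n * 6 + 110)
      (progIter n ε * (bodyTime n m + 1) + 1) (by rw [hm]; omega) (setupProg_large (G := G) hn) ?_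
    rintro s1 ⟨a, a3, a16, a4, a2⟩ -
    exact hloop s1 a a3 a16 a4 a2
  obtain ⟨h1, h2, -⟩ := Ens.run (A := {S | NearOptimal G c (30 * ε) S}) h
    (fun s => by split_ifs <;> simp) fun s _ hs => by
      by_contra hcon
      exact hs (if_neg hcon)
  exact ⟨h1, h2⟩

end UGSC

/-! ### The sampling algorithm and the additive PTAS -/

theorem mainTheorem4 :
    (∃ C : ℝ, 0 < C ∧
      ∀ ε : ℝ, 0 < ε → ε ≤ 1 / 7 →
      ∀ (n : ℕ) [NeZero n], 2 ^ 2 * 3 ^ 4 / ε ^ 8 ≤ (n : ℝ) →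
      ∀ (G : SimpleGraph (Fin n)) (c : ℝ), 0 < c →
      ∀ solver : Finset (Fin n) → ℕ → (Fin n → ℝ) → (Fin n → ℝ),
        UGSC.IsLPSolver G c ε solver →
        ENNReal.ofReal (1 - 1 / (n : ℝ)) ≤
          (UGSC.algorithm G c ε solver).toOuterMeasure
            {S | UGSC.NearOptimal G c (C * ε) S}) ∧
    (∃ (P : UGSC.Prog) (C : ℝ) (T : ℝ → ℕ → ℕ), 0 < C ∧
      ∀ ε : ℝ, 0 < ε → ε ≤ 1 / 7 →
      ∀ n : ℕ,
        (2 ^ 2 * 3 ^ 4 / ε ^ 8 ≤ (n : ℝ) →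
          (T ε n : ℝ) ≤ (n : ℝ) ^ (C * (Real.log (1 / ε) / ε ^ 4)) ∧
          ∀ (G : SimpleGraph (Fin n)) (c : ℝ), 0 < c →
            P.HaltsWithin G ε c (T ε n) ∧
            ENNReal.ofReal (1 - 1 / (n : ℝ)) ≤
              (P.outputDist G ε c (T ε n)).toOuterMeasure
                {S | UGSC.NearOptimal G c (C * ε) S}) ∧
        ((n : ℝ) < 2 ^ 2 * 3 ^ 4 / ε ^ 8 →
          (T ε n : ℝ) ≤ 2 ^ (C * ((n : ℝ) + 1)) ∧
          ∀ (G : SimpleGraph (Fin n)) (c : ℝ), 0 < c →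
            P.HaltsWithin G ε c (T ε n) ∧
            ∀ S ∈ (P.outputDist G ε c (T ε n)).support, UGSC.NearOptimal G c 0 S)) := by
  constructor
  · refine ⟨30, by norm_num, fun ε hε hε1 n _ hn G c hc solver hsolver => ?_⟩
    have h := UGSC.algorithm_nearOptimal hε hε1 (by rwa [Fintype.card_fin]) G hc hsolver
    rwa [Fintype.card_fin] at h
  · have e : (2 : ℝ) ^ 2 * 3 ^ 4 = 324 := by norm_num
    -- One constant serves the error and both time bounds. The exponent dictates it, and the error
    -- 30ε is weakened accordingly.
    refine ⟨UGSC.ptas, 6014, UGSC.ptasTime, by norm_num, fun ε hε hε1 n => ⟨fun hn => ?_,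
      fun hn => ?_⟩⟩
    · rw [e] at hn
      refine ⟨UGSC.ptasTime_large hε hε1 hn, fun G c hc => ?_⟩
      obtain ⟨h1, h2⟩ := UGSC.ptas_large G hc hε hε1 hn
      refine ⟨h1, h2.trans (MeasureTheory.measure_mono fun S hS => ?_)⟩
      exact UGSC.NearOptimal.mono hS (by linarith)
    · rw [e] at hn
      exact ⟨UGSC.ptasTime_small hn, fun G c _ => UGSC.ptas_small G hn⟩
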